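/- Let $k=\mathbb F_q$ be a finite field, with algebraic closure $\bar k$. For a submonoid $S$ of $(\mathbb Q_{\ge 0},+)$ and a field $K$, let $(\operatorname{Spec}K, S)$ be the spectrum of $K$ with the log structure $\mathcal M=\mathcal O^\times\oplus S$ on the small étale site, where $\alpha(x,0)=x$ and $\alpha(x,s)=0$ for $s\neq 0$; a field extension $K\subseteq L$ and an inclusion $S\subseteq T$ give a morphism of log schemes $(\operatorname{Spec}L,T)\to(\operatorname{Spec}K,S)$. Put $$\mathbb F_q^{\log}=(\operatorname{Spec}k,\mathbb N),\qquad \overline{\mathbb F_q^{\log,\mathrm{ab}}}=\bigl(\operatorname{Spec}\bar k,\tfrac1{q-1}\mathbb N\bigr),\qquad \overline{\mathbb F_q}^{\mathrm{Kum}}=(\operatorname{Spec}\bar k,\mathbb N_{(p)}),$$ where $\mathbb N_{(p)}$ is the monoid of non-negative rational numbers with denominator prime to $p=\operatorname{char}k$; these are the standard log point, its universal abelian Kummer cover and its universal Kummer cover. The last one is a log geometric point of the first. For a log scheme $X$ write $\mathbb G_m^{\log}(X)$ for the group completion of $\Gamma(X,\mathcal M_X)$, and for a log geometric point $\bar s\to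 X$ write $\pi_1^{\log}(X,\bar s)$ for the automorphism group, with the topology of pointwise convergence, of the fibre functor $Y\mapsto\operatorname{Hom}_X(\bar s,Y)$ on finite Kummer étale covers $Y$ of $X$, and $\pi_1^{\log,\mathrm{ab}}$ for its quotient by the closure of its commutator subgroup. An automorphism $g$ of $\bar s$ over $X$ defines the element $y\mapsto y\circ g^{-1}$ of $\pi_1^{\log}(X,\bar s)$. Let $\pi_1^{\log,\mathrm{ab}}(\mathbb F_q^{\log})$ be formed with $\bar s=\overline{\mathbb F_q}^{\mathrm{Kum}}$. **Proposition (local logarithmic class field theory).** There is exactly one homomorphism $$\mathrm{Rec}_{\mathrm{loc}}\colon \mathbb G_m^{\log}(\mathbb F_q^{\log})\to\pi_1^{\log,\mathrm{ab}}(\mathbb F_q^{\log})$$ for which there are group isomorphisms $$\theta\colon\mathbb G_m^{\log}(\mathbb F_q^{\log})\cong\mathbb F_q^\times\times\mathbb Z,\qquad \gamma\colon\mathbb F_q^\times\times\widehat{\mathbb Z}\cong\operatorname{Aut}_{\mathbb F_q^{\log}}\bigl(\overline{\mathbb F_q^{\log,\mathrm{ab}}}\bigr),\qquad \Psi\colon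 \operatorname{Aut}_{\mathbb F_q^{\log}}\bigl(\overline{\mathbb F_q^{\log,\mathrm{ab}}}\bigr)\cong\pi_1^{\log,\mathrm{ab}}(\mathbb F_q^{\log})$$ with the following properties. 1. $\theta$ sends the class of the section $(x,n)\in\mathbb F_q^\times\oplus\mathbb N$ to $(x,n)$. 2. $\gamma(u,t)$ acts on the global sections $\bar k^\times\oplus\frac1{q-1}\mathbb N$ of the log structure (by pullback along $\gamma(u,t)^{-1}$) as $$\bigl(x,\tfrac m{q-1}\bigr)\mapsto\bigl(u^m x^{q^t},\tfrac m{q-1}\bigr);$$ here $x^{q^t}$ is $x^{q^a}$ for any integer $a\ge 0$ with $a\equiv t$ modulo $n$, if $x^{q^n}=x$, $n\geq 1$. 3. Every automorphism $h$ of $\overline{\mathbb F_q^{\log,\mathrm{ab}}}$ over $\mathbb F_q^{\log}$ lifts to an automorphism of $\overline{\mathbb F_q}^{\mathrm{Kum}}$ over $\mathbb F_q^{\log}$, and $\Psi(h)$ is the class of the element of $\pi_1^{\log}(\mathbb F_q^{\log})$ defined by any such lift. 4. $\Psi\circ\gamma\colon\mathbb F_q^\times\times\widehat{\mathbb Z}\to\pi_1^{\log,\mathrm{ab}}(\mathbb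 F_q^{\log})$ is a homeomorphism ($\mathbb F_q^\times$ being discrete). 5. $\mathrm{Rec}_{\mathrm{loc}}=\Psi\circ\gamma\circ(\mathrm{id}\times(\mathbb Z\to\widehat{\mathbb Z}))\circ\theta$. 6. $\mathrm{Rec}_{\mathrm{loc}}$ makes $\pi_1^{\log,\mathrm{ab}}(\mathbb F_q^{\log})$ the profinite completion of $\mathbb G_m^{\log}(\mathbb F_q^{\log})$: it extends to an isomorphism of topological groups from the profinite completion. -/

import Mathlib

open CategoryTheory AlgebraicGeometry Opposite Limits

namespace LogCFT

/-! ### The small étale site -/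

/-- The category of étale schemes over `X`. -/
def Et (X : Scheme.{0}) : Type 1 := X.Etale

namespace Et

instance (X : Scheme.{0}) : Category (Et X) := inferInstanceAs (Category X.Etale)

variable {X : Scheme.{0}}

/-- The étale topology. -/
def topology (X : Scheme.{0}) : GrothendieckTopology (Et X) := X.smallEtaleTopology

/-- The scheme underlying an étale `X`-scheme. -/
def left (U : Et X) : Scheme.{0} := (Scheme.Etale.forget X ⋙ Over.forget X).obj U

/-- The structure morphism of an étale `X`-scheme. -/
def hom (U : Et X) : U.left ⟶ X := ((Scheme.Etale.forget X).obj U).hom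

instance (U : Et X) : Etale U.hom := MorphismProperty.Comma.prop U

/-- An étale morphism to `X` as an étale `X`-scheme. -/
def mk {U : Scheme.{0}} (f : U ⟶ X) [Etale f] : Et X := Scheme.Etale.mk f

/-- The morphism of schemes underlying a morphism of étale `X`-schemes. -/
def homLeft {U V : Et X} (a : U ⟶ V) : U.left ⟶ V.left :=
  (Scheme.Etale.forget X ⋙ Over.forget X).map a

/-- A morphism of étale `X`-schemes from a morphism of schemes over `X`. -/
def homMk {U V : Et X} (g : U.left ⟶ V.left) (h : g ≫ V.hom = U.hom) : U ⟶ V :=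
  MorphismProperty.Over.homMk g h

@[simp] theorem homLeft_w {U V : Et X} (a : U ⟶ V) : homLeft a ≫ V.hom = U.hom :=
  Over.w ((Scheme.Etale.forget X).map a)

@[simp] theorem homLeft_w_assoc {U V : Et X} (a : U ⟶ V) {Y : Scheme.{0}} (f : X ⟶ Y) :
    homLeft a ≫ V.hom ≫ f = U.hom ≫ f := by
  rw [← Category.assoc, homLeft_w]

@[simp] theorem homLeft_homMk {U V : Et X} (g : U.left ⟶ V.left) (h : g ≫ V.hom = U.hom) :
    homLeft (homMk g h) = g := rfl

@[simp] theorem homLeft_id (U : Et X) : homLeft (𝟙 U) = 𝟙 U.left := rfl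

@[simp] theorem homLeft_comp {U V W : Et X} (a : U ⟶ V) (b : V ⟶ W) :
    homLeft (a ≫ b) = homLeft a ≫ homLeft b := rfl

/-- The functor sending an étale `X`-scheme to its underlying scheme. -/
def toScheme (X : Scheme.{0}) : Et X ⥤ Scheme.{0} where
  obj U := U.left
  map a := homLeft a

theorem hom_ext {U V : Et X} {a b : U ⟶ V} (h : homLeft a = homLeft b) : a = b :=
  (Scheme.Etale.forget X ⋙ Over.forget X).map_injective h

/-- Pullback of étale schemes along a morphism of schemes. -/
noncomputable def pull {Y : Scheme.{0}} (f : Y ⟶ X) (W : Et X) : Et Y :=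
  mk (pullback.snd W.hom f)

/-- The projection from the pullback. -/
noncomputable def pullFst {Y : Scheme.{0}} (f : Y ⟶ X) (W : Et X) : (pull f W).left ⟶ W.left :=
  pullback.fst W.hom f

theorem pull_condition {Y : Scheme.{0}} (f : Y ⟶ X) (W : Et X) :
    pullFst f W ≫ W.hom = (pull f W).hom ≫ f := pullback.condition

/-- The map to the pullback. -/
noncomputable def pullLift {Y T : Scheme.{0}} (f : Y ⟶ X) (W : Et X) (a : T ⟶ W.left) (b : T ⟶ Y)
    (h : a ≫ W.hom = b ≫ f) : T ⟶ (pull f W).left := pullback.lift a b h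

@[simp] theorem pullLift_fst {Y T : Scheme.{0}} (f : Y ⟶ X) (W : Et X) (a : T ⟶ W.left)
    (b : T ⟶ Y) (h : a ≫ W.hom = b ≫ f) : pullLift f W a b h ≫ pullFst f W = a :=
  pullback.lift_fst _ _ _

@[simp] theorem pullLift_hom {Y T : Scheme.{0}} (f : Y ⟶ X) (W : Et X) (a : T ⟶ W.left)
    (b : T ⟶ Y) (h : a ≫ W.hom = b ≫ f) : pullLift f W a b h ≫ (pull f W).hom = b :=
  pullback.lift_snd _ _ _

theorem pull_hom_ext {Y T : Scheme.{0}} {f : Y ⟶ X} {W : Et X} {a b : T ⟶ (pull f W).left}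
    (h₁ : a ≫ pullFst f W = b ≫ pullFst f W)
    (h₂ : a ≫ (pull f W).hom = b ≫ (pull f W).hom) : a = b :=
  pullback.hom_ext h₁ h₂

end Et

/-! ### Logarithmic schemes -/

/-- A logarithmic scheme: a scheme with a sheaf of commutative monoids `M` on its small étale site
and a multiplicative map `α : M → 𝒪` which is an isomorphism over the units of `𝒪`. -/
structure LogScheme where
  /-- the underlying scheme -/
  scheme : Scheme.{0}
  /-- the sheaf of monoids -/
  M : (Et scheme)ᵒᵖ ⥤ CommMonCat.{0}
  isSheaf : Presheaf.IsSheaf (Et.topology scheme) (M ⋙ forget CommMonCat)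
  /-- the structure map to the (multiplicative monoid of the) structure sheaf -/
  α : ∀ U : Et scheme, M.obj (op U) →* Γ(U.left, ⊤)
  α_res : ∀ {U V : Et scheme} (a : V ⟶ U) (m : M.obj (op U)),
    α V ((M.map a.op).hom m) = (Et.homLeft a).appTop (α U m)
  existsUnique_unit : ∀ (U : Et scheme) (u : Γ(U.left, ⊤)ˣ),
    ∃! m : M.obj (op U), α U m = (u : Γ(U.left, ⊤))

namespace LogScheme

/-- Sections of the log structure over an étale `U`. -/
abbrev sec (X : LogScheme) (U : Et X.scheme) : Type := X.M.obj (op U)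

/-- Restriction of sections of the log structure. -/
def res (X : LogScheme) {U V : Et X.scheme} (a : V ⟶ U) : X.sec U →* X.sec V :=
  (X.M.map a.op).hom

theorem res_id (X : LogScheme) {U : Et X.scheme} (m : X.sec U) : X.res (𝟙 U) m = m := by
  simp [res]

theorem res_res (X : LogScheme) {U V W : Et X.scheme} (a : V ⟶ U) (b : W ⟶ V) (m : X.sec U) :
    X.res b (X.res a m) = X.res (b ≫ a) m := by
  simp [res]

/-- The final object of the small étale site. -/
def top (X : LogScheme) : Et X.scheme := Et.mk (𝟙 X.scheme)

/-- A morphism of log schemes: a morphism `base` of schemes and a map of sheaves of monoids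
`base⁻¹ M_Y → M_X` compatible with the structure maps. The sheaf map is given through its effect
on sections: for `U` étale over `X`, `V` étale over `Y` and `g : U → V` over `base`, a monoid
homomorphism `M_Y(V) → M_X(U)`, natural in `U` and `V`. -/
structure Hom (X Y : LogScheme) where
  /-- the underlying morphism of schemes -/
  base : X.scheme ⟶ Y.scheme
  /-- the map on the sheaves of monoids -/
  flat : ∀ (U : Et X.scheme) (V : Et Y.scheme) (g : U.left ⟶ V.left),
    g ≫ V.hom = U.hom ≫ base → (Y.sec V →* X.sec U)
  res_flat : ∀ {U' U : Et X.scheme} {V : Et Y.scheme} (a : U' ⟶ U) (g : U.left ⟶ V.left)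
    (h : g ≫ V.hom = U.hom ≫ base) (h' : (Et.homLeft a ≫ g) ≫ V.hom = U'.hom ≫ base)
    (m : Y.sec V), X.res a (flat U V g h m) = flat U' V (Et.homLeft a ≫ g) h' m
  flat_res : ∀ {U : Et X.scheme} {V' V : Et Y.scheme} (b : V' ⟶ V) (g : U.left ⟶ V'.left)
    (h : g ≫ V'.hom = U.hom ≫ base) (h' : (g ≫ Et.homLeft b) ≫ V.hom = U.hom ≫ base)
    (m : Y.sec V), flat U V' g h (Y.res b m) = flat U V (g ≫ Et.homLeft b) h' m
  α_flat : ∀ (U : Et X.scheme) (V : Et Y.scheme) (g : U.left ⟶ V.left)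
    (h : g ≫ V.hom = U.hom ≫ base) (m : Y.sec V),
    X.α U (flat U V g h m) = g.appTop (Y.α V m)

theorem Hom.ext' {X Y : LogScheme} {f f' : Hom X Y} (hb : f.base = f'.base)
    (hf : ∀ U V g h h' m, f.flat U V g h m = f'.flat U V g h' m) : f = f' := by
  obtain ⟨b, fl, _, _, _⟩ := f
  obtain ⟨b', fl', _, _, _⟩ := f'
  obtain rfl : b = b' := hb
  obtain rfl : fl = fl' := by
    funext U V g h
    exact MonoidHom.ext fun m => hf U V g h h m
  rfl

theorem Hom.flat_congr {X Y : LogScheme} (f : Hom X Y) {U : Et X.scheme} {V : Et Y.scheme}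
    {g g' : U.left ⟶ V.left} (e : g = g') (h : g ≫ V.hom = U.hom ≫ f.base) (m : Y.sec V) :
    f.flat U V g h m = f.flat U V g' (e ▸ h) m := by
  subst e; rfl

/-- The identity morphism. -/
def Hom.id (X : LogScheme) : Hom X X where
  base := 𝟙 _
  flat U V g h := X.res (Et.homMk g (h.trans (Category.comp_id _)))
  res_flat a g h h' m := X.res_res _ _ _
  flat_res b g h h' m := X.res_res _ _ _
  α_flat U V g h m := X.α_res _ m

/-- Composition of morphisms. -/
noncomputable def Hom.comp {X Y Z : LogScheme} (f : Hom X Y) (g : Hom Y Z) : Hom X Z where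
  base := f.base ≫ g.base
  flat U W k h :=
    (f.flat U (Et.pull g.base W)
      (Et.pullLift g.base W k (U.hom ≫ f.base) (by simpa using h)) (Et.pullLift_hom _ _ _ _ _)).comp
    (g.flat (Et.pull g.base W) W (Et.pullFst g.base W) (Et.pull_condition _ _))
  res_flat {U' U W} a k h h' m := by
    simp only [MonoidHom.comp_apply]
    rw [f.res_flat _ _ _ (by simp)]
    refine f.flat_congr ?_ _ _
    apply Et.pull_hom_ext <;> simp
  flat_res {U W' W} b k h h' m := by
    simp only [MonoidHom.comp_apply]
    rw [g.flat_res b _ _ (by simp [Et.pull_condition])]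
    let c : Et.pull g.base W' ⟶ Et.pull g.base W := Et.homMk
      (Et.pullLift g.base W (Et.pullFst g.base W' ≫ Et.homLeft b) (Et.pull g.base W').hom
        (by simp [Et.pull_condition])) (by simp)
    have hc : Et.homLeft c ≫ Et.pullFst g.base W = Et.pullFst g.base W' ≫ Et.homLeft b := by
      simp [c]
    rw [g.flat_congr hc.symm, ← g.res_flat c _ (Et.pull_condition _ _), f.flat_res c _ _ (by simp)]
    refine f.flat_congr ?_ _ _
    apply Et.pull_hom_ext
    · rw [Category.assoc, hc, ← Category.assoc]; simp
    · simp
  α_flat U W k h m := by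
    simp only [MonoidHom.comp_apply]
    rw [f.α_flat, g.α_flat, ← CommRingCat.comp_apply, ← Scheme.Hom.comp_appTop, Et.pullLift_fst]

/-- The composition may be computed through any étale `V` that fits in between. -/
theorem Hom.comp_flat {X Y Z : LogScheme} (f : Hom X Y) (g : Hom Y Z) {U : Et X.scheme}
    {V : Et Y.scheme} {W : Et Z.scheme} (a : U.left ⟶ V.left) (b : V.left ⟶ W.left)
    (ha : a ≫ V.hom = U.hom ≫ f.base) (hb : b ≫ W.hom = V.hom ≫ g.base)
    (k : U.left ⟶ W.left) (hk : k = a ≫ b) (h : k ≫ W.hom = U.hom ≫ (f.comp g).base)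
    (m : Z.sec W) :
    (f.comp g).flat U W k h m = f.flat U V a ha (g.flat V W b hb m) := by
  subst hk
  let c : V ⟶ Et.pull g.base W := Et.homMk (Et.pullLift g.base W b V.hom hb) (by simp)
  have hc : b = Et.homLeft c ≫ Et.pullFst g.base W := by simp [c]
  rw [g.flat_congr hc, ← g.res_flat c _ (Et.pull_condition _ _), f.flat_res c a ha (by simp [ha])]
  refine f.flat_congr ?_ _ _
  apply Et.pull_hom_ext
  · rw [Category.assoc, ← hc]; simp
  · simp [ha]

noncomputable instance : Category LogScheme where
  Hom := Hom
  id := Hom.id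
  comp := Hom.comp
  id_comp {X Y} f := by
    refine Hom.ext' (Category.id_comp _) fun U V g h h' m => ?_
    rw [Hom.comp_flat (Hom.id X) f (V := U) (𝟙 _) g (by simp [Hom.id]) h' g (by simp) h]
    exact X.res_id _
  comp_id {X Y} f := by
    refine Hom.ext' (Category.comp_id _) fun U V g h h' m => ?_
    rw [Hom.comp_flat f (Hom.id Y) (V := V) g (𝟙 _) h' (by simp [Hom.id]) g (by simp) h]
    exact congrArg _ (Y.res_id _)
  assoc {X Y Z T} f g h := by
    refine Hom.ext' (Category.assoc _ _ _) fun U W k e e' m => ?_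
    let V := Et.pull h.base W
    let V' := Et.pull g.base V
    have e0 : k ≫ W.hom = (U.hom ≫ f.base ≫ g.base) ≫ h.base := by
      rw [e]; exact (Category.assoc _ _ _).symm
    let a : U.left ⟶ V.left := Et.pullLift h.base W k (U.hom ≫ f.base ≫ g.base) e0
    have ha : a ≫ V.hom = (U.hom ≫ f.base) ≫ g.base := by simp [a, V]
    let a' : U.left ⟶ V'.left := Et.pullLift g.base V a (U.hom ≫ f.base) ha
    have ha' : a' ≫ V'.hom = U.hom ≫ f.base := by simp [a', V']
    have h1 : a = a' ≫ Et.pullFst g.base V := by simp [a']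
    have h2 : k = a ≫ Et.pullFst h.base W := by simp [a]
    have c1 : Et.pullFst g.base V ≫ V.hom = V'.hom ≫ g.base := Et.pull_condition _ _
    have c2 : Et.pullFst h.base W ≫ W.hom = V.hom ≫ h.base := Et.pull_condition _ _
    have c3 : (Et.pullFst g.base V ≫ Et.pullFst h.base W) ≫ W.hom =
        V'.hom ≫ g.base ≫ h.base := by
      rw [Category.assoc, c2, ← Category.assoc, c1, Category.assoc]
    rw [Hom.comp_flat (f.comp g) h a (Et.pullFst h.base W)
        (ha.trans (Category.assoc _ _ _)) c2 k h2 e,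
      Hom.comp_flat f g a' (Et.pullFst g.base V) ha' c1 a h1,
      Hom.comp_flat f (g.comp h) a' (Et.pullFst g.base V ≫ Et.pullFst h.base W)
        ha' c3 k (by rw [← Category.assoc, ← h1, ← h2]) e',
      Hom.comp_flat g h (Et.pullFst g.base V) (Et.pullFst h.base W) c1 c2 _ rfl c3]

/-- The effect of a morphism on global sections of the log structures. -/
noncomputable def globalFlat {X Y : LogScheme} (f : X ⟶ Y) : Y.sec Y.top →* X.sec X.top :=
  Hom.flat f X.top Y.top (Hom.base f)
    ((Category.comp_id _).trans (Category.id_comp _).symm)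

/-- The value at `X` of the functor `𝔾ₘ^log`: the group completion of the monoid of global
sections of the log structure. -/
abbrev Gmlog (X : LogScheme) : Type := Algebra.GrothendieckGroup (X.sec X.top)

/-! ### Charts, Kummer étale morphisms -/

/-- A commutative monoid is fs: finitely generated, cancellative, and saturated in its group
completion. -/
def IsFSMonoid (P : Type) [CommMonoid P] : Prop :=
  Monoid.FG P ∧ (∀ a b c : P, a * b = a * c → b = c) ∧
    ∀ (a b : P) (n : ℕ), n ≠ 0 → b ^ n ∣ a ^ n → b ∣ a

/-- A monoid homomorphism `c : P → M(U)` is a chart over `U`: the log structure associated to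
`P → 𝒪`, which is the pushout of `P ← α⁻¹(𝒪ˣ) → 𝒪ˣ`, maps isomorphically to `M` over `U`.
The first condition is surjectivity, the second one injectivity, both étale locally. The units of
`𝒪` are written as the sections `e` of `M` with `α e` invertible. -/
def IsChart (X : LogScheme) (U : Et X.scheme) {P : Type} [CommMonoid P] (c : P →* X.sec U) :
    Prop :=
  (∀ (V : Et X.scheme) (j : V ⟶ U) (m : X.sec V) (x : V.left),
    ∃ (W : Et X.scheme) (a : W ⟶ V) (e : X.sec W) (p : P), x ∈ Set.range (Et.homLeft a) ∧
      IsUnit (X.α W e) ∧ X.res a m = e * X.res (a ≫ j) (c p)) ∧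
  (∀ (V : Et X.scheme) (j : V ⟶ U) (e e' : X.sec V) (p p' : P),
    IsUnit (X.α V e) → IsUnit (X.α V e') → e * X.res j (c p) = e' * X.res j (c p') →
    ∀ x : V.left, ∃ (W : Et X.scheme) (a : W ⟶ V) (s s' : P), x ∈ Set.range (Et.homLeft a) ∧
      IsUnit (X.α W (X.res (a ≫ j) (c s))) ∧ IsUnit (X.α W (X.res (a ≫ j) (c s'))) ∧
      p * s = p' * s' ∧ X.res a e * X.res (a ≫ j) (c s') = X.res a e' * X.res (a ≫ j) (c s))

/-- A log scheme is fs: étale locally it has charts by fs monoids. -/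
def IsFS (X : LogScheme) : Prop :=
  ∀ x : X.scheme, ∃ (U : Et X.scheme) (P : Type) (_ : CommMonoid P) (c : P →* X.sec U),
    x ∈ Set.range U.hom ∧ IsFSMonoid P ∧ X.IsChart U c

/-- The morphism `U → Spec ℤ[P]` defined by a monoid homomorphism `P → M(U)`. -/
noncomputable def toSpec (X : LogScheme) (U : Et X.scheme) {P : Type} [CommMonoid P]
    (c : P →* X.sec U) : U.left ⟶ Spec (CommRingCat.of (MonoidAlgebra ℤ P)) :=
  U.left.toSpecΓ ≫ Spec.map (CommRingCat.ofHom
    (MonoidAlgebra.lift ℤ Γ(U.left, ⊤) P ((X.α U).comp c)).toRingHom)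

/-- The morphism `Spec ℤ[P] → Spec ℤ[Q]` defined by a monoid homomorphism `Q → P`. -/
noncomputable def specMap {Q P : Type} [CommMonoid Q] [CommMonoid P] (φ : Q →* P) :
    Spec (CommRingCat.of (MonoidAlgebra ℤ P)) ⟶ Spec (CommRingCat.of (MonoidAlgebra ℤ Q)) :=
  Spec.map (CommRingCat.ofHom (MonoidAlgebra.mapDomainRingHom ℤ φ))

/-- The homomorphism of group completions induced by a homomorphism of monoids. -/
noncomputable def gpMap {Q P : Type} [CommMonoid Q] [CommMonoid P] (φ : Q →* P) :
    Algebra.GrothendieckGroup Q →* Algebra.GrothendieckGroup P :=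
  Algebra.GrothendieckGroup.lift (Algebra.GrothendieckGroup.of.comp φ)

/-- A morphism `f : Y → X` of fs log schemes is log étale: étale locally on `Y` and `X` it has a
chart `φ : Q → P` by fs monoids such that the kernel and the cokernel of `φ^gp` are finite of order
invertible on `Y`, and such that `Y → X ×_{Spec ℤ[Q]} Spec ℤ[P]` is étale. -/
def IsLogEtale {Y X : LogScheme} (f : Y ⟶ X) : Prop :=
  ∀ y : Y.scheme, ∃ (U : Et X.scheme) (V : Et Y.scheme) (g : V.left ⟶ U.left)
    (hg : g ≫ U.hom = V.hom ≫ Hom.base f)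
    (Q P : Type) (_ : CommMonoid Q) (_ : CommMonoid P) (φ : Q →* P)
    (cQ : Q →* X.sec U) (cP : P →* Y.sec V),
    y ∈ Set.range V.hom ∧ IsFSMonoid Q ∧ IsFSMonoid P ∧ X.IsChart U cQ ∧ Y.IsChart V cP ∧
    cP.comp φ = (Hom.flat f V U g hg).comp cQ ∧
    Finite (gpMap φ).ker ∧ IsUnit (Nat.card (gpMap φ).ker : Γ(V.left, ⊤)) ∧
    Finite (Algebra.GrothendieckGroup P ⧸ (gpMap φ).range) ∧
    IsUnit (Nat.card (Algebra.GrothendieckGroup P ⧸ (gpMap φ).range) : Γ(V.left, ⊤)) ∧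
    ∃ h : g ≫ X.toSpec U cQ = Y.toSpec V cP ≫ specMap φ,
      Etale (pullback.lift g (Y.toSpec V cP) h)

/-- A morphism `f : Y → X` of log schemes is Kummer: for all geometric points `ȳ` of `Y` the map
`M_{X,f(ȳ)}/𝒪ˣ → M_{Y,ȳ}/𝒪ˣ` is injective and every element of the target has a power, with
positive exponent, in the image. -/
def IsKummer {Y X : LogScheme} (f : Y ⟶ X) : Prop :=
  (∀ (V : Et Y.scheme) (m : Y.sec V) (y : V.left),
    ∃ (W : Et Y.scheme) (a : W ⟶ V) (U : Et X.scheme) (g : W.left ⟶ U.left)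
      (hg : g ≫ U.hom = W.hom ≫ Hom.base f) (m' : X.sec U) (e : Y.sec W) (n : ℕ),
      y ∈ Set.range (Et.homLeft a) ∧ n ≠ 0 ∧ IsUnit (Y.α W e) ∧
      Y.res a m ^ n = e * Hom.flat f W U g hg m') ∧
  (∀ (V : Et Y.scheme) (U : Et X.scheme) (g : V.left ⟶ U.left)
      (hg : g ≫ U.hom = V.hom ≫ Hom.base f) (m m' : X.sec U) (e : Y.sec V),
    IsUnit (Y.α V e) → Hom.flat f V U g hg m = e * Hom.flat f V U g hg m' →
    ∀ y : V.left, ∃ (U' : Et X.scheme) (b : U' ⟶ U) (e' : X.sec U'),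
      g y ∈ Set.range (Et.homLeft b) ∧ IsUnit (X.α U' e') ∧ X.res b m = e' * X.res b m')

/-! ### The logarithmic fundamental group -/

/-- The finite Kummer étale covers of `X`, among the log schemes over `X`. -/
def isFiniteKummerEtale (X : LogScheme) : ObjectProperty (Over X) := fun Y =>
  Y.left.IsFS ∧ IsFinite (Hom.base Y.hom) ∧ IsKummer Y.hom ∧ IsLogEtale Y.hom

/-- The category of finite Kummer étale covers of `X`; morphisms are the morphisms of log schemes
over `X`. -/
abbrev KCov (X : LogScheme) : Type 1 := (isFiniteKummerEtale X).FullSubcategory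

/-- The fibre functor at a log geometric point `s → X`: it sends a cover `Y → X` to the set of
morphisms `s → Y` over `X`. -/
noncomputable def Fib {X : LogScheme} (s : Over X) : KCov X ⥤ Type 1 :=
  (isFiniteKummerEtale X).ι ⋙ coyoneda.obj (op s)

/-- The logarithmic fundamental group: the automorphism group of the fibre functor. -/
abbrev LogPi1 {X : LogScheme} (s : Over X) : Type 1 := Aut (Fib s)

/-- The action of the fundamental group on a fibre. -/
def LogPi1.act {X : LogScheme} {s : Over X} (σ : LogPi1 s) (Y : KCov X) (y : (Fib s).obj Y) :
    (Fib s).obj Y := σ.hom.app Y y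

theorem LogPi1.act_mul {X : LogScheme} {s : Over X} (σ τ : LogPi1 s) (Y : KCov X)
    (y : (Fib s).obj Y) : (σ * τ).act Y y = σ.act Y (τ.act Y y) := rfl

theorem LogPi1.act_one {X : LogScheme} {s : Over X} (Y : KCov X)
    (y : (Fib s).obj Y) : (1 : LogPi1 s).act Y y = y := rfl

/-- The topology of the fundamental group: the topology of pointwise convergence on the
(discrete) fibres. -/
instance {X : LogScheme} (s : Over X) : TopologicalSpace (LogPi1 s) :=
  ⨅ (Y : KCov X) (y : (Fib s).obj Y), TopologicalSpace.induced (fun σ => σ.act Y y) ⊥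

theorem LogPi1.isOpen_act {X : LogScheme} {s : Over X} (Y : KCov X) (y z : (Fib s).obj Y) :
    IsOpen {σ : LogPi1 s | σ.act Y y = z} := by
  let _ : TopologicalSpace ((Fib s).obj Y) := ⊥
  have _ : DiscreteTopology ((Fib s).obj Y) := ⟨rfl⟩
  have h : Continuous (fun σ : LogPi1 s => σ.act Y y) :=
    continuous_iInf_dom (i := Y) (continuous_iInf_dom (i := y) continuous_induced_dom)
  exact (isOpen_discrete {z}).preimage h

theorem LogPi1.continuous_iff {X : LogScheme} {s : Over X} {T : Type*} [TopologicalSpace T]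
    (F : T → LogPi1 s) : Continuous F ↔
      ∀ (Y : KCov X) (y z : (Fib s).obj Y), IsOpen {t | (F t).act Y y = z} := by
  constructor
  · intro h Y y z
    exact (isOpen_act Y y z).preimage h
  · intro h
    refine continuous_iInf_rng.2 fun Y => continuous_iInf_rng.2 fun y => continuous_induced_rng.2 ?_
    let _ : TopologicalSpace ((Fib s).obj Y) := ⊥
    have _ : DiscreteTopology ((Fib s).obj Y) := ⟨rfl⟩
    exact continuous_discrete_rng.2 fun z => h Y y z

instance {X : LogScheme} (s : Over X) : IsTopologicalGroup (LogPi1 s) where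
  continuous_mul := by
    rw [LogPi1.continuous_iff]
    intro Y y z
    have : {t : LogPi1 s × LogPi1 s | (t.1 * t.2).act Y y = z} =
        ⋃ w : (Fib s).obj Y, {σ | σ.act Y w = z} ×ˢ {τ | τ.act Y y = w} := by
      ext ⟨σ, τ⟩
      simp [LogPi1.act_mul]
    rw [this]
    exact isOpen_iUnion fun w => (LogPi1.isOpen_act Y w z).prod (LogPi1.isOpen_act Y y w)
  continuous_inv := by
    rw [LogPi1.continuous_iff]
    intro Y y z
    have : {t : LogPi1 s | (t⁻¹).act Y y = z} = {t : LogPi1 s | t.act Y z = y} := by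
      ext t
      constructor
      · rintro rfl
        simp only [Set.mem_ofPred_eq]
        rw [← LogPi1.act_mul, mul_inv_cancel, LogPi1.act_one]
      · rintro rfl
        simp only [Set.mem_ofPred_eq]
        rw [← LogPi1.act_mul, inv_mul_cancel, LogPi1.act_one]
    rw [this]
    exact LogPi1.isOpen_act Y z y

/-- The abelianized logarithmic fundamental group: the quotient by the closure of the commutator
subgroup. -/
abbrev LogPi1Ab {X : LogScheme} (s : Over X) : Type 1 := TopologicalAbelianization (LogPi1 s)

/-- An automorphism `g` of the log geometric point `s` over `X` acts on the fibre functor by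
`y ↦ y ∘ g⁻¹`. -/
noncomputable def deck {X : LogScheme} (s : Over X) : Aut s →* LogPi1 s where
  toFun g := NatIso.ofComponents (fun Y => Equiv.toIso
    { toFun := fun y : s ⟶ Y.obj => g.inv ≫ y
      invFun := fun y : s ⟶ Y.obj => g.hom ≫ y
      left_inv := fun y => g.hom_inv_id_assoc y
      right_inv := fun y => g.inv_hom_id_assoc y }) (by
        intro Y Z f
        ext y
        exact (Category.assoc g.inv (show s ⟶ Y.obj from y) f.hom).symm)
  map_one' := by
    ext Y y
    exact Category.id_comp (show s ⟶ Y.obj from y)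
  map_mul' g h := by
    ext Y y
    exact Category.assoc g.inv h.inv (show s ⟶ Y.obj from y)

end LogScheme

open LogScheme


/-! ### Sheaf conditions -/

theorem isContinuous_overForget (P : MorphismProperty Scheme.{0}) [P.IsMultiplicative]
    [P.IsStableUnderBaseChange] [P.HasOfPostcompProperty P] (X : Scheme.{0}) :
    (MorphismProperty.Over.forget P ⊤ X ⋙ Over.forget X).IsContinuous
      (X.smallGrothendieckTopology (P := P) (Q := P)) (Scheme.grothendieckTopology P) := by
  have : (MorphismProperty.Over.forget P ⊤ X).IsContinuous
      (X.smallGrothendieckTopology (P := P) (Q := P))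
      ((Scheme.grothendieckTopology P).over X) := by
    have : PreservesFiniteLimits (MorphismProperty.Over.forget P ⊤ X) := inferInstance
    have := flat_of_preservesFiniteLimits (MorphismProperty.Over.forget P ⊤ X)
    rw [Functor.isContinuous_iff_coverPreserving]
    exact Functor.coverPreserving_restrictedTopology _ _
  exact Functor.isContinuous_comp _ _ _ ((Scheme.grothendieckTopology P).over X) _

theorem isSheaf_restrict (X : Scheme.{0}) (F : Scheme.{0}ᵒᵖ ⥤ Type)
    (h : Presheaf.IsSheaf Scheme.etaleTopology F) :
    Presheaf.IsSheaf X.smallEtaleTopology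
      ((Scheme.Etale.forget X ⋙ Over.forget X).op ⋙ F) :=
  have : (Scheme.Etale.forget X ⋙ Over.forget X).IsContinuous X.smallEtaleTopology
      Scheme.etaleTopology :=
    isContinuous_overForget (@Etale : MorphismProperty Scheme.{0}) X
  Functor.op_comp_isSheaf_of_isSheaf _ _ _ _ h

theorem isSheaf_structureSheaf :
    Presheaf.IsSheaf Scheme.etaleTopology.{0} (Scheme.Γ.{0} ⋙ forget CommRingCat.{0}) := by
  have : Scheme.etaleTopology.{0}.Subcanonical :=
    .of_le (Scheme.etaleTopology_le_proetaleTopology)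
  have h := (GrothendieckTopology.Subcanonical.isSheaf_of_isRepresentable
    (J := Scheme.etaleTopology.{0})
    (yoneda.obj (Spec (.of (MvPolynomial PUnit.{1} (ULift ℤ))))))
  rw [← isSheaf_iff_isSheaf_of_type] at h
  let e : yoneda.obj (Spec (.of (MvPolynomial PUnit.{1} (ULift ℤ)))) ≅
      (Scheme.Γ.{0} ⋙ forget CommRingCat.{0}) :=
    NatIso.ofComponents (fun U => Equiv.toIso
      ((AffineSpace.toSpecMvPolyIntEquiv PUnit (X := U.unop)).trans (Equiv.funUnique PUnit _)))
      (by intro U V f; ext g; rfl)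
  exact (Presheaf.isSheaf_of_iso_iff e).1 h

/-- The presheaf of locally constant functions. -/
def lcPresheaf (P : Type) : Scheme.{0}ᵒᵖ ⥤ Type where
  obj U := LocallyConstant U.unop P
  map f := ↾(LocallyConstant.comap f.unop.base.hom)

theorem isSheaf_lcPresheaf (P : Type) :
    Presheaf.IsSheaf Scheme.etaleTopology.{0} (lcPresheaf P) := by
  let _ : TopologicalSpace P := ⊥
  have _ : DiscreteTopology P := ⟨rfl⟩
  have h := isSheaf_fpqcTopology_continuousMapPresheaf.{0} P
  rw [isSheaf_iff_isSheaf_of_type] at h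
  have h := Presieve.isSheaf_of_le _ (Scheme.etaleTopology_le_proetaleTopology.trans
    Scheme.proetaleTopology_le_fpqcTopology) h
  rw [← isSheaf_iff_isSheaf_of_type] at h
  let e : continuousMapPresheaf P ≅ lcPresheaf P :=
    NatIso.ofComponents (fun U => Equiv.toIso
      { toFun := fun f : C(U.unop, P) => ⟨f, (IsLocallyConstant.iff_continuous _).2 f.continuous⟩
        invFun := fun f : LocallyConstant U.unop P => (f : C(U.unop, P))
        left_inv := fun _ => rfl
        right_inv := fun _ => rfl })
      (by intro U V f; ext g; rfl)
  exact (Presheaf.isSheaf_of_iso_iff e).1 h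

/-- The map `(u, f) ↦ (g^* u, φ ∘ f ∘ g)` on pairs of a unit and a locally constant function. -/
def constPull {U V : Scheme.{0}} {Q P : Type} [CommMonoid Q] [CommMonoid P] (g : V ⟶ U)
    (φ : Q →* P) : Γ(U, ⊤)ˣ × LocallyConstant U Q →* Γ(V, ⊤)ˣ × LocallyConstant V P where
  toFun m := (Units.map g.appTop.hom.toMonoidHom m.1, (m.2.comap g.base.hom).map φ)
  map_one' := by
    refine Prod.ext (map_one _) ?_
    ext x
    exact map_one φ
  map_mul' m m' := by
    refine Prod.ext (map_mul _ _ _) ?_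
    ext x
    exact map_mul φ _ _

theorem constPull_id {U : Scheme.{0}} {P : Type} [CommMonoid P]
    (m : Γ(U, ⊤)ˣ × LocallyConstant U P) : constPull (𝟙 U) (MonoidHom.id P) m = m := by
  refine Prod.ext (Units.ext ?_) rfl
  simp [constPull]

theorem constPull_comp {U V W : Scheme.{0}} {Q P R : Type} [CommMonoid Q] [CommMonoid P]
    [CommMonoid R] (g : V ⟶ U) (h : W ⟶ V) (φ : Q →* P) (ψ : P →* R)
    (m : Γ(U, ⊤)ˣ × LocallyConstant U Q) :
    constPull h ψ (constPull g φ m) = constPull (h ≫ g) (ψ.comp φ) m := by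
  refine Prod.ext (Units.ext ?_) rfl
  change h.appTop (g.appTop (m.1 : Γ(U, ⊤))) = (h ≫ g).appTop (m.1 : Γ(U, ⊤))
  rw [Scheme.Hom.comp_appTop, CommRingCat.comp_apply]

/-- The presheaf of monoids `𝒪ˣ × P` with `P` the constant sheaf. -/
def constMonoid (P : Type) [CommMonoid P] : Scheme.{0}ᵒᵖ ⥤ CommMonCat.{0} where
  obj U := CommMonCat.of (Γ(U.unop, ⊤)ˣ × LocallyConstant U.unop P)
  map f := CommMonCat.ofHom (constPull f.unop (MonoidHom.id P))
  map_id U := by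
    ext m : 2
    exact constPull_id m
  map_comp f g := by
    ext m : 2
    exact (constPull_comp f.unop g.unop (MonoidHom.id P) (MonoidHom.id P) m).symm

theorem isSheaf_constMonoid (P : Type) [CommMonoid P] :
    Presheaf.IsSheaf Scheme.etaleTopology.{0} (constMonoid P ⋙ forget CommMonCat) := by
  rw [isSheaf_iff_isSheaf_of_type]
  have hΓ := (isSheaf_iff_isSheaf_of_type _ _).1 isSheaf_structureSheaf
  have hP := (isSheaf_iff_isSheaf_of_type _ _).1 (isSheaf_lcPresheaf P)
  intro U S hS x hx
  let val : Presieve.FamilyOfElements (Scheme.Γ.{0} ⋙ forget CommRingCat.{0}) S.arrows :=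
    fun V f hf => ((x f hf).1 : Γ(V, ⊤))
  let inv : Presieve.FamilyOfElements (Scheme.Γ.{0} ⋙ forget CommRingCat.{0}) S.arrows :=
    fun V f hf => (((x f hf).1)⁻¹ : Γ(V, ⊤)ˣ).val
  let lc : Presieve.FamilyOfElements (lcPresheaf P) S.arrows :=
    fun V f hf => (x f hf).2
  have hval : val.Compatible := fun V₁ V₂ W g₁ g₂ f₁ f₂ h₁ h₂ e =>
    congr(($(hx g₁ g₂ h₁ h₂ e)).1.val)
  have hinv : inv.Compatible := fun V₁ V₂ W g₁ g₂ f₁ f₂ h₁ h₂ e =>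
    congr(($(hx g₁ g₂ h₁ h₂ e)).1.inv)
  have hlc : lc.Compatible := fun V₁ V₂ W g₁ g₂ f₁ f₂ h₁ h₂ e =>
    congr(($(hx g₁ g₂ h₁ h₂ e)).2)
  have sep := (hΓ S hS).isSeparatedFor
  let a : Γ(U, ⊤) := (hΓ S hS).amalgamate val hval
  let b : Γ(U, ⊤) := (hΓ S hS).amalgamate inv hinv
  let c : LocallyConstant U P := (hP S hS).amalgamate lc hlc
  have ha : ∀ {V} (f : V ⟶ U) (hf : S f), f.appTop a = val f hf :=
    fun f hf => (hΓ S hS).valid_glue hval f hf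
  have hb : ∀ {V} (f : V ⟶ U) (hf : S f), f.appTop b = inv f hf :=
    fun f hf => (hΓ S hS).valid_glue hinv f hf
  have hc : ∀ {V} (f : V ⟶ U) (hf : S f), LocallyConstant.comap f.base.hom c = lc f hf :=
    fun f hf => (hP S hS).valid_glue hlc f hf
  have hab : a * b = 1 := by
    refine sep.ext fun V f hf => ?_
    change f.appTop (a * b) = f.appTop 1
    rw [map_mul, ha f hf, hb f hf, map_one]
    exact (x f hf).1.mul_inv
  refine ⟨(⟨a, b, hab, by rw [mul_comm, hab]⟩, c), ?_, ?_⟩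
  · intro V f hf
    exact Prod.ext (Units.ext (ha f hf)) (hc f hf)
  · intro y hy
    refine Prod.ext (Units.ext ?_) ?_
    · refine sep.ext fun V f hf => ?_
      refine Eq.trans ?_ (ha f hf).symm
      exact congr(($(hy f hf)).1.val)
    · refine (hP S hS).isSeparatedFor.ext fun V f hf => ?_
      refine Eq.trans ?_ (hc f hf).symm
      exact congr(($(hy f hf)).2)

/-! ### Constant log structures -/

theorem existsUnique_glue {P : Type} {U : Scheme.{0}} (α : P → Γ(U, ⊤))
    (f : LocallyConstant U P) : ∃! s : Γ(U, ⊤), ∀ (W : Scheme.{0}) (g : W ⟶ U) (p : P),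
      (∀ w, f (g w) = p) → g.appTop s = g.appTop (α p) := by
  let V : P → U.Opens := fun p => ⟨f ⁻¹' {p}, f.isLocallyConstant.isOpen_fiber p⟩
  have hV : iSup V = ⊤ := by
    ext x
    simp only [TopologicalSpace.Opens.coe_iSup, Set.mem_iUnion]
    exact ⟨fun _ => trivial, fun _ => ⟨f x, rfl⟩⟩
  have key : ∃! s : Γ(U, ⊤), ∀ p, U.presheaf.map (homOfLE (le_top : V p ≤ ⊤)).op s =
      U.presheaf.map (homOfLE (le_top : V p ≤ ⊤)).op (α p) :=
    U.sheaf.existsUnique_gluing' V ⊤ (fun p => homOfLE le_top) hV.ge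
     (fun p => U.presheaf.map (homOfLE (le_top : V p ≤ ⊤)).op (α p)) (by
       intro p q
       by_cases h : p = q
       · subst h; rfl
       · have : V p ⊓ V q = ⊥ := by
           refine TopologicalSpace.Opens.ext (Set.eq_empty_of_forall_notMem ?_)
           rintro x ⟨h1, h2⟩
           exact h (h1.symm.trans h2)
         have : Subsingleton Γ(U, V p ⊓ V q) := by rw [this]; infer_instance
         exact this.elim _ _)
  have hι : ∀ (p : P) (a : Γ(U, ⊤)), (V p).ι.appTop a =
      (V p).topIso.inv (U.presheaf.map (homOfLE (le_top : V p ≤ ⊤)).op a) := by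
    intro p a
    rw [← ConcreteCategory.comp_apply]
    congr 2
    rw [Scheme.Opens.ι_appTop]
    exact U.presheaf.map_comp _ _
  obtain ⟨s, hs, hu⟩ := key
  refine ⟨s, ?_, ?_⟩
  · intro W g p hW
    have hle : Set.range g ⊆ Set.range (V p).ι := by
      rintro _ ⟨w, rfl⟩
      rw [Scheme.Opens.range_ι]
      exact hW w
    rw [← IsOpenImmersion.lift_fac (V p).ι g hle]
    simp only [Scheme.Hom.comp_appTop, CommRingCat.comp_apply, hι]
    exact congrArg (fun z => (IsOpenImmersion.lift (V p).ι g hle).appTop ((V p).topIso.inv z))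
      (hs p)
  · intro y hy
    refine hu _ fun p => ?_
    have := hy _ (V p).ι p (fun w => w.2)
    rw [hι, hι] at this
    exact (ConcreteCategory.injective_of_mono_of_preservesPullback (V p).topIso.inv) this

/-- For a map `α : P → 𝒪(U)` and a locally constant function `f : U → P`, the section of `𝒪` over
`U` that is equal to `α p` where `f` is equal to `p`. -/
noncomputable def glue {P : Type} {U : Scheme.{0}} (α : P → Γ(U, ⊤)) (f : LocallyConstant U P) :
    Γ(U, ⊤) := (existsUnique_glue α f).choose

theorem glue_spec {P : Type} {U : Scheme.{0}} (α : P → Γ(U, ⊤)) (f : LocallyConstant U P)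
    {W : Scheme.{0}} (g : W ⟶ U) (p : P) (h : ∀ w, f (g w) = p) :
    g.appTop (glue α f) = g.appTop (α p) :=
  (existsUnique_glue α f).choose_spec.1 W g p h

theorem glue_eq {P : Type} {U : Scheme.{0}} (α : P → Γ(U, ⊤)) (f : LocallyConstant U P)
    (s : Γ(U, ⊤)) (hs : ∀ (W : Scheme.{0}) (g : W ⟶ U) (p : P), (∀ w, f (g w) = p) →
      g.appTop s = g.appTop (α p)) : glue α f = s :=
  ((existsUnique_glue α f).choose_spec.2 s hs).symm

theorem subsingleton_of_isEmpty (W : Scheme.{0}) (h : IsEmpty W) : Subsingleton Γ(W, ⊤) := by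
  infer_instance

theorem glue_const {P : Type} {U : Scheme.{0}} (α : P → Γ(U, ⊤)) (p : P) :
    glue α (LocallyConstant.const U p) = α p := by
  refine glue_eq _ _ _ fun W g q h => ?_
  rcases isEmpty_or_nonempty W with hW | ⟨⟨w⟩⟩
  · exact (subsingleton_of_isEmpty W hW).elim _ _
  · rw [← h w]; rfl

theorem glue_mul {P : Type} [CommMonoid P] {U : Scheme.{0}} (α : P →* Γ(U, ⊤))
    (f f' : LocallyConstant U P) : glue α (f * f') = glue α f * glue α f' := by
  let F : LocallyConstant U (P × P) :=
    ⟨fun x => (f x, f' x), f.isLocallyConstant.prodMk f'.isLocallyConstant⟩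
  have h := existsUnique_glue (fun p : P × P => α (p.1 * p.2)) F
  refine h.unique ?_ ?_
  · intro W g p hp
    exact glue_spec _ _ g _ fun w => by rw [← hp w]; rfl
  · intro W g p hp
    rw [map_mul, map_mul, map_mul, glue_spec α f g p.1 fun w => by rw [← hp w]; rfl,
      glue_spec α f' g p.2 fun w => by rw [← hp w]; rfl]

theorem appTop_glue {P Q : Type} {U V : Scheme.{0}} (α : P → Γ(U, ⊤)) (f : LocallyConstant U P)
    (g : V ⟶ U) (φ : P → Q) (β : Q → Γ(V, ⊤)) (hβ : ∀ p, g.appTop (α p) = β (φ p)) :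
    g.appTop (glue α f) = glue β ((f.comap g.base.hom).map φ) := by
  have h := existsUnique_glue (fun p => β (φ p)) (f.comap g.base.hom)
  refine h.unique ?_ ?_
  · intro W k p hp
    rw [← hβ, ← CommRingCat.comp_apply, ← CommRingCat.comp_apply, ← Scheme.Hom.comp_appTop]
    exact glue_spec α f (k ≫ g) p fun w => hp w
  · intro W k p hp
    exact glue_spec β _ k (φ p) fun w => congrArg φ (hp w)

/-- The map `(u, f) ↦ u α(f)`. -/
noncomputable def constAlpha {P : Type} [CommMonoid P] {U : Scheme.{0}} (α : P →* Γ(U, ⊤)) :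
    Γ(U, ⊤)ˣ × LocallyConstant U P →* Γ(U, ⊤) where
  toFun m := m.1 * glue α m.2
  map_one' := by
    have := glue_const (U := U) α 1
    rw [map_one] at this
    exact (one_mul _).trans this
  map_mul' m m' := by
    change ((m.1 * m'.1 : Γ(U, ⊤)ˣ) : Γ(U, ⊤)) * glue α (m.2 * m'.2) = _
    rw [glue_mul, Units.val_mul]
    exact mul_mul_mul_comm _ _ _ _

theorem constAlpha_constPull {Q P : Type} [CommMonoid Q] [CommMonoid P] {U V : Scheme.{0}}
    (g : V ⟶ U) (φ : Q →* P) (α : Q →* Γ(U, ⊤)) (β : P →* Γ(V, ⊤))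
    (h : ∀ q, g.appTop (α q) = β (φ q)) (m : Γ(U, ⊤)ˣ × LocallyConstant U Q) :
    constAlpha β (constPull g φ m) = g.appTop (constAlpha α m) := by
  refine Eq.trans ?_ (map_mul g.appTop.hom _ _).symm
  exact congrArg _ (appTop_glue α m.2 g φ β h).symm

theorem eq_one_of_isUnit_glue {P : Type} [CommMonoid P] {U : Scheme.{0}} (α : P →* Γ(U, ⊤))
    (hα : ∀ p, p ≠ 1 → IsNilpotent (α p)) (f : LocallyConstant U P) (h : IsUnit (glue α f)) :
    f = 1 := by
  ext x
  by_contra hx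
  let V : U.Opens := ⟨f ⁻¹' {f x}, f.isLocallyConstant.isOpen_fiber _⟩
  have h1 : V.ι.appTop (glue α f) = V.ι.appTop (α (f x)) := glue_spec _ _ _ _ fun w => w.2
  have h2 : IsUnit (V.ι.appTop (α (f x))) := h1 ▸ h.map V.ι.appTop.hom
  have h3 : IsNilpotent (V.ι.appTop (α (f x))) := (hα _ hx).map V.ι.appTop.hom
  have : Nonempty (⊤ : V.toScheme.Opens) := ⟨⟨⟨x, rfl⟩, trivial⟩⟩
  have : Nontrivial Γ(V.toScheme, ⊤) := V.toScheme.component_nontrivial ⊤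
  exact h3.not_isUnit h2

theorem existsUnique_constAlpha {P : Type} [CommMonoid P] {U : Scheme.{0}} (α : P →* Γ(U, ⊤))
    (hα : ∀ p, p ≠ 1 → IsNilpotent (α p)) (u : Γ(U, ⊤)ˣ) :
    ∃! m : Γ(U, ⊤)ˣ × LocallyConstant U P, constAlpha α m = u := by
  have h1 : glue α (1 : LocallyConstant U P) = 1 := by
    have := glue_const (U := U) α 1
    rwa [map_one] at this
  refine ⟨(u, 1), ?_, ?_⟩
  · change (u : Γ(U, ⊤)) * glue α (1 : LocallyConstant U P) = u
    rw [h1, mul_one]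
  · rintro ⟨v, f⟩ hv
    change (v : Γ(U, ⊤)) * glue α f = u at hv
    have hf : f = 1 := eq_one_of_isUnit_glue α hα f
      (isUnit_of_mul_isUnit_right (hv ▸ u.isUnit))
    subst hf
    rw [h1, mul_one] at hv
    exact Prod.ext (Units.ext hv) rfl

/-- The log structure on a scheme `X` associated to the constant monoid `P` and a homomorphism
`α : P → 𝒪(X)` such that `α p` is nilpotent for all `p ≠ 1`: its sheaf of monoids is `𝒪ˣ × P`, and
its structure map is `(u, p) ↦ u α(p)`. -/
noncomputable abbrev constLog (X : Scheme.{0}) (P : Type) [CommMonoid P] (α : P →* Γ(X, ⊤))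
    (hα : ∀ p, p ≠ 1 → IsNilpotent (α p)) : LogScheme where
  scheme := X
  M := (Et.toScheme X).op ⋙ constMonoid P
  isSheaf := isSheaf_restrict X _ (isSheaf_constMonoid P)
  α U := constAlpha ((U.hom.appTop.hom : Γ(X, ⊤) →* Γ(U.left, ⊤)).comp α)
  α_res {U V} a m := by
    refine constAlpha_constPull (Et.homLeft a) (MonoidHom.id P) _ _ (fun p => ?_) m
    change (U.hom.appTop ≫ (Et.homLeft a).appTop) (α p) = V.hom.appTop (α p)
    rw [← Scheme.Hom.comp_appTop, Et.homLeft_w]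
  existsUnique_unit U u :=
    existsUnique_constAlpha _ (fun p hp => (hα p hp).map U.hom.appTop.hom) u

/-- The morphism between constant log structures given by a morphism `f : Y → X` of schemes and a
homomorphism `φ : Q → P` of monoids: `(u, q) ↦ (f^* u, φ q)`. -/
noncomputable def constLogMap {X Y : Scheme.{0}} {Q P : Type} [CommMonoid Q] [CommMonoid P]
    {α : Q →* Γ(X, ⊤)} {hα : ∀ q, q ≠ 1 → IsNilpotent (α q)}
    {β : P →* Γ(Y, ⊤)} {hβ : ∀ p, p ≠ 1 → IsNilpotent (β p)} (f : Y ⟶ X) (φ : Q →* P)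
    (h : ∀ q, f.appTop (α q) = β (φ q)) : constLog Y P β hβ ⟶ constLog X Q α hα where
  base := f
  flat U V g _ := constPull g φ
  res_flat {_ _ _} a g _ _ m := constPull_comp g (Et.homLeft a) φ (MonoidHom.id P) m
  flat_res {_ _ _} b g _ _ m := constPull_comp (Et.homLeft b) g (MonoidHom.id Q) φ m
  α_flat U V g hg m := by
    refine constAlpha_constPull g φ _ _ (fun q => ?_) m
    change (V.hom.appTop ≫ g.appTop) (α q) = U.hom.appTop (β (φ q))
    rw [← Scheme.Hom.comp_appTop, hg, ← h]
    rfl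

/-! ### Spectra of fields with a monoid of non-negative rational numbers -/

/-- The homomorphism from a monoid of non-negative rational numbers to the multiplicative monoid of
a ring that sends `0` to `1` and every `r ≠ 0` to `0`. -/
noncomputable def indic (S : AddSubmonoid ℚ≥0) (R : Type) [CommRing R] : Multiplicative S →* R := by
  classical
  exact
  { toFun := fun r => if r = 1 then 1 else 0
    map_one' := if_pos rfl
    map_mul' := fun r s => by
      have key : r * s = 1 ↔ r = 1 ∧ s = 1 := by
        constructor
        · intro h
          have h' : (r.toAdd : ℚ≥0) + (s.toAdd : ℚ≥0) = 0 := congrArg (fun z => (z.toAdd : ℚ≥0)) h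
          obtain ⟨h1, h2⟩ := add_eq_zero.1 h'
          exact ⟨Subtype.ext h1, Subtype.ext h2⟩
        · rintro ⟨rfl, rfl⟩
          exact one_mul 1
      by_cases hr : r = 1 <;> by_cases hs : s = 1 <;> simp [key, hr, hs] }

theorem indic_of_ne (S : AddSubmonoid ℚ≥0) (R : Type) [CommRing R] (r : Multiplicative S)
    (h : r ≠ 1) : indic S R r = 0 := if_neg h

theorem map_indic (S T : AddSubmonoid ℚ≥0) (h : S ≤ T) {R R' : Type} [CommRing R] [CommRing R']
    (f : R →+* R') (r : Multiplicative S) :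
    f (indic S R r) = indic T R' (AddMonoidHom.toMultiplicative (AddSubmonoid.inclusion h) r) := by
  by_cases hr : r = 1
  · subst hr
    simp
  · rw [indic_of_ne S R r hr, map_zero, indic_of_ne]
    intro h'
    exact hr (AddSubmonoid.inclusion_injective h h')

/-- The spectrum of a field `K` with the log structure `𝒪ˣ ⊕ S`, where `S` is a monoid of
non-negative rational numbers; all non-zero elements of `S` are sent to `0` in `𝒪`. -/
noncomputable abbrev hollow (K : Type) [Field K] (S : AddSubmonoid ℚ≥0) : LogScheme :=
  constLog (Spec (CommRingCat.of K)) (Multiplicative S) (indic S _)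
    (fun r hr => by rw [indic_of_ne S _ r hr]; exact IsNilpotent.zero)

/-- The global section `(x, r)` of the log structure of `hollow K S`, for `x ∈ Kˣ` and `r ∈ S`. -/
noncomputable def hollowSec {K : Type} [Field K] {S : AddSubmonoid ℚ≥0} (x : Kˣ) (r : S) :
    (hollow K S).sec (hollow K S).top :=
  (Units.map (Scheme.ΓSpecIso (CommRingCat.of K)).inv.hom.toMonoidHom x,
    LocallyConstant.const _ (Multiplicative.ofAdd r))

/-- The morphism `(Spec L, 𝒪ˣ ⊕ T) → (Spec K, 𝒪ˣ ⊕ S)` for an extension `L` of `K` and `S ⊆ T`. -/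
noncomputable def hollowMap (K L : Type) [Field K] [Field L] [Algebra K L]
    {S T : AddSubmonoid ℚ≥0} (h : S ≤ T) : hollow L T ⟶ hollow K S :=
  constLogMap (Spec.map (CommRingCat.ofHom (algebraMap K L)))
    (AddMonoidHom.toMultiplicative (AddSubmonoid.inclusion h))
    (fun r => map_indic S T h (Spec.map (CommRingCat.ofHom (algebraMap K L))).appTop.hom r)

theorem hollowMap_comp (K L L' : Type) [Field K] [Field L] [Field L'] [Algebra K L] [Algebra K L']
    [Algebra L L'] [IsScalarTower K L L'] {S T T' : AddSubmonoid ℚ≥0} (h : S ≤ T) (h' : T ≤ T') :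
    hollowMap L L' h' ≫ hollowMap K L h = hollowMap K L' (h.trans h') := by
  have hb : Spec.map (CommRingCat.ofHom (algebraMap L L')) ≫
      Spec.map (CommRingCat.ofHom (algebraMap K L)) =
      Spec.map (CommRingCat.ofHom (algebraMap K L')) := by
    rw [← Spec.map_comp, ← CommRingCat.ofHom_comp, ← IsScalarTower.algebraMap_eq]
  refine Hom.ext' hb fun U W g e e' m => ?_
  let V := Et.pull (Spec.map (CommRingCat.ofHom (algebraMap K L))) W
  refine (constPull_comp (Et.pullFst _ W) _ _ _ m).trans ?_
  refine congrArg (fun z => constPull z _ m) ?_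
  exact Et.pullLift_fst _ _ _ _ _

/-! ### The standard log point and its Kummer covers -/

/-- The monoid `ℕ` of natural numbers, inside the non-negative rational numbers. -/
def natMonoid : AddSubmonoid ℚ≥0 := AddMonoidHom.mrange (Nat.castAddMonoidHom ℚ≥0)

/-- The natural number `n` as an element of `natMonoid`. -/
def natElt (n : ℕ) : natMonoid := ⟨n, n, rfl⟩

/-- The monoid `(1/(q-1)) ℕ`, where `q` is the number of elements of `k`. -/
noncomputable def abMonoid (k : Type) : AddSubmonoid ℚ≥0 :=
  AddSubmonoid.multiples (((Nat.card k - 1 : ℕ) : ℚ≥0)⁻¹)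

/-- The element `m/(q-1)` of `(1/(q-1)) ℕ`. -/
noncomputable def abElt (k : Type) (m : ℕ) : abMonoid k :=
  ⟨m • (((Nat.card k - 1 : ℕ) : ℚ≥0)⁻¹), m, rfl⟩

/-- The monoid `ℕ_(p)` of all non-negative rational numbers whose denominator is prime to the
characteristic `p` of `k`. -/
def kumMonoid (k : Type) [Field k] : AddSubmonoid ℚ≥0 where
  carrier := {r | (r.den : k) ≠ 0}
  zero_mem' := by simp
  add_mem' {r s} hr hs h0 := by
    have h : (r + s).den ∣ r.den * s.den := by
      have := Rat.add_den_dvd (r : ℚ) (s : ℚ)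
      rw [← NNRat.coe_add] at this
      simpa only [NNRat.den_coe] using this
    obtain ⟨c, hc⟩ := h
    have h2 : ((r.den * s.den : ℕ) : k) = 0 := by
      rw [hc, Nat.cast_mul, h0, zero_mul]
    rw [Nat.cast_mul] at h2
    exact (mul_ne_zero hr hs) h2

theorem natMonoid_le_abMonoid (k : Type) [Field k] [Finite k] : natMonoid ≤ abMonoid k := by
  rintro _ ⟨n, rfl⟩
  refine ⟨n * (Nat.card k - 1), ?_⟩
  have h : ((Nat.card k - 1 : ℕ) : ℚ≥0) ≠ 0 := by
    have := Finite.one_lt_card (α := k)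
    exact_mod_cast (by omega : Nat.card k - 1 ≠ 0)
  change (n * (Nat.card k - 1)) • ((Nat.card k - 1 : ℕ) : ℚ≥0)⁻¹ = n
  rw [nsmul_eq_mul, Nat.cast_mul, mul_assoc, mul_inv_cancel₀ h, mul_one]

theorem abMonoid_le_kumMonoid (k : Type) [Field k] [Finite k] : abMonoid k ≤ kumMonoid k := by
  refine (AddSubmonoid.multiples_le).2 ?_
  have h1 := Finite.one_lt_card (α := k)
  have hk : ((Nat.card k : ℕ) : k) = 0 := by
    have := Fintype.ofFinite k
    rw [Nat.card_eq_fintype_card]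
    exact FiniteField.cast_card_eq_zero k
  have h2 : ((Nat.card k - 1 : ℕ) : k) = -1 := by
    rw [Nat.cast_sub h1.le, hk]
    simp
  change ((((Nat.card k - 1 : ℕ) : ℚ≥0)⁻¹).den : k) ≠ 0
  have h3 : (((Nat.card k - 1 : ℕ) : ℚ≥0)⁻¹).den = Nat.card k - 1 := by
    have := Rat.inv_natCast_den_of_pos (a := Nat.card k - 1) (by omega)
    refine Eq.trans ?_ this
    rw [← NNRat.den_coe, NNRat.cast_inv, NNRat.cast_natCast]
  rw [h3, h2]
  simp

theorem natMonoid_le_kumMonoid (k : Type) [Field k] [Finite k] : natMonoid ≤ kumMonoid k :=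
  (natMonoid_le_abMonoid k).trans (abMonoid_le_kumMonoid k)

/-- The standard log point over `k`: the spectrum of `k` with the log structure `kˣ ⊕ ℕ`. -/
noncomputable abbrev logPoint (k : Type) [Field k] : LogScheme := hollow k natMonoid

/-- The universal Kummer cover of the standard log point: the spectrum of the algebraic closure of
`k` with the log structure associated to `ℕ_(p)`. It is a log geometric point. -/
noncomputable def kumCover (k : Type) [Field k] [Finite k] : Over (logPoint k) :=
  Over.mk (hollowMap k (AlgebraicClosure k) (natMonoid_le_kumMonoid k))

/-- The universal abelian Kummer cover of the standard log point: the spectrum of the algebraic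
closure of `k` with the log structure associated to `(1/(q-1)) ℕ`. -/
noncomputable def abCover (k : Type) [Field k] [Finite k] : Over (logPoint k) :=
  Over.mk (hollowMap k (AlgebraicClosure k) (natMonoid_le_abMonoid k))

/-- The projection from the universal Kummer cover to the universal abelian Kummer cover. -/
noncomputable def coverProj (k : Type) [Field k] [Finite k] : kumCover k ⟶ abCover k :=
  Over.homMk (hollowMap (AlgebraicClosure k) (AlgebraicClosure k) (abMonoid_le_kumMonoid k))
    (hollowMap_comp k (AlgebraicClosure k) (AlgebraicClosure k) _ _)

/-- The abelianized logarithmic fundamental group of the standard log point. -/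
abbrev Pi1Ab (k : Type) [Field k] [Finite k] : Type 1 := LogPi1Ab (kumCover k)

/-- The profinite integers: the compatible families of residue classes, with the topology induced
from the product of the discrete groups `ℤ/n`. -/
def Zhat : AddSubgroup (∀ n : ℕ+, ZMod n) where
  carrier := {t | ∀ (m n : ℕ+) (h : (m : ℕ) ∣ n), ZMod.castHom h (ZMod m) (t n) = t m}
  zero_mem' m n h := map_zero _
  add_mem' hs ht m n h := by
    change ZMod.castHom h (ZMod m) (_ + _) = _
    rw [map_add, hs m n h, ht m n h]
    rfl
  neg_mem' ht m n h := by
    change ZMod.castHom h (ZMod m) (- _) = _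
    rw [map_neg, ht m n h]
    rfl

/-- The homomorphism from the integers to the profinite integers. -/
def intToZhat : ℤ →+ Zhat where
  toFun a := ⟨fun n => (a : ZMod n), fun m n h => map_intCast _ a⟩
  map_zero' := Subtype.ext (funext fun n => Int.cast_zero)
  map_add' a b := Subtype.ext (funext fun n => Int.cast_add a b)

end LogCFT

/-!
# Local logarithmic class field theory

Both sides of the reciprocity map are computed in terms of charts. A morphism into a log scheme with
a chart is determined by the underlying morphism of schemes and by the images of the elements of the
chart (`IsChart.hom_ext`), and suitable images define a morphism (`IsChart.exists_hom`). An
automorphism over `𝔽_q^log` of a cover `(Spec k̄, S)` is therefore a pair `(ψ, χ)` of an automorphism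
`ψ` of `k̄` over `k` and a homomorphism `χ : S → k̄ˣ` with `χ(1) = 1` (`IsActBy`,
`exists_aut_isActBy`). For `S = (1/(q-1))ℕ` the homomorphism is given by `χ(1/(q-1))`, a `(q-1)`-th
root of unity, that is, an element of `𝔽_qˣ`, and it is fixed by the Frobenius; the Galois group of
`k̄` is `ℤ̂` (`frobZ`). This is `γ` (`gammaEquiv`).

The fundamental group is that of the universal Kummer cover. The truncated polynomial rings
`L[x]/(x^m)`, with the log structure `𝒪ˣ ⊕ ℕ` for which the generator of `ℕ` maps to `x`, are finite
Kummer étale covers for `L` finite over `k` and `m` prime to `p` (`isFiniteKummerEtale_truncCover`),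
and they are cofinal (`exists_factor_truncPoint`): a geometric point of a cover `Y` with a chart
`ℤ[Q] → ℤ[P]` over `V → U` defines a morphism from such a ring to `U ×_{ℤ[Q]} ℤ[P]`, and this lifts
to `V` because `V` is étale over the fibre product and `L[x]/(x^m) → L` has a nilpotent kernel. The
values of an element of `π₁` on the standard points of these covers fit together to an automorphism
of the universal cover that defines it (`deck_surjective`).

An automorphism of the universal Kummer cover that is trivial on the abelian one is a pair `(1, χ)`
with `χ(1/(q-1)) = 1`. It is the commutator of the Frobenius and of `(1, χ')`, where
`χ'(r) = χ(r/(q-1))`, because the Frobenius raises `χ'` to the power `q` and `χ'^(q-1) = χ`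
(`ker_restrictHom_le_commutator`). Conversely the closure of the commutator subgroup acts trivially
on the abelian cover, whose automorphism group is abelian and whose points over the finite covers
have closed stabilizers (`restrictHom_eq_one_of_deck_mem`). This gives `Ψ` (`psiEquiv`), and `Ψ ∘ γ`
is a homeomorphism by compactness (`isHomeomorph_psi_gamma`). Finally `𝔽_qˣ × ℤ → 𝔽_qˣ × ℤ̂` is a
profinite completion (`exists_completion_equiv`), and the reciprocity homomorphism is unique because
the conditions determine `θ`, `γ` and `Ψ` (`eq_thetaEquiv`, `eq_gammaEquiv`, `eq_psiEquiv`).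
-/

namespace LogCFT

/-! ### Gluing sections of a log structure -/

theorem Et.etale_homLeft {S : Scheme.{0}} {U V : Et S} (a : U ⟶ V) : Etale (Et.homLeft a) :=
  MorphismProperty.of_postcomp (W := @Etale) (W' := @Etale) _ V.hom inferInstance
    (by rw [Et.homLeft_w]; infer_instance)

/-- The base change of an étale `W → V` along a morphism `g : U → V` of schemes that are étale over
different bases. -/
theorem Et.exists_pull {X Y : Scheme.{0}} {U : Et X} {V W : Et Y} (g : U.left ⟶ V.left)
    (a : W ⟶ V) (u : U.left) (h : g u ∈ Set.range (Et.homLeft a)) :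
    ∃ (U' : Et X) (b : U' ⟶ U) (g' : U'.left ⟶ W.left),
      g' ≫ Et.homLeft a = Et.homLeft b ≫ g ∧ u ∈ Set.range (Et.homLeft b) := by
  obtain ⟨w, hw⟩ := h
  have := Et.etale_homLeft a
  let U' : Et X := Et.mk (pullback.snd (Et.homLeft a) g ≫ U.hom)
  let b : U' ⟶ U := Et.homMk (pullback.snd (Et.homLeft a) g) rfl
  refine ⟨U', b, pullback.fst (Et.homLeft a) g, pullback.condition, ?_⟩
  obtain ⟨z, -, hz⟩ := Scheme.Pullback.exists_preimage_pullback w u hw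
  exact ⟨z, hz⟩

namespace LogScheme

variable {X : LogScheme}

theorem sec_ext_of_isUnit {U : Et X.scheme} {e e' : X.sec U} (he : IsUnit (X.α U e))
    (h : X.α U e = X.α U e') : e = e' := by
  obtain ⟨u, hu⟩ := he
  exact (X.existsUnique_unit U u).unique hu.symm (h ▸ hu.symm)

/-- The section of the log structure that corresponds to a unit of the structure sheaf. -/
noncomputable def unitSec (X : LogScheme) (U : Et X.scheme) (u : Γ(U.left, ⊤)ˣ) : X.sec U :=
  (X.existsUnique_unit U u).choose

@[simp] theorem α_unitSec (U : Et X.scheme) (u : Γ(U.left, ⊤)ˣ) :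
    X.α U (X.unitSec U u) = u :=
  (X.existsUnique_unit U u).choose_spec.1

theorem eq_unitSec {U : Et X.scheme} {e : X.sec U} {u : Γ(U.left, ⊤)ˣ} (h : X.α U e = u) :
    e = X.unitSec U u :=
  sec_ext_of_isUnit (h ▸ u.isUnit) (h.trans (α_unitSec U u).symm)

theorem unitSec_one (U : Et X.scheme) : X.unitSec U 1 = 1 :=
  (eq_unitSec (map_one _)).symm

theorem unitSec_mul (U : Et X.scheme) (u v : Γ(U.left, ⊤)ˣ) :
    X.unitSec U (u * v) = X.unitSec U u * X.unitSec U v :=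
  (eq_unitSec (by simp)).symm

theorem isUnit_sec {U : Et X.scheme} {e : X.sec U} (he : IsUnit (X.α U e)) : IsUnit e := by
  obtain ⟨u, hu⟩ := he
  rw [eq_unitSec hu.symm]
  exact .of_mul_eq_one _ (by rw [← unitSec_mul, mul_inv_cancel, unitSec_one])

theorem isUnit_α_res {U V : Et X.scheme} (a : V ⟶ U) {e : X.sec U} (he : IsUnit (X.α U e)) :
    IsUnit (X.α V (X.res a e)) := by
  have := X.α_res a e
  exact this ▸ he.map (Et.homLeft a).appTop.hom

theorem α_res' {U V : Et X.scheme} (a : V ⟶ U) (e : X.sec U) :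
    X.α V (X.res a e) = (Et.homLeft a).appTop (X.α U e) := X.α_res a e

theorem range_mem_topology {U : Et X.scheme} {ι : Type} {W : ι → Et X.scheme}
    (a : ∀ i, W i ⟶ U) (h : ∀ x : U.left, ∃ i, x ∈ Set.range (Et.homLeft (a i))) :
    Sieve.ofArrows W a ∈ Et.topology X.scheme U := by
  refine Scheme.ofArrows_mem_smallEtaleTopology_iff (X := X.scheme) (W := U) a |>.2 ?_
  refine Set.eq_univ_of_forall fun x => ?_
  obtain ⟨i, hi⟩ := h x
  exact Set.mem_iUnion.2 ⟨i, hi⟩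

/-- Sections that agree étale locally are equal. -/
theorem sec_ext {U : Et X.scheme} {m m' : X.sec U}
    (h : ∀ x : U.left, ∃ (W : Et X.scheme) (a : W ⟶ U), x ∈ Set.range (Et.homLeft a) ∧
      X.res a m = X.res a m') : m = m' := by
  choose W a hx hr using h
  have hs := (isSheaf_iff_isSheaf_of_type _ _).1 X.isSheaf _
    (range_mem_topology a fun x => ⟨x, hx x⟩)
  refine hs.isSeparatedFor.ext fun V f hf => ?_
  obtain ⟨_, b, _, ⟨i⟩, rfl⟩ := hf
  change X.res (b ≫ a i) m = X.res (b ≫ a i) m'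
  rw [← X.res_res, ← X.res_res, hr]

/-- Sections which are characterized étale locally by a relation glue. -/
theorem exists_sec_of_local {U : Et X.scheme} (R : ∀ W : Et X.scheme, (W ⟶ U) → X.sec W → Prop)
    (hres : ∀ (W W' : Et X.scheme) (a : W ⟶ U) (b : W' ⟶ W) (m : X.sec W), R W a m →
      R W' (b ≫ a) (X.res b m))
    (huniq : ∀ (W : Et X.scheme) (a : W ⟶ U) (m m' : X.sec W), R W a m → R W a m' → m = m')
    (hex : ∀ x : U.left, ∃ (W : Et X.scheme) (a : W ⟶ U) (m : X.sec W),
      x ∈ Set.range (Et.homLeft a) ∧ R W a m) :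
    ∃ m : X.sec U, ∀ (W : Et X.scheme) (a : W ⟶ U) (m' : X.sec W), R W a m' →
      X.res a m = m' := by
  choose W a m hx hm using hex
  let S : Sieve U := Sieve.ofArrows W a
  have hs := (isSheaf_iff_isSheaf_of_type _ _).1 X.isSheaf _
    (range_mem_topology a fun x => ⟨x, hx x⟩)
  have key : ∀ (V : Et X.scheme) (f : V ⟶ U), S f → ∃ n : X.sec V, R V f n := by
    rintro V f ⟨_, b, _, ⟨i⟩, rfl⟩
    exact ⟨_, hres _ _ _ b _ (hm i)⟩
  let fam : Presieve.FamilyOfElements (X.M ⋙ forget CommMonCat) S.arrows :=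
    fun V f hf => (key V f hf).choose
  have hfam : ∀ (V : Et X.scheme) (f : V ⟶ U) (hf : S f), R V f (fam f hf) :=
    fun V f hf => (key V f hf).choose_spec
  have hcomp : fam.Compatible := by
    intro V₁ V₂ T g₁ g₂ f₁ f₂ h₁ h₂ e
    have h1 := hres _ _ _ g₁ _ (hfam _ _ h₁)
    have h2 := hres _ _ _ g₂ _ (hfam _ _ h₂)
    rw [← e] at h2
    exact huniq _ _ _ _ h1 h2
  refine ⟨hs.amalgamate fam hcomp, fun V f m' hm' => sec_ext fun x => ?_⟩
  obtain ⟨V', b, g', hb, hxb⟩ := Et.exists_pull (Et.homLeft f) (a (Et.homLeft f x)) x (hx _)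
  refine ⟨V', b, hxb, ?_⟩
  have hS : S (b ≫ f) := by
    refine ⟨_, Et.homMk g' ?_, _, ⟨Et.homLeft f x⟩, Et.hom_ext hb⟩
    rw [← Et.homLeft_w (a _), ← Category.assoc, hb]
    simp
  rw [X.res_res]
  refine huniq _ (b ≫ f) _ _ ?_ (hres _ _ _ b _ hm')
  have := hs.valid_glue hcomp (b ≫ f) hS
  change X.res (b ≫ f) _ = _ at this
  rw [this]
  exact hfam _ _ hS

/-! ### Morphisms into a log scheme with a chart -/

variable {Y Z : LogScheme}

theorem isUnit_α_flat (f : Hom Z Y) {U : Et Z.scheme} {V : Et Y.scheme} (g : U.left ⟶ V.left)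
    (h : g ≫ V.hom = U.hom ≫ f.base) {e : Y.sec V} (he : IsUnit (Y.α V e)) :
    IsUnit (Z.α U (f.flat U V g h e)) := by
  rw [f.α_flat]
  exact he.map g.appTop.hom

/-- The pull-back of a section that is a unit depends only on the morphism of schemes. -/
theorem flat_eq_of_isUnit (f f' : Hom Z Y) {U : Et Z.scheme} {V : Et Y.scheme}
    (g : U.left ⟶ V.left) (h : g ≫ V.hom = U.hom ≫ f.base) (h' : g ≫ V.hom = U.hom ≫ f'.base)
    {e : Y.sec V} (he : IsUnit (Y.α V e)) : f.flat U V g h e = f'.flat U V g h' e :=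
  sec_ext_of_isUnit (isUnit_α_flat f g h he) (by rw [f.α_flat, f'.α_flat])

end LogScheme

namespace LogScheme

/-- Functions that agree étale locally are equal. -/
theorem _root_.LogCFT.Et.function_ext {S : Scheme.{0}} {U : Et S} {s t : Γ(U.left, ⊤)}
    (h : ∀ x : U.left, ∃ (W : Et S) (a : W ⟶ U), x ∈ Set.range (Et.homLeft a) ∧
      (Et.homLeft a).appTop s = (Et.homLeft a).appTop t) : s = t := by
  choose W a hx hr using h
  have hsh := isSheaf_restrict S _ isSheaf_structureSheaf
  have hm : Sieve.ofArrows W a ∈ Scheme.smallEtaleTopology S U := by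
    refine Scheme.ofArrows_mem_smallEtaleTopology_iff (X := S) (W := U) a |>.2 ?_
    exact Set.eq_univ_of_forall fun x => Set.mem_iUnion.2 ⟨x, hx x⟩
  have hs := (isSheaf_iff_isSheaf_of_type _ _).1 hsh _ hm
  refine hs.isSeparatedFor.ext fun V f hf => ?_
  obtain ⟨_, b, _, ⟨i⟩, rfl⟩ := hf
  let V' : Et S := V
  let b' : V' ⟶ W i := b
  have h : ∀ r : Γ(U.left, ⊤), (Et.homLeft (b' ≫ a i)).appTop r =
      (Et.homLeft b').appTop ((Et.homLeft (a i)).appTop r) := fun r => by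
    rw [Et.homLeft_comp, Scheme.Hom.comp_appTop, CommRingCat.comp_apply]
  exact (h s).trans ((congrArg _ (hr i)).trans (h t).symm)

variable {Y Z : LogScheme}

/-- The morphism to the final object of the small étale site. -/
def toTop (Z : LogScheme) (U : Et Z.scheme) : U ⟶ Z.top := Et.homMk U.hom (Category.comp_id _)

theorem comp_toTop {U U' : Et Z.scheme} (a : U' ⟶ U) : a ≫ Z.toTop U = Z.toTop U' :=
  Et.hom_ext (Et.homLeft_w a)

/-- A chart over `V`, used to write a section étale locally as the product of a unit and an element
of the chart, compatibly with a given map `v` to `V`. -/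
theorem IsChart.exists_eq_mul {V : Et Y.scheme} {P : Type} [CommMonoid P] {c : P →* Y.sec V}
    (hc : Y.IsChart V c) {b : Z.scheme ⟶ Y.scheme} (v : Z.top.left ⟶ V.left)
    (hv : v ≫ V.hom = Z.top.hom ≫ b)
    {U : Et Z.scheme} {V' : Et Y.scheme} (g : U.left ⟶ V'.left) (hg : g ≫ V'.hom = U.hom ≫ b)
    (m : Y.sec V') (u : U.left) :
    ∃ (U' : Et Z.scheme) (β : U' ⟶ U) (W : Et Y.scheme) (a : W ⟶ V') (j : W ⟶ V)
      (g' : U'.left ⟶ W.left) (e : Y.sec W) (p : P), u ∈ Set.range (Et.homLeft β) ∧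
      g' ≫ Et.homLeft a = Et.homLeft β ≫ g ∧
        g' ≫ Et.homLeft j = Et.homLeft (Z.toTop U') ≫ v ∧
      IsUnit (Y.α W e) ∧ Y.res a m = e * Y.res j (c p) := by
  let W₀ : Et Y.scheme := Et.mk (pullback.fst V'.hom V.hom ≫ V'.hom)
  let a₀ : W₀ ⟶ V' := Et.homMk (pullback.fst V'.hom V.hom) rfl
  let j₀ : W₀ ⟶ V := Et.homMk (pullback.snd V'.hom V.hom) pullback.condition.symm
  let g₀ : U.left ⟶ W₀.left := pullback.lift g (Et.homLeft (Z.toTop U) ≫ v)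
    (by rw [hg, Category.assoc, hv, Et.homLeft_w_assoc])
  have hg₀a : g₀ ≫ Et.homLeft a₀ = g := pullback.lift_fst _ _ _
  have hg₀j : g₀ ≫ Et.homLeft j₀ = Et.homLeft (Z.toTop U) ≫ v := pullback.lift_snd _ _ _
  obtain ⟨W, b', e, p, hx, he, hm⟩ := hc.1 W₀ j₀ (Y.res a₀ m) (g₀ u)
  obtain ⟨U', β, g', hg', hu⟩ := Et.exists_pull g₀ b' u hx
  refine ⟨U', β, W, b' ≫ a₀, b' ≫ j₀, g', e, p, hu, ?_, ?_, he, ?_⟩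
  · rw [Et.homLeft_comp, ← Category.assoc, hg', Category.assoc, hg₀a]
  · rw [Et.homLeft_comp, ← Category.assoc, hg', Category.assoc, hg₀j, ← Category.assoc,
      ← Et.homLeft_comp, comp_toTop]
  · rw [← hm, Y.res_res]

/-- A morphism to a log scheme with a chart is determined by its effect on the chart. -/
theorem IsChart.hom_ext {V : Et Y.scheme} {P : Type} [CommMonoid P] {c : P →* Y.sec V}
    (hc : Y.IsChart V c) {f f' : Hom Z Y} (v : Z.top.left ⟶ V.left)
    (hv : v ≫ V.hom = Z.top.hom ≫ f.base) (hv' : v ≫ V.hom = Z.top.hom ≫ f'.base)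
    (h : ∀ p, f.flat Z.top V v hv (c p) = f'.flat Z.top V v hv' (c p)) : f = f' := by
  have hb : f.base = f'.base :=
    ((Category.id_comp _).symm.trans (hv.symm.trans hv')).trans (Category.id_comp _)
  refine Hom.ext' hb fun U V' g hg hg' m => ?_
  refine sec_ext fun u => ?_
  obtain ⟨U', β, W, a, j, g', e, p, hu, ha, hj, he, hm⟩ :=
    hc.exists_eq_mul v hv g hg m u
  refine ⟨U', β, hu, ?_⟩
  have hgW : g' ≫ W.hom = U'.hom ≫ f.base := by
    rw [← Et.homLeft_w a, ← Category.assoc, ha, Category.assoc, hg, ← Category.assoc, Et.homLeft_w]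
  have key : ∀ (φ : Hom Z Y) (hφ : f.base = φ.base),
      Z.res β (φ.flat U V' g (hφ ▸ hg) m) = φ.flat U' W g' (hφ ▸ hgW) e *
        Z.res (Z.toTop U') (φ.flat Z.top V v (hφ ▸ hv) (c p)) := by
    intro φ hφ
    rw [φ.res_flat β g _ (by rw [← ha, Category.assoc, Et.homLeft_w, ← hφ, hgW]),
      φ.flat_congr ha.symm, ← φ.flat_res a g' (hφ ▸ hgW), hm, map_mul,
      φ.flat_res j g' _ (by rw [Category.assoc, Et.homLeft_w, ← hφ, hgW]),
      φ.flat_congr hj, ← φ.res_flat (Z.toTop U') v (hφ ▸ hv)]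
  rw [key f rfl, key f' hb, h p, flat_eq_of_isUnit f f' g' _ _ he]

/-- The defining property of the pull-back `m'` of a section `m` under the morphism to a log scheme
with chart `c` which is given by the map `v` and the homomorphism `c'` on the chart. -/
def IsChartPullback {V : Et Y.scheme} {P : Type} [CommMonoid P] (c : P →* Y.sec V)
    (v : Z.top.left ⟶ V.left) (c' : P →* Z.sec Z.top)
    (U : Et Z.scheme) (V' : Et Y.scheme) (g : U.left ⟶ V'.left) (m : Y.sec V') (m' : Z.sec U) :
    Prop :=
  ∀ (U' : Et Z.scheme) (β : U' ⟶ U) (W : Et Y.scheme) (a : W ⟶ V') (j : W ⟶ V)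
    (g' : U'.left ⟶ W.left) (e : Y.sec W) (p : P) (e' : Z.sec U'),
    g' ≫ Et.homLeft a = Et.homLeft β ≫ g →
    g' ≫ Et.homLeft j = Et.homLeft (Z.toTop U') ≫ v → IsUnit (Y.α W e) →
    Y.res a m = e * Y.res j (c p) → Z.α U' e' = g'.appTop (Y.α W e) →
    Z.res β m' = e' * Z.res (Z.toTop U') (c' p)

section Lift

variable {V : Et Y.scheme} {P : Type} [CommMonoid P] {c : P →* Y.sec V}
  {v : Z.top.left ⟶ V.left} {c' : P →* Z.sec Z.top}

/-- Over one étale `U`, the value `e' * c' p` does not depend on the way of writing a section as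
`e * c p`. -/
theorem IsChart.mul_eq_mul (hc : Y.IsChart V c)
    (hα : ∀ p, Z.α Z.top (c' p) = v.appTop (Y.α V (c p))) {U : Et Z.scheme} {W : Et Y.scheme}
    (j : W ⟶ V) (g : U.left ⟶ W.left)
    (hg : g ≫ Et.homLeft j = Et.homLeft (Z.toTop U) ≫ v) {e e₁ : Y.sec W}
    {p p₁ : P} (he : IsUnit (Y.α W e)) (he₁ : IsUnit (Y.α W e₁))
    (h : e * Y.res j (c p) = e₁ * Y.res j (c p₁)) {e' e₁' : Z.sec U}
    (he' : Z.α U e' = g.appTop (Y.α W e)) (he₁' : Z.α U e₁' = g.appTop (Y.α W e₁)) :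
    e' * Z.res (Z.toTop U) (c' p) = e₁' * Z.res (Z.toTop U) (c' p₁) := by
  refine sec_ext fun u => ?_
  obtain ⟨W', a, s, s', hx, hs, hs', hps, hes⟩ := hc.2 W j e e₁ p p₁ he he₁ h (g u)
  obtain ⟨U', β, g', hg', hu⟩ := Et.exists_pull g a u hx
  refine ⟨U', β, hu, ?_⟩
  have hv : g' ≫ Et.homLeft (a ≫ j) = Et.homLeft (Z.toTop U') ≫ v := by
    rw [Et.homLeft_comp, ← Category.assoc, hg', Category.assoc, hg, ← Category.assoc,
      ← Et.homLeft_comp, comp_toTop]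
  -- the function `α (c' q)` is the pull-back of `α (c q)`
  have hq : ∀ q, Z.α U' (Z.res (Z.toTop U') (c' q)) =
      g'.appTop (Y.α W' (Y.res (a ≫ j) (c q))) := by
    intro q
    rw [α_res', α_res', hα, ← CommRingCat.comp_apply, ← CommRingCat.comp_apply,
      ← Scheme.Hom.comp_appTop, ← Scheme.Hom.comp_appTop, hv]
  have hE : ∀ {x : Y.sec W} {x' : Z.sec U}, Z.α U x' = g.appTop (Y.α W x) →
      Z.α U' (Z.res β x') = g'.appTop (Y.α W' (Y.res a x)) := by
    intro x x' hx
    rw [α_res', α_res', hx, ← CommRingCat.comp_apply, ← CommRingCat.comp_apply,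
      ← Scheme.Hom.comp_appTop, ← Scheme.Hom.comp_appTop, hg']
  have hu1 : IsUnit (Z.res (Z.toTop U') (c' s)) :=
    isUnit_sec (by rw [hq]; exact hs.map g'.appTop.hom)
  have hu2 : IsUnit (Z.res (Z.toTop U') (c' s')) :=
    isUnit_sec (by rw [hq]; exact hs'.map g'.appTop.hom)
  have key : Z.res β e' * Z.res (Z.toTop U') (c' s') =
      Z.res β e₁' * Z.res (Z.toTop U') (c' s) := by
    refine sec_ext_of_isUnit ?_ ?_
    · rw [map_mul, hE he', hq, ← map_mul]
      exact ((isUnit_α_res a he).mul hs').map g'.appTop.hom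
    · rw [map_mul, map_mul, hE he', hE he₁', hq, hq, ← map_mul, ← map_mul, ← map_mul, ← map_mul,
        hes]
  rw [map_mul, map_mul, Z.res_res, Z.res_res, comp_toTop]
  refine hu1.mul_left_injective (hu2.mul_left_injective ?_)
  beta_reduce
  have hps' := congrArg (fun q => Z.res (Z.toTop U') (c' q)) hps
  simp only [map_mul] at hps'
  generalize Z.res (Z.toTop U') (c' p) = A at *
  generalize Z.res (Z.toTop U') (c' p₁) = A₁ at *
  generalize Z.res (Z.toTop U') (c' s) = B at *
  generalize Z.res (Z.toTop U') (c' s') = B' at *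
  calc Z.res β e' * A * B * B' = (Z.res β e' * B') * (A * B) := by ac_rfl
    _ = _ := by rw [key, hps']; ac_rfl

theorem exists_flat_unit {U : Et Z.scheme} {W : Et Y.scheme}
    (g : U.left ⟶ W.left) {e : Y.sec W} (he : IsUnit (Y.α W e)) :
    ∃ e' : Z.sec U, Z.α U e' = g.appTop (Y.α W e) := by
  obtain ⟨u, hu⟩ := he.map g.appTop.hom
  exact ⟨Z.unitSec U u, (α_unitSec U u).trans hu⟩

/-- Pull-backs of sections exist and are unique: étale locally a section is `e * c p`, and its
pull-back is `e' * c' p`, where `e'` is the unit whose value is the pull-back of the value of `e`. -/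
theorem IsChart.existsUnique_isChartPullback (hc : Y.IsChart V c)
    {b : Z.scheme ⟶ Y.scheme} (hv : v ≫ V.hom = Z.top.hom ≫ b)
    (hα : ∀ p, Z.α Z.top (c' p) = v.appTop (Y.α V (c p)))
    (U : Et Z.scheme) (V' : Et Y.scheme) (g : U.left ⟶ V'.left)
    (hg : g ≫ V'.hom = U.hom ≫ b) (m : Y.sec V') :
    ∃! m' : Z.sec U, IsChartPullback c v c' U V' g m m' := by
  let R : ∀ U' : Et Z.scheme, (U' ⟶ U) → Z.sec U' → Prop := fun U' β m' =>
    ∃ (W : Et Y.scheme) (a : W ⟶ V') (j : W ⟶ V) (g' : U'.left ⟶ W.left) (e : Y.sec W) (p : P)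
      (e' : Z.sec U'), g' ≫ Et.homLeft a = Et.homLeft β ≫ g ∧
        g' ≫ Et.homLeft j = Et.homLeft (Z.toTop U') ≫ v ∧
      IsUnit (Y.α W e) ∧ Y.res a m = e * Y.res j (c p) ∧ Z.α U' e' = g'.appTop (Y.α W e) ∧
      m' = e' * Z.res (Z.toTop U') (c' p)
  have hex : ∀ x : U.left, ∃ (U' : Et Z.scheme) (β : U' ⟶ U) (m' : Z.sec U'),
      x ∈ Set.range (Et.homLeft β) ∧ R U' β m' := by
    intro x
    obtain ⟨U', β, W, a, j, g', e, p, hu, ha, hj, he, hm⟩ := hc.exists_eq_mul v hv g hg m x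
    obtain ⟨e', he'⟩ := exists_flat_unit g' he
    exact ⟨U', β, _, hu, W, a, j, g', e, p, e', ha, hj, he, hm, he', rfl⟩
  have hres : ∀ (W W' : Et Z.scheme) (a : W ⟶ U) (b : W' ⟶ W) (m : Z.sec W), R W a m →
      R W' (b ≫ a) (Z.res b m) := by
    rintro U' U'' β γ _ ⟨W, a, j, g', e, p, e', ha, hj, he, hm, he', rfl⟩
    refine ⟨W, a, j, Et.homLeft γ ≫ g', e, p, Z.res γ e', ?_, ?_, he, hm, ?_, ?_⟩
    · rw [Category.assoc, ha, Et.homLeft_comp, Category.assoc]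
    · rw [Category.assoc, hj, ← Category.assoc, ← Et.homLeft_comp, comp_toTop]
    · rw [α_res', he', Scheme.Hom.comp_appTop, CommRingCat.comp_apply]
    · rw [map_mul, Z.res_res, comp_toTop]
  have huniq : ∀ (W : Et Z.scheme) (a : W ⟶ U) (m m' : Z.sec W), R W a m → R W a m' → m = m' := by
    rintro U' β _ _ ⟨W, a, j, g', e, p, e', ha, hj, he, hm, he', rfl⟩
      ⟨W₁, a₁, j₁, g₁, e₁, p₁, e₁', ha₁, hj₁, he₁, hm₁, he₁', rfl⟩
    -- both ways of writing `m` are restricted to the fibre product of `W` and `W₁` over `V' × V`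
    let l := pullback.lift (Et.homLeft a) (Et.homLeft j)
      ((Et.homLeft_w a).trans (Et.homLeft_w j).symm)
    let l₁ := pullback.lift (Et.homLeft a₁) (Et.homLeft j₁)
      ((Et.homLeft_w a₁).trans (Et.homLeft_w j₁).symm)
    have hl : Etale l := by
      refine MorphismProperty.of_postcomp (W := @Etale) (W' := @Etale) l
        (pullback.fst V'.hom V.hom ≫ V'.hom) inferInstance ?_
      rw [← Category.assoc, pullback.lift_fst, Et.homLeft_w]
      infer_instance
    have hl₁ : Etale l₁ := by
      refine MorphismProperty.of_postcomp (W := @Etale) (W' := @Etale) l₁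
        (pullback.fst V'.hom V.hom ≫ V'.hom) inferInstance ?_
      rw [← Category.assoc, pullback.lift_fst, Et.homLeft_w]
      infer_instance
    let W₂ : Et Y.scheme := Et.mk (pullback.fst l l₁ ≫ W.hom)
    have cond : pullback.fst l l₁ ≫ l = pullback.snd l l₁ ≫ l₁ := pullback.condition
    have conda : pullback.fst l l₁ ≫ Et.homLeft a = pullback.snd l l₁ ≫ Et.homLeft a₁ := by
      have := congrArg (· ≫ pullback.fst V'.hom V.hom) cond
      simpa only [l, l₁, Category.assoc, pullback.lift_fst] using this
    have condj : pullback.fst l l₁ ≫ Et.homLeft j = pullback.snd l l₁ ≫ Et.homLeft j₁ := by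
      have := congrArg (· ≫ pullback.snd V'.hom V.hom) cond
      simpa only [l, l₁, Category.assoc, pullback.lift_snd] using this
    let q : W₂ ⟶ W := Et.homMk (pullback.fst l l₁) rfl
    let q₁ : W₂ ⟶ W₁ := Et.homMk (pullback.snd l l₁) (by
      change pullback.snd l l₁ ≫ W₁.hom = pullback.fst l l₁ ≫ W.hom
      rw [← Et.homLeft_w a₁, ← Category.assoc, ← conda, Category.assoc, Et.homLeft_w])
    have hqa : q ≫ a = q₁ ≫ a₁ := Et.hom_ext conda
    have hqj : q ≫ j = q₁ ≫ j₁ := Et.hom_ext condj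
    let g₂ : U'.left ⟶ W₂.left := pullback.lift g' g₁ (by
      refine pullback.hom_ext ?_ ?_
      · simp only [l, l₁, Category.assoc, pullback.lift_fst, ha, ha₁]
      · simp only [l, l₁, Category.assoc, pullback.lift_snd, hj, hj₁])
    have hg₂ : g₂ ≫ Et.homLeft q = g' := pullback.lift_fst _ _ _
    have hg₂' : g₂ ≫ Et.homLeft q₁ = g₁ := pullback.lift_snd _ _ _
    refine hc.mul_eq_mul hα (W := W₂) (q ≫ j) g₂ ?_ (isUnit_α_res q he) (isUnit_α_res q₁ he₁)
      ?_ ?_ ?_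
    · rw [Et.homLeft_comp, ← Category.assoc, hg₂, hj]
    · have h1 := congrArg (Y.res q) hm
      have h2 := congrArg (Y.res q₁) hm₁
      rw [Y.res_res, map_mul, Y.res_res] at h1 h2
      rw [← h1, hqa, h2, hqj]
    · rw [he', α_res', ← CommRingCat.comp_apply, ← Scheme.Hom.comp_appTop, hg₂]
    · rw [he₁', α_res', ← CommRingCat.comp_apply, ← Scheme.Hom.comp_appTop, hg₂']
  obtain ⟨m', hm'⟩ := exists_sec_of_local R hres huniq hex
  refine ⟨m', ?_, ?_⟩
  · intro U' β W a j g' e p e' ha hj he hm he'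
    exact hm' U' β _ ⟨W, a, j, g', e, p, e', ha, hj, he, hm, he', rfl⟩
  · intro n hn
    refine sec_ext fun x => ?_
    obtain ⟨U', β, l, hx, hR⟩ := hex x
    refine ⟨U', β, hx, ?_⟩
    rw [hm' U' β l hR]
    obtain ⟨W, a, j, g', e, p, e', ha, hj, he, hm, he', rfl⟩ := hR
    exact hn U' β W a j g' e p e' ha hj he hm he'

/-- A morphism to a log scheme with a chart may be given by a map `v` to the domain of the chart and
a compatible homomorphism `c'` on the monoid of the chart. -/
theorem IsChart.exists_hom (hc : Y.IsChart V c)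
    {b : Z.scheme ⟶ Y.scheme} (hv : v ≫ V.hom = Z.top.hom ≫ b)
    (hα : ∀ p, Z.α Z.top (c' p) = v.appTop (Y.α V (c p))) :
    ∃ (f : Hom Z Y) (hf : f.base = b), ∀ p,
      f.flat Z.top V v (hf ▸ hv) (c p) = c' p := by
  have hU := fun U V' g hg m => hc.existsUnique_isChartPullback hv hα U V' g hg m
  let F : ∀ (U : Et Z.scheme) (V' : Et Y.scheme) (g : U.left ⟶ V'.left),
      g ≫ V'.hom = U.hom ≫ b → Y.sec V' → Z.sec U :=
    fun U V' g hg m => (hU U V' g hg m).choose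
  have hF : ∀ U V' g hg m, IsChartPullback c v c' U V' g m (F U V' g hg m) :=
    fun U V' g hg m => (hU U V' g hg m).choose_spec.1
  have hF' : ∀ U V' g hg m m', IsChartPullback c v c' U V' g m m' → F U V' g hg m = m' :=
    fun U V' g hg m m' h => ((hU U V' g hg m).choose_spec.2 m' h).symm
  let f : Hom Z Y :=
    { base := b
      flat := fun U V' g hg =>
        { toFun := F U V' g hg
          map_one' := by
            refine hF' U V' g hg 1 1 fun U' β W a j g' e p e' ha hj he hm he' => ?_
            have := hc.mul_eq_mul hα j g' hj (e := 1) (e₁ := e) (p := 1) (p₁ := p)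
              (by simp) he (by simpa using hm) (e' := 1) (by simp) he'
            simpa using this
          map_mul' := by
            intro m n
            refine sec_ext fun u => ?_
            obtain ⟨U', β, W, a, j, g', e, p, ⟨u', hu⟩, ha, hj, he, hm⟩ :=
              hc.exists_eq_mul v hv g hg m u
            obtain ⟨W₁, a₁, e₁, p₁, hx, he₁, hm₁⟩ := hc.1 W j (Y.res a n) (g' u')
            obtain ⟨U₁, β₁, g₁, hg₁, ⟨u₁, hu₁⟩⟩ := Et.exists_pull g' a₁ u' hx
            obtain ⟨e', he'⟩ := exists_flat_unit (Z := Z) g₁ (isUnit_α_res a₁ he)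
            obtain ⟨e₁', he₁'⟩ := exists_flat_unit (Z := Z) g₁ he₁
            have hA : g₁ ≫ Et.homLeft (a₁ ≫ a) = Et.homLeft (β₁ ≫ β) ≫ g := by
              rw [Et.homLeft_comp, ← Category.assoc, hg₁, Category.assoc, ha, Et.homLeft_comp,
                Category.assoc]
            have hJ : g₁ ≫ Et.homLeft (a₁ ≫ j) = Et.homLeft (Z.toTop U₁) ≫ v := by
              rw [Et.homLeft_comp, ← Category.assoc, hg₁, Category.assoc, hj, ← Category.assoc,
                ← Et.homLeft_comp, comp_toTop]
            have hM : Y.res (a₁ ≫ a) m = Y.res a₁ e * Y.res (a₁ ≫ j) (c p) := by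
              rw [← Y.res_res, hm, map_mul, Y.res_res]
            have hN : Y.res (a₁ ≫ a) n = e₁ * Y.res (a₁ ≫ j) (c p₁) := by
              rw [← Y.res_res, hm₁]
            refine ⟨U₁, β₁ ≫ β, ⟨u₁, ?_⟩, ?_⟩
            · rw [Et.homLeft_comp, Scheme.Hom.comp_apply, hu₁, hu]
            · rw [map_mul, hF U V' g hg m U₁ _ W₁ _ _ g₁ _ p e' hA hJ (isUnit_α_res a₁ he) hM he',
                hF U V' g hg n U₁ _ W₁ _ _ g₁ _ p₁ e₁' hA hJ he₁ hN he₁',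
                hF U V' g hg (m * n) U₁ _ W₁ _ _ g₁ (Y.res a₁ e * e₁) (p * p₁) (e' * e₁') hA hJ
                  (by rw [map_mul]; exact (isUnit_α_res a₁ he).mul he₁)
                  (by rw [map_mul, hM, hN, map_mul, map_mul]; exact mul_mul_mul_comm _ _ _ _)
                  (by rw [map_mul, map_mul, map_mul, he', he₁']), map_mul, map_mul]
              exact mul_mul_mul_comm _ _ _ _ }
      res_flat := by
        intro U' U V' β g hg hg' m
        refine (hF' U' V' (Et.homLeft β ≫ g) hg' m _ ?_).symm
        intro U₁ β₁ W a j g' e p e' ha hj he hm he'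
        rw [Z.res_res]
        refine hF U V' g hg m U₁ (β₁ ≫ β) W a j g' e p e' ?_ hj he hm he'
        rw [ha, Et.homLeft_comp, Category.assoc]
      flat_res := by
        intro U V' V'' b' g hg hg' m
        refine hF' U V' g hg (Y.res b' m) _ ?_
        intro U₁ β₁ W a j g' e p e' ha hj he hm he'
        rw [Y.res_res] at hm
        refine hF U V'' (g ≫ Et.homLeft b') hg' m U₁ β₁ W (a ≫ b') j g' e p e' ?_ hj he hm he'
        rw [Et.homLeft_comp, ← Category.assoc, ha, Category.assoc]
      α_flat := by
        intro U V' g hg m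
        refine Et.function_ext fun u => ?_
        obtain ⟨U', β, W, a, j, g', e, p, hu, ha, hj, he, hm⟩ := hc.exists_eq_mul v hv g hg m u
        obtain ⟨e', he'⟩ := exists_flat_unit g' he
        refine ⟨U', β, hu, ?_⟩
        have h1 := hF U V' g hg m U' β W a j g' e p e' ha hj he hm he'
        change (Et.homLeft β).appTop (Z.α U (F U V' g hg m)) = _
        rw [← α_res', h1, ← CommRingCat.comp_apply, ← Scheme.Hom.comp_appTop, ← ha,
          Scheme.Hom.comp_appTop, CommRingCat.comp_apply, ← α_res', hm, map_mul, map_mul, map_mul,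
          he', α_res', α_res', hα, ← CommRingCat.comp_apply, ← CommRingCat.comp_apply,
          ← Scheme.Hom.comp_appTop, ← Scheme.Hom.comp_appTop, hj] }
  refine ⟨f, rfl, fun p => ?_⟩
  have e : Z.toTop Z.top = 𝟙 _ := Et.hom_ext rfl
  have := hF Z.top V v hv (c p) Z.top (𝟙 _) V (𝟙 _) (𝟙 _) v 1 p 1
    (by simp) (by simp [e]) (by simp) (by simp [res_id]) (by simp)
  rw [res_id, one_mul, e, res_id] at this
  exact this

end Lift

end LogScheme

/-! ### Operations on charts, global sections -/

theorem Et.exists_restrict {S : Scheme.{0}} (U : Et S) (O : U.left.Opens) {x : U.left}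
    (hx : x ∈ O) : ∃ (W : Et S) (a : W ⟶ U), x ∈ Set.range (Et.homLeft a) ∧
      ∀ w : W.left, Et.homLeft a w ∈ O := by
  refine ⟨Et.mk (O.ι ≫ U.hom), Et.homMk O.ι rfl, ⟨⟨x, hx⟩, rfl⟩, fun w => w.2⟩

namespace LogScheme

theorem IsChart.restrict {X : LogScheme} {U V : Et X.scheme} {P : Type} [CommMonoid P]
    {c : P →* X.sec U} (hc : X.IsChart U c) (a : V ⟶ U) : X.IsChart V ((X.res a).comp c) := by
  constructor
  · intro W j m x
    obtain ⟨W', b, e, p, hx, he, hm⟩ := hc.1 W (j ≫ a) m x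
    refine ⟨W', b, e, p, hx, he, ?_⟩
    rw [hm, MonoidHom.comp_apply, X.res_res, Category.assoc]
  · intro W j e e' p p' he he' h x
    simp only [MonoidHom.comp_apply, X.res_res] at h ⊢
    obtain ⟨W', b, s, s', hx, hs, hs', hp, h⟩ := hc.2 W (j ≫ a) e e' p p' he he' h x
    simp only [← Category.assoc] at hs hs' h
    exact ⟨W', b, s, s', hx, by simpa only [Category.assoc] using hs,
      by simpa only [Category.assoc] using hs', hp, by simpa only [Category.assoc] using h⟩

theorem IsChart.comp_mulEquiv {X : LogScheme} {U : Et X.scheme} {P Q : Type} [CommMonoid P]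
    [CommMonoid Q] {c : P →* X.sec U} (hc : X.IsChart U c) (φ : Q ≃* P) :
    X.IsChart U (c.comp φ.toMonoidHom) := by
  constructor
  · intro W j m x
    obtain ⟨W', b, e, p, hx, he, hm⟩ := hc.1 W j m x
    obtain ⟨q, rfl⟩ := φ.surjective p
    exact ⟨W', b, e, q, hx, he, hm⟩
  · intro W j e e' p p' he he' h x
    obtain ⟨W', b, s, s', hx, hs, hs', hp, h⟩ := hc.2 W j e e' (φ p) (φ p') he he' h x
    obtain ⟨t, rfl⟩ := φ.surjective s
    obtain ⟨t', rfl⟩ := φ.surjective s'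
    rw [← map_mul, ← map_mul] at hp
    exact ⟨W', b, t, t', hx, hs, hs', φ.injective hp, h⟩

theorem globalFlat_comp {X Y Z : LogScheme} (f : X ⟶ Y) (g : Y ⟶ Z) (m : Z.sec Z.top) :
    globalFlat (f ≫ g) m = globalFlat f (globalFlat g m) :=
  Hom.comp_flat f g (U := X.top) (V := Y.top) (W := Z.top) (Hom.base f) (Hom.base g) _ _ _ rfl _ m

theorem globalFlat_id {X : LogScheme} (m : X.sec X.top) : globalFlat (𝟙 X) m = m :=
  X.res_id m

theorem α_globalFlat {X Y : LogScheme} (f : X ⟶ Y) (m : Y.sec Y.top) :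
    X.α X.top (globalFlat f m) = (Hom.base f).appTop (Y.α Y.top m) :=
  Hom.α_flat f _ _ _ _ _

theorem base_comp {X Y Z : LogScheme} (f : X ⟶ Y) (g : Y ⟶ Z) :
    Hom.base (f ≫ g) = Hom.base f ≫ Hom.base g := rfl

end LogScheme

open LogScheme

/-! ### Sections of constant log structures -/

section ConstLog

variable {S : Scheme.{0}} {P : Type} [CommMonoid P] {α : P →* Γ(S, ⊤)}
  {hα : ∀ p, p ≠ 1 → IsNilpotent (α p)}

/-- The section `(u, f)` of a constant log structure. -/
def constSec (U : Et (constLog S P α hα).scheme) (u : Γ(U.left, ⊤)ˣ)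
    (f : LocallyConstant U.left P) : (constLog S P α hα).sec U := (u, f)

theorem exists_constSec {U : Et (constLog S P α hα).scheme} (m : (constLog S P α hα).sec U) :
    ∃ u f, m = constSec U u f := ⟨m.1, m.2, rfl⟩

theorem constSec_inj {U : Et (constLog S P α hα).scheme} {u u' : Γ(U.left, ⊤)ˣ}
    {f f' : LocallyConstant U.left P} (h : constSec (hα := hα) U u f = constSec U u' f') :
    u = u' ∧ f = f' := Prod.ext_iff.1 h

theorem constSec_mul {U : Et (constLog S P α hα).scheme} (u u' : Γ(U.left, ⊤)ˣ)
    (f f' : LocallyConstant U.left P) :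
    constSec (hα := hα) U u f * constSec U u' f' = constSec U (u * u') (f * f') := rfl

theorem res_constSec {U V : Et (constLog S P α hα).scheme} (a : V ⟶ U) (u : Γ(U.left, ⊤)ˣ)
    (f : LocallyConstant U.left P) :
    (constLog S P α hα).res a (constSec U u f) =
      constSec V (Units.map (Et.homLeft a).appTop.hom.toMonoidHom u)
        (f.comap (Et.homLeft a).base.hom) := by
  refine Prod.ext rfl ?_
  ext x
  rfl

theorem α_constSec_const {U : Et (constLog S P α hα).scheme} (u : Γ(U.left, ⊤)ˣ) (p : P) :
    (constLog S P α hα).α U (constSec U u (LocallyConstant.const _ p)) =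
      u * U.hom.appTop (α p) := by
  exact congrArg (fun z : Γ(U.left, ⊤) => (u : Γ(U.left, ⊤)) * z)
    (glue_const (((U.hom.appTop.hom : Γ(S, ⊤) →* Γ(U.left, ⊤)).comp α)) p)

theorem isUnit_α_constSec {U : Et (constLog S P α hα).scheme} {u : Γ(U.left, ⊤)ˣ}
    {f : LocallyConstant U.left P} :
    IsUnit ((constLog S P α hα).α U (constSec U u f)) ↔ f = 1 := by
  constructor
  · intro h
    exact eq_one_of_isUnit_glue _ (fun p hp => (hα p hp).map U.hom.appTop.hom) f
      (isUnit_of_mul_isUnit_right h)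
  · rintro rfl
    have := α_constSec_const (hα := hα) u 1
    rw [map_one, map_one, mul_one] at this
    change IsUnit ((constLog S P α hα).α U (constSec U u (LocallyConstant.const _ 1)))
    rw [this]
    exact u.isUnit

/-- The global section `(u, p)` of a constant log structure. -/
noncomputable def constTop (u : Γ(S, ⊤)ˣ) (p : P) :
    (constLog S P α hα).sec (constLog S P α hα).top :=
  constSec _ u (LocallyConstant.const _ p)

theorem constTop_mul (u u' : Γ(S, ⊤)ˣ) (p p' : P) :
    constTop (hα := hα) u p * constTop u' p' = constTop (u * u') (p * p') := rfl

theorem constTop_one : constTop (hα := hα) 1 1 = 1 := rfl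

theorem constTop_inj [Nonempty S] {u u' : Γ(S, ⊤)ˣ} {p p' : P}
    (h : constTop (hα := hα) u p = constTop u' p') : u = u' ∧ p = p' := by
  obtain ⟨h1, h2⟩ := constSec_inj h
  refine ⟨h1, ?_⟩
  obtain ⟨x⟩ := ‹Nonempty S›
  exact congrArg (fun f : LocallyConstant S P => f x) h2

theorem exists_constTop [Subsingleton S] [Nonempty S]
    (m : (constLog S P α hα).sec (constLog S P α hα).top) :
    ∃ u p, m = constTop u p := by
  obtain ⟨u, f, rfl⟩ := exists_constSec m
  obtain ⟨x⟩ := ‹Nonempty S›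
  let f' : LocallyConstant S P := f
  refine ⟨u, f' x, congrArg (constSec _ u) ?_⟩
  refine LocallyConstant.ext fun (y : S) => ?_
  exact congrArg f' (Subsingleton.elim y x)

theorem α_constTop (u : Γ(S, ⊤)ˣ) (p : P) :
    (constLog S P α hα).α _ (constTop u p) = (u * α p : Γ(S, ⊤)) := by
  refine (α_constSec_const (hα := hα) (U := (constLog S P α hα).top) u p).trans ?_
  refine congrArg (fun z : Γ(S, ⊤) => (u : Γ(S, ⊤)) * z) ?_
  change (𝟙 S : S ⟶ S).appTop (α p) = α p
  simp

theorem res_constTop_one {V : Et (constLog S P α hα).scheme}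
    (j : V ⟶ (constLog S P α hα).top) (p : P) :
    (constLog S P α hα).res j (constTop 1 p) = constSec V 1 (LocallyConstant.const _ p) :=
  Prod.ext (map_one _) rfl

/-- The tautological chart of a constant log structure. -/
noncomputable def constChart (α : P →* Γ(S, ⊤)) (hα : ∀ p, p ≠ 1 → IsNilpotent (α p)) :
    P →* (constLog S P α hα).sec (constLog S P α hα).top where
  toFun p := constTop 1 p
  map_one' := rfl
  map_mul' p p' := ((constTop_mul 1 1 p p').trans (by rw [mul_one])).symm

theorem isChart_constChart :
    (constLog S P α hα).IsChart (constLog S P α hα).top (constChart α hα) := by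
  constructor
  · intro V j m x
    obtain ⟨u, f, rfl⟩ := exists_constSec m
    obtain ⟨W, a, hx, hW⟩ := Et.exists_restrict V
      ⟨f ⁻¹' {f x}, f.isLocallyConstant.isOpen_fiber _⟩ (x := x) rfl
    refine ⟨W, a, constSec W (Units.map (Et.homLeft a).appTop.hom.toMonoidHom u) 1, f x, hx,
      isUnit_α_constSec.2 rfl, ?_⟩
    refine (res_constSec a u f).trans ?_
    refine Eq.trans ?_ (congrArg _ (res_constTop_one (a ≫ j) _)).symm
    refine Eq.trans ?_ (constSec_mul _ _ _ _).symm
    congr 1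
    · rw [mul_one]
    · ext w
      exact (hW w).trans (one_mul _).symm
  · intro V j e e' p p' he he' h x
    obtain ⟨u, f, rfl⟩ := exists_constSec e
    obtain ⟨u', f', rfl⟩ := exists_constSec e'
    obtain rfl := isUnit_α_constSec.1 he
    obtain rfl := isUnit_α_constSec.1 he'
    have h2 := (congrArg _ (res_constTop_one j _)).symm.trans
      (h.trans (congrArg _ (res_constTop_one j _)))
    obtain ⟨h3, h4⟩ := constSec_inj ((constSec_mul _ _ _ _).symm.trans
      (h2.trans (constSec_mul _ _ _ _)))
    rw [mul_one, mul_one] at h3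
    have h5 : p = p' := by
      have := congrArg (fun f : LocallyConstant V.left P => f x) h4
      exact ((one_mul _).symm.trans this).trans (one_mul _)
    subst h3 h5
    have h1 : IsUnit ((constLog S P α hα).α V
        ((constLog S P α hα).res (𝟙 V ≫ j) (constChart α hα 1))) := by
      have : (constLog S P α hα).res (𝟙 V ≫ j) (constChart α hα 1) = 1 :=
        (congrArg _ (map_one _)).trans (map_one _)
      rw [this]
      exact isUnit_α_constSec.2 rfl
    exact ⟨V, 𝟙 V, 1, 1, ⟨x, rfl⟩, h1, h1, rfl, rfl⟩

/-- Two morphisms to a scheme with a constant log structure are equal if they agree on schemes and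
on the constant monoid. -/
theorem constLog_hom_ext {Z : LogScheme} {f f' : Z ⟶ constLog S P α hα}
    (hb : Hom.base f = Hom.base f')
    (h : ∀ p, globalFlat f (constTop 1 p) = globalFlat f' (constTop 1 p)) : f = f' := by
  refine (isChart_constChart (hα := hα)).hom_ext (f := f) (f' := f') (Hom.base f)
    ((Category.comp_id _).trans (Category.id_comp _).symm)
    ((Category.comp_id _).trans (hb.trans (Category.id_comp _).symm)) fun p => ?_
  refine (h p).trans ?_
  exact Hom.flat_congr f' hb.symm _ _

theorem constLog_exists_hom {Z : LogScheme} (b : Z.scheme ⟶ S) (c : P →* Z.sec Z.top)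
    (h : ∀ p, Z.α Z.top (c p) = b.appTop (α p)) :
    ∃ f : Z ⟶ constLog S P α hα, Hom.base f = b ∧ ∀ p, globalFlat f (constTop 1 p) = c p := by
  let v : Z.top.left ⟶ (constLog S P α hα).top.left := b
  obtain ⟨f, rfl, hf⟩ := (isChart_constChart (hα := hα)).exists_hom (Z := Z) (c' := c)
    (v := v) (b := b)
    ((Category.comp_id _).trans (Category.id_comp _).symm) (fun p => by
      rw [h]
      refine congrArg b.appTop ?_
      exact ((α_constTop 1 p).trans (one_mul _)).symm)
  exact ⟨f, rfl, hf⟩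

variable {S' : Scheme.{0}} {P' : Type} [CommMonoid P'] {α' : P' →* Γ(S', ⊤)}
  {hα' : ∀ p, p ≠ 1 → IsNilpotent (α' p)}

theorem globalFlat_unit (f : constLog S' P' α' hα' ⟶ constLog S P α hα) (u : Γ(S, ⊤)ˣ) :
    globalFlat f (constTop u 1) = constTop (Units.map (Hom.base f).appTop.hom.toMonoidHom u) 1 := by
  refine sec_ext_of_isUnit ?_ ?_
  · rw [α_globalFlat]
    refine IsUnit.map (Hom.base f).appTop.hom ?_
    exact isUnit_α_constSec.2 rfl
  · rw [α_globalFlat]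
    refine Eq.trans ?_ (α_constTop _ _).symm
    refine (congrArg (Hom.base f).appTop (α_constTop u 1)).trans ?_
    rw [map_one, mul_one]
    let v : Γ(S', ⊤)ˣ := Units.map (Hom.base f).appTop.hom.toMonoidHom u
    have hv : (v * α' 1 : Γ(S', ⊤)) = v := by rw [map_one, mul_one]
    exact hv.symm

theorem globalFlat_constTop (f : constLog S' P' α' hα' ⟶ constLog S P α hα) (u : Γ(S, ⊤)ˣ) (p : P)
    {v : Γ(S', ⊤)ˣ} {p' : P'} (h : globalFlat f (constTop 1 p) = constTop v p') :
    globalFlat f (constTop u p) =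
      constTop (Units.map (Hom.base f).appTop.hom.toMonoidHom u * v) p' := by
  have : constTop (hα := hα) u p = constTop u 1 * constTop 1 p := by
    rw [constTop_mul, mul_one, one_mul]
  rw [this, map_mul, h, globalFlat_unit, constTop_mul, one_mul]

theorem globalFlat_constLogMap (b : S' ⟶ S) (φ : P →* P') (h : ∀ p, b.appTop (α p) = α' (φ p))
    (p : P) : globalFlat (constLogMap (hα := hα) (hβ := hα') b φ h) (constTop 1 p) =
      constTop 1 (φ p) := by
  refine Prod.ext (map_one _) ?_
  rfl

/-- A morphism between schemes with constant log structures, from a morphism `b` of schemes and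
the map `p ↦ (χ p, φ p)`. -/
theorem exists_constLog_hom (b : S' ⟶ S) (χ : P →* Γ(S', ⊤)ˣ) (φ : P →* P')
    (h : ∀ p, (χ p * α' (φ p) : Γ(S', ⊤)) = b.appTop (α p)) :
    ∃ f : constLog S' P' α' hα' ⟶ constLog S P α hα, Hom.base f = b ∧
      ∀ u p, globalFlat f (constTop u p) =
        constTop (Units.map b.appTop.hom.toMonoidHom u * χ p) (φ p) := by
  obtain ⟨f, rfl, hf⟩ := constLog_exists_hom (hα := hα) (Z := constLog S' P' α' hα') b
    { toFun := fun p => constTop (χ p) (φ p)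
      map_one' := by rw [map_one, map_one]; rfl
      map_mul' := fun p p' => by rw [map_mul, map_mul]; rfl } (fun p => by
        refine (α_constTop _ _).trans (h p))
  exact ⟨f, rfl, fun u p => globalFlat_constTop f u p (hf p)⟩

end ConstLog

/-! ### Constant log structures on affine schemes -/

section SpecSec

variable {A B : Type} [CommRing A] [CommRing B] {P P' : Type} [CommMonoid P] [CommMonoid P']
  {α : P →* Γ(Spec (.of A), ⊤)} {hα : ∀ p, p ≠ 1 → IsNilpotent (α p)}
  {β : P' →* Γ(Spec (.of B), ⊤)} {hβ : ∀ p, p ≠ 1 → IsNilpotent (β p)}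

/-- An element of a ring as a global function on the spectrum. -/
noncomputable def specFun (A : Type) [CommRing A] : A ≃+* Γ(Spec (CommRingCat.of A), ⊤) :=
  (Scheme.ΓSpecIso (CommRingCat.of A)).symm.commRingCatIsoToRingEquiv

theorem appTop_specFun (ψ : A →+* B) (a : A) :
    (Spec.map (CommRingCat.ofHom ψ)).appTop (specFun A a) = specFun B (ψ a) := by
  have := Scheme.ΓSpecIso_inv_naturality (CommRingCat.ofHom ψ)
  exact (congr($(this) a)).symm

/-- The global section `(u, p)` of a constant log structure on the spectrum of a ring. -/
noncomputable def specSec (u : Aˣ) (p : P) :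
    (constLog (Spec (.of A)) P α hα).sec (constLog (Spec (.of A)) P α hα).top :=
  constTop (Units.map (specFun A : A →* Γ(Spec (CommRingCat.of A), ⊤)) u) p

theorem specSec_one : specSec (hα := hα) 1 1 = 1 := by
  rw [specSec, map_one, constTop_one]

theorem specSec_mul (u u' : Aˣ) (p p' : P) :
    specSec (hα := hα) u p * specSec u' p' = specSec (u * u') (p * p') := by
  rw [specSec, specSec, constTop_mul, ← map_mul, specSec]

theorem hollowSec_eq {K : Type} [Field K] {S : AddSubmonoid ℚ≥0} (x : Kˣ) (r : S) :
    hollowSec x r = specSec x (Multiplicative.ofAdd r) := rfl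

theorem constTop_one_eq (p : P) : constTop (hα := hα) 1 p = specSec 1 p := by
  rw [specSec, map_one]

theorem specSec_inj [Nontrivial A] {u u' : Aˣ} {p p' : P}
    (h : specSec (hα := hα) u p = specSec u' p') : u = u' ∧ p = p' := by
  have : Nonempty (Spec (CommRingCat.of A)) := inferInstanceAs (Nonempty (PrimeSpectrum A))
  obtain ⟨h1, h2⟩ := constTop_inj h
  exact ⟨Units.map_injective (specFun A).injective h1, h2⟩

theorem exists_specSec [Subsingleton (PrimeSpectrum A)] [Nontrivial A]
    (m : (constLog (Spec (.of A)) P α hα).sec (constLog (Spec (.of A)) P α hα).top) :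
    ∃ u p, m = specSec u p := by
  have : Nonempty (Spec (CommRingCat.of A)) := inferInstanceAs (Nonempty (PrimeSpectrum A))
  have : Subsingleton (Spec (CommRingCat.of A)) :=
    inferInstanceAs (Subsingleton (PrimeSpectrum A))
  obtain ⟨u, p, rfl⟩ := exists_constTop m
  refine ⟨Units.map ((specFun A).symm : Γ(Spec (CommRingCat.of A), ⊤) →* A) u, p, ?_⟩
  rw [specSec]
  congr 1
  ext
  simp

theorem α_specSec (u : Aˣ) (p : P) :
    (constLog (Spec (.of A)) P α hα).α _ (specSec u p) =
      (specFun A u * α p : Γ(Spec (CommRingCat.of A), ⊤)) := α_constTop _ _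

theorem map_specFun_units (ψ : A →+* B) (u : Aˣ) :
    Units.map (Spec.map (CommRingCat.ofHom ψ)).appTop.hom.toMonoidHom
      (Units.map (specFun A : A →* Γ(Spec (CommRingCat.of A), ⊤)) u) =
    Units.map (specFun B : B →* Γ(Spec (CommRingCat.of B), ⊤)) (Units.map (ψ : A →* B) u) :=
  Units.ext (appTop_specFun ψ u)

theorem exists_base_eq (f : constLog (Spec (.of B)) P' β hβ ⟶ constLog (Spec (.of A)) P α hα) :
    ∃ ψ : A →+* B, Hom.base f = Spec.map (CommRingCat.ofHom ψ) := by
  obtain ⟨ψ, hψ⟩ := Spec.map_surjective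
    (Hom.base f : Spec (CommRingCat.of B) ⟶ Spec (CommRingCat.of A))
  exact ⟨ψ.hom, hψ.symm⟩

theorem globalFlat_specSec (f : constLog (Spec (.of B)) P' β hβ ⟶ constLog (Spec (.of A)) P α hα)
    {ψ : A →+* B} (hψ : Hom.base f = Spec.map (CommRingCat.ofHom ψ)) (u : Aˣ) (p : P)
    {v : Bˣ} {p' : P'} (h : globalFlat f (specSec 1 p) = specSec v p') :
    globalFlat f (specSec u p) = specSec (Units.map (ψ : A →* B) u * v) p' := by
  rw [← constTop_one_eq, specSec] at h
  rw [specSec, globalFlat_constTop f _ _ h, specSec, hψ, map_mul]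
  congr 2
  exact map_specFun_units ψ u

theorem spec_hom_ext {f f' : constLog (Spec (.of B)) P' β hβ ⟶ constLog (Spec (.of A)) P α hα}
    (hb : Hom.base f = Hom.base f')
    (h : ∀ p, globalFlat f (specSec 1 p) = globalFlat f' (specSec 1 p)) : f = f' :=
  constLog_hom_ext hb fun p => by rw [constTop_one_eq, h]

theorem exists_spec_hom (ψ : A →+* B) (χ : P →* Bˣ) (φ : P →* P')
    (h : ∀ p, specFun B (χ p) * β (φ p) = (Spec.map (CommRingCat.ofHom ψ)).appTop (α p)) :
    ∃ f : constLog (Spec (.of B)) P' β hβ ⟶ constLog (Spec (.of A)) P α hα,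
      Hom.base f = Spec.map (CommRingCat.ofHom ψ) ∧
      ∀ u p, globalFlat f (specSec u p) = specSec (Units.map (ψ : A →* B) u * χ p) (φ p) := by
  obtain ⟨f, hf, hf'⟩ := exists_constLog_hom (hα := hα) (hα' := hβ)
    (Spec.map (CommRingCat.ofHom ψ))
    ((Units.map (specFun B : B →* Γ(Spec (CommRingCat.of B), ⊤))).comp χ) φ h
  refine ⟨f, hf, fun u p => ?_⟩
  rw [specSec, hf', specSec, map_mul, map_specFun_units]
  rfl

end SpecSec

/-! ### Spectra of fields with a monoid of non-negative rational numbers -/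

theorem indic_eq (S : AddSubmonoid ℚ≥0) (A : Type) [CommRing A] (r : Multiplicative S) :
    indic S Γ(Spec (.of A), ⊤) r = specFun A (indic S A r) := by
  have h := map_indic S S le_rfl (specFun A : A →+* Γ(Spec (.of A), ⊤)) r
  exact h.symm

section Hollow

variable {K L : Type} [Field K] [Field L] {S T : AddSubmonoid ℚ≥0}

theorem hollowSec_inj {x x' : Kˣ} {r r' : S} (h : hollowSec x r = hollowSec x' r') :
    x = x' ∧ r = r' := by
  obtain ⟨h1, h2⟩ := specSec_inj h
  exact ⟨h1, Multiplicative.ofAdd.injective h2⟩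

theorem exists_hollowSec (m : (hollow K S).sec (hollow K S).top) :
    ∃ (x : Kˣ) (r : S), m = hollowSec x r := by
  obtain ⟨u, p, rfl⟩ := exists_specSec m
  exact ⟨u, p.toAdd, rfl⟩

theorem hollowSec_mul (x x' : Kˣ) (r r' : S) :
    hollowSec x r * hollowSec x' r' = hollowSec (x * x') (r + r') := specSec_mul _ _ _ _

theorem hollowSec_one : hollowSec (1 : Kˣ) (0 : S) = 1 := specSec_one

theorem hollow_hom_ext {f f' : hollow L T ⟶ hollow K S} (hb : Hom.base f = Hom.base f')
    (h : ∀ r : S, globalFlat f (hollowSec 1 r) = globalFlat f' (hollowSec 1 r)) : f = f' :=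
  spec_hom_ext hb fun p => h p.toAdd

theorem hollow_globalFlat (f : hollow L T ⟶ hollow K S) {ψ : K →+* L}
    (hψ : Hom.base f = Spec.map (CommRingCat.ofHom ψ)) (x : Kˣ) (r : S) {y : Lˣ} {r' : T}
    (h : globalFlat f (hollowSec 1 r) = hollowSec y r') :
    globalFlat f (hollowSec x r) = hollowSec (Units.map (ψ : K →* L) x * y) r' :=
  globalFlat_specSec f hψ x _ h

theorem globalFlat_hollowMap [Algebra K L] (h : S ≤ T) (x : Kˣ) (r : S) :
    globalFlat (hollowMap K L h) (hollowSec x r) =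
      hollowSec (Units.map (algebraMap K L : K →* L) x) (AddSubmonoid.inclusion h r) := by
  have h1 : globalFlat (hollowMap K L h) (hollowSec 1 r) =
      hollowSec 1 (AddSubmonoid.inclusion h r) := by
    rw [hollowSec_eq, ← constTop_one_eq, hollowMap, globalFlat_constLogMap]
    exact constTop_one_eq _
  rw [hollow_globalFlat _ rfl x r h1, mul_one]

/-- Morphisms between spectra of fields with log structures, from a map `ψ` of fields and the map
`r ↦ (χ r, r)` on the monoids. -/
theorem exists_hollow_hom (ψ : K →+* L) (h : S ≤ T) (χ : Multiplicative S →* Lˣ) :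
    ∃ f : hollow L T ⟶ hollow K S, Hom.base f = Spec.map (CommRingCat.ofHom ψ) ∧
      ∀ x r, globalFlat f (hollowSec x r) =
        hollowSec (Units.map (ψ : K →* L) x * χ (Multiplicative.ofAdd r))
          (AddSubmonoid.inclusion h r) := by
  obtain ⟨f, hf, hf'⟩ := exists_spec_hom (A := K) (B := L) (P := Multiplicative S)
    (P' := Multiplicative T) (α := indic S _)
    (hα := fun r hr => by rw [indic_of_ne S _ r hr]; exact IsNilpotent.zero) (β := indic T _)
    (hβ := fun r hr => by rw [indic_of_ne T _ r hr]; exact IsNilpotent.zero)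
    ψ χ (AddMonoidHom.toMultiplicative (AddSubmonoid.inclusion h)) (fun r => by
      rw [map_indic S T h (Spec.map (CommRingCat.ofHom ψ)).appTop.hom r]
      by_cases hr : r = 1
      · subst hr
        simp
      · rw [indic_of_ne, mul_zero]
        intro h'
        exact hr (AddSubmonoid.inclusion_injective h h'))
  exact ⟨f, hf, fun x r => hf' x (Multiplicative.ofAdd r)⟩

end Hollow

/-! ### Group completions -/

/-- A group which contains a monoid and consists of quotients of elements of the monoid is its group
completion. -/
theorem bijective_grothendieckLift {M G : Type} [CommMonoid M] [CommGroup G] (f : M →* G)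
    (hf : Function.Injective f) (hs : ∀ g, ∃ a b, g = f a / f b) :
    Function.Bijective (Algebra.GrothendieckGroup.lift f) := by
  have hof : ∀ m, Algebra.GrothendieckGroup.lift f (Algebra.GrothendieckGroup.of m) = f m :=
    fun m => DFunLike.congr_fun (Algebra.GrothendieckGroup.lift.symm_apply_apply f) m
  constructor
  · rw [injective_iff_map_eq_one]
    intro x hx
    rw [Algebra.GrothendieckGroup.lift_apply, div_eq_one] at hx
    have h := (Localization.monoidOf (⊤ : Submonoid M)).sec_spec' x
    have h2 := hf hx
    rw [h2] at h
    exact (mul_eq_left (a := Algebra.GrothendieckGroup.of _)).1 h.symm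
  · intro g
    obtain ⟨a, b, rfl⟩ := hs g
    refine ⟨Algebra.GrothendieckGroup.of a / Algebra.GrothendieckGroup.of b, ?_⟩
    rw [map_div, hof, hof]

/-- The group completion of `ℕ` is `ℤ`. -/
noncomputable def natGroupEquiv :
    Algebra.GrothendieckGroup (Multiplicative ℕ) ≃* Multiplicative ℤ :=
  MulEquiv.ofBijective
    (Algebra.GrothendieckGroup.lift (AddMonoidHom.toMultiplicative (Nat.castAddMonoidHom ℤ)))
    (bijective_grothendieckLift _
      (fun a b h => Multiplicative.toAdd.injective
        (Nat.cast_injective (R := ℤ) (Multiplicative.ofAdd.injective h)))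
      (fun g => ⟨Multiplicative.ofAdd (g.toAdd).toNat, Multiplicative.ofAdd (-g.toAdd).toNat, by
        refine Multiplicative.toAdd.injective ?_
        exact (Int.toNat_sub_toNat_neg g.toAdd).symm⟩))

theorem gpMap_pow {M : Type} [CommMonoid M] (n : ℕ) :
    gpMap (powMonoidHom n : M →* M) = powMonoidHom n := by
  refine Algebra.GrothendieckGroup.lift.symm.injective ?_
  refine (Algebra.GrothendieckGroup.lift.symm_apply_apply _).trans ?_
  ext m
  exact map_pow Algebra.GrothendieckGroup.of m n

theorem gpMap_pow_ker {n : ℕ} (hn : n ≠ 0) :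
    (gpMap (powMonoidHom n : Multiplicative ℕ →* Multiplicative ℕ)).ker = ⊥ := by
  rw [gpMap_pow, eq_bot_iff]
  intro x hx
  have h : x ^ n = 1 := hx
  have h2 := congrArg natGroupEquiv h
  rw [map_pow, map_one] at h2
  have h3 : natGroupEquiv x = 1 := by
    refine Multiplicative.toAdd.injective ?_
    have h4 : n • (natGroupEquiv x).toAdd = 0 := congrArg Multiplicative.toAdd h2
    exact (smul_eq_zero.1 h4).resolve_left hn
  exact (map_eq_one_iff _ natGroupEquiv.injective).1 h3

theorem card_gpMap_pow {n : ℕ} :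
    Nat.card (Algebra.GrothendieckGroup (Multiplicative ℕ) ⧸
      (gpMap (powMonoidHom n : Multiplicative ℕ →* Multiplicative ℕ)).range) = n := by
  change Subgroup.index _ = n
  rw [gpMap_pow, ← Subgroup.index_map_equiv _ natGroupEquiv]
  have : ((powMonoidHom n : Algebra.GrothendieckGroup (Multiplicative ℕ) →* _).range).map
      (natGroupEquiv : _ →* Multiplicative ℤ) =
      AddSubgroup.toSubgroup (AddSubgroup.zmultiples (n : ℤ)) := by
    ext x
    constructor
    · rintro ⟨_, ⟨y, rfl⟩, rfl⟩
      refine ⟨(natGroupEquiv y).toAdd, ?_⟩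
      refine Multiplicative.ofAdd.injective ?_
      change _ = natGroupEquiv (y ^ n)
      rw [map_pow]
      refine Multiplicative.toAdd.injective ?_
      change (natGroupEquiv y).toAdd • (n : ℤ) = n • (natGroupEquiv y).toAdd
      simp [mul_comm]
    · rintro ⟨a, ha⟩
      refine ⟨_, ⟨natGroupEquiv.symm (Multiplicative.ofAdd a), rfl⟩, ?_⟩
      refine (map_pow natGroupEquiv _ n).trans ?_
      rw [MulEquiv.apply_symm_apply]
      refine Multiplicative.toAdd.injective (Eq.trans ?_ ha)
      change n • a = a • (n : ℤ)
      simp [mul_comm]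
  rw [this]
  exact Int.index_zmultiples n

/-! ### Truncated polynomial rings -/

open Polynomial in
/-- The ring `L[x]/(x^m)`. -/
abbrev TruncRing (L : Type) [Field L] (m : ℕ) : Type := AdjoinRoot (X ^ m : L[X])

namespace TruncRing

variable (L : Type) [Field L] (m : ℕ)

open Polynomial

/-- The class of the variable. -/
noncomputable def x : TruncRing L m := AdjoinRoot.root _

theorem x_pow : x L m ^ m = 0 := by
  have := AdjoinRoot.eval₂_root (X ^ m : L[X])
  rwa [eval₂_pow, eval₂_X] at this

variable {L m}

/-- The homomorphism `L[x]/(x^m) → R` given by a homomorphism `L → R` and an element `y` with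
`y^m = 0`. -/
noncomputable def lift {R : Type} [CommRing R] (f : L →+* R) (y : R) (hy : y ^ m = 0) :
    TruncRing L m →+* R :=
  AdjoinRoot.lift f y (by rw [eval₂_pow, eval₂_X, hy])

@[simp] theorem lift_algebraMap {R : Type} [CommRing R] (f : L →+* R) (y : R) (hy : y ^ m = 0)
    (a : L) : lift f y hy (algebraMap L _ a) = f a := AdjoinRoot.lift_of _

@[simp] theorem lift_x {R : Type} [CommRing R] (f : L →+* R) (y : R) (hy : y ^ m = 0) :
    lift f y hy (x L m) = y := AdjoinRoot.lift_root _

theorem hom_ext {R : Type} [CommRing R] {f g : TruncRing L m →+* R}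
    (h : ∀ a : L, f (algebraMap L _ a) = g (algebraMap L _ a)) (hx : f (x L m) = g (x L m)) :
    f = g := by
  refine RingHom.ext fun a => ?_
  obtain ⟨p, rfl⟩ := AdjoinRoot.mk_surjective a
  induction p using Polynomial.induction_on' with
  | add p q hp hq => rw [map_add, map_add, map_add, hp, hq]
  | monomial n a =>
    rw [← C_mul_X_pow_eq_monomial, map_mul, map_pow, map_mul, map_mul, map_pow, map_pow]
    exact congrArg₂ (· * ·) (h a) (congrArg (· ^ n) hx)

theorem isNilpotent_x_pow {n : ℕ} (hn : n ≠ 0) : IsNilpotent (x L m ^ n) :=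
  IsNilpotent.pow_of_pos ⟨m, x_pow L m⟩ hn

instance finite : Module.Finite L (TruncRing L m) := (monic_X_pow m).finite_adjoinRoot

theorem x_pow_mul {n : ℕ} (hn : n ≠ 0) : x L m ^ (m * n) = 0 := by
  rw [pow_mul, x_pow, zero_pow hn]

end TruncRing

/-! ### The standard Kummer étale covers -/

/-- The homomorphism `j ↦ x^j`. -/
noncomputable def truncAlpha (L : Type) [Field L] (m : ℕ) :
    Multiplicative ℕ →* Γ(Spec (CommRingCat.of (TruncRing L m)), ⊤) :=
  (specFun (TruncRing L m) : TruncRing L m →* Γ(Spec (CommRingCat.of (TruncRing L m)), ⊤)).comp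
    (powersHom _ (TruncRing.x L m))

theorem truncAlpha_ofAdd (L : Type) [Field L] (m n : ℕ) :
    truncAlpha L m (Multiplicative.ofAdd n) = specFun _ (TruncRing.x L m ^ n) := rfl

theorem truncAlpha_isNilpotent (L : Type) [Field L] (m : ℕ) (j : Multiplicative ℕ) (hj : j ≠ 1) :
    IsNilpotent (truncAlpha L m j) :=
  (TruncRing.isNilpotent_x_pow (n := j.toAdd)
    (fun h => hj (Multiplicative.toAdd.injective h))).map (specFun (TruncRing L m))

theorem indic_isNilpotent (S : AddSubmonoid ℚ≥0) (R : Type) [CommRing R] (r : Multiplicative S)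
    (hr : r ≠ 1) : IsNilpotent (indic S R r) := by
  rw [indic_of_ne S _ r hr]
  exact IsNilpotent.zero

/-- The scheme `Spec L[x]/(x^m)` with the log structure `𝒪ˣ ⊕ ℕ`, where `j` is sent to `x^j`. -/
noncomputable abbrev truncLog (L : Type) [Field L] (m : ℕ) : LogScheme :=
  constLog (Spec (.of (TruncRing L m))) (Multiplicative ℕ) (truncAlpha L m)
    (truncAlpha_isNilpotent L m)

/-- The monoid `natMonoid` is isomorphic to `ℕ`. -/
noncomputable def natEquiv : ℕ ≃+ natMonoid :=
  AddEquiv.ofBijective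
    ({ toFun := natElt
       map_zero' := Subtype.ext Nat.cast_zero
       map_add' := fun a b => Subtype.ext (Nat.cast_add a b) } : ℕ →+ natMonoid)
    ⟨fun a b h => Nat.cast_injective (R := ℚ≥0) (congrArg Subtype.val h),
      fun ⟨_, n, h⟩ => ⟨n, Subtype.ext h⟩⟩

theorem natEquiv_apply (n : ℕ) : natEquiv n = natElt n := rfl

/-- The homomorphism `natMonoid → ℕ` given by multiplication by `m`. -/
noncomputable def mulNat (m : ℕ) : Multiplicative natMonoid →* Multiplicative ℕ :=
  (powMonoidHom m).comp (AddMonoidHom.toMultiplicative (natEquiv.symm : natMonoid →+ ℕ))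

theorem mulNat_ofAdd (m n : ℕ) :
    mulNat m (Multiplicative.ofAdd (natElt n)) = Multiplicative.ofAdd (m * n) := by
  change (Multiplicative.ofAdd (natEquiv.symm (natEquiv n))) ^ m = _
  rw [AddEquiv.symm_apply_apply, ← ofAdd_nsmul, smul_eq_mul]

section

variable (k : Type) [Field k] (L : Type) [Field L] [Algebra k L] (m : ℕ)

/-- The structure morphism of the standard Kummer étale cover. -/
noncomputable def truncMap : truncLog L m ⟶ logPoint k :=
  constLogMap (hα := indic_isNilpotent _ _) (hβ := truncAlpha_isNilpotent L m)
    (Spec.map (CommRingCat.ofHom (algebraMap k (TruncRing L m)))) (mulNat m) (by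
    intro q
    obtain ⟨n, hn⟩ := natEquiv.surjective q.toAdd
    obtain rfl : Multiplicative.ofAdd (natElt n) = q := congrArg Multiplicative.ofAdd hn
    rw [mulNat_ofAdd, indic_eq, appTop_specFun]
    refine congrArg (specFun _) ?_
    change _ = TruncRing.x L m ^ (m * n)
    by_cases h : n = 0
    · subst h
      have : Multiplicative.ofAdd (natElt 0) = 1 := congrArg Multiplicative.ofAdd
        (natEquiv.map_zero)
      rw [this, map_one, map_one, mul_zero, pow_zero]
    · rw [TruncRing.x_pow_mul h, indic_of_ne, map_zero]
      intro h'
      refine h (natEquiv.injective ?_)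
      rw [map_zero]
      exact congrArg Multiplicative.toAdd h')

/-- The standard Kummer étale cover of the standard log point, given by a field extension `L` of `k`
and the index `m` of ramification. -/
noncomputable def truncCover : Over (logPoint k) := Over.mk (truncMap k L m)

theorem globalFlat_truncMap (n : ℕ) :
    globalFlat (truncMap k L m) (hollowSec 1 (natElt n)) =
      specSec 1 (Multiplicative.ofAdd (m * n)) := by
  rw [hollowSec_eq, ← constTop_one_eq, truncMap, globalFlat_constLogMap, mulNat_ofAdd]
  exact constTop_one_eq _

end

theorem isFSMonoid_nat : IsFSMonoid (Multiplicative ℕ) := by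
  refine ⟨inferInstance, fun a b c h => mul_left_cancel h, fun a b n hn h => ?_⟩
  obtain ⟨c, hc⟩ := h
  have h1 : n * a.toAdd = n * b.toAdd + c.toAdd := congrArg Multiplicative.toAdd hc
  have h2 : b.toAdd ≤ a.toAdd := by
    refine Nat.le_of_mul_le_mul_left ?_ (Nat.pos_of_ne_zero hn)
    omega
  exact ⟨Multiplicative.ofAdd (a.toAdd - b.toAdd),
    Multiplicative.toAdd.injective (Nat.add_sub_cancel' h2).symm⟩

theorem constLog_isFS {S : Scheme.{0}} {P : Type} [CommMonoid P] {α : P →* Γ(S, ⊤)}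
    {hα : ∀ p, p ≠ 1 → IsNilpotent (α p)} (hP : IsFSMonoid P) : (constLog S P α hα).IsFS :=
  fun x => ⟨LogScheme.top _, P, _, _, ⟨(x : S), rfl⟩, hP, isChart_constChart⟩

section Kummer

variable {S S' : Scheme.{0}} {P P' : Type} [CommMonoid P] [CommMonoid P'] {α : P →* Γ(S, ⊤)}
  {hα : ∀ p, p ≠ 1 → IsNilpotent (α p)} {α' : P' →* Γ(S', ⊤)}
  {hα' : ∀ p, p ≠ 1 → IsNilpotent (α' p)}

/-- A morphism of constant log structures is Kummer if the homomorphism of monoids is injective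
and every element of the target has a power in the image. -/
theorem isKummer_constLogMap (b : S' ⟶ S) (φ : P →* P') (h : ∀ p, b.appTop (α p) = α' (φ p))
    (hφ : Function.Injective φ) (hφ' : ∀ p', ∃ n p, n ≠ 0 ∧ p' ^ n = φ p) :
    IsKummer (constLogMap (hα := hα) (hβ := hα') b φ h) := by
  constructor
  · intro V m y
    obtain ⟨u, f, rfl⟩ := exists_constSec m
    obtain ⟨W, a, hy, hW⟩ := Et.exists_restrict V
      ⟨f ⁻¹' {f y}, f.isLocallyConstant.isOpen_fiber _⟩ (x := y) rfl
    obtain ⟨n, p, hn, hp⟩ := hφ' (f y)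
    refine ⟨W, a, LogScheme.top _, W.hom ≫ b, Category.comp_id _, constTop 1 p,
      constSec W ((Units.map (Et.homLeft a).appTop.hom.toMonoidHom u) ^ n) 1, n, hy, hn,
      isUnit_α_constSec.2 rfl, ?_⟩
    refine (congrArg (· ^ n) (res_constSec a u f)).trans ?_
    refine Prod.ext ?_ ?_
    · let w : Γ(W.left, ⊤)ˣ := Units.map (Et.homLeft a).appTop.hom.toMonoidHom u
      have h1 : Units.map (W.hom ≫ b).appTop.hom.toMonoidHom 1 = 1 := map_one _
      exact ((congrArg (w ^ n * ·) h1).trans (mul_one (w ^ n))).symm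
    · refine LocallyConstant.ext fun w => ?_
      refine Eq.trans ?_ (one_mul _).symm
      refine Eq.trans ?_ hp
      exact congrArg (· ^ n) (hW w)
  · intro V U g hg m m' e he hm y
    obtain ⟨u, f, rfl⟩ := exists_constSec m
    obtain ⟨u', f', rfl⟩ := exists_constSec m'
    obtain ⟨v, l, rfl⟩ := exists_constSec e
    obtain rfl := isUnit_α_constSec.1 he
    have hf : f (g y) = f' (g y) := by
      have h2 := congrArg (fun z => z.2) hm
      have h3 := congrArg (fun l : LocallyConstant V.left P' => l y) h2
      have h4 : φ (f (g y)) = 1 * φ (f' (g y)) := h3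
      rw [one_mul] at h4
      exact hφ h4
    obtain ⟨W, a, hy, hW⟩ := Et.exists_restrict U
      ⟨f ⁻¹' {f (g y)} ∩ f' ⁻¹' {f (g y)}, (f.isLocallyConstant.isOpen_fiber _).inter
        (f'.isLocallyConstant.isOpen_fiber _)⟩ (x := g y) ⟨rfl, hf.symm⟩
    refine ⟨W, a, constSec W (Units.map (Et.homLeft a).appTop.hom.toMonoidHom (u * u'⁻¹)) 1, hy,
      isUnit_α_constSec.2 rfl, ?_⟩
    refine (res_constSec a u f).trans ?_
    refine Eq.trans ?_ (congrArg _ (res_constSec a u' f')).symm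
    refine Eq.trans ?_ (constSec_mul _ _ _ _).symm
    congr 1
    · rw [← map_mul, inv_mul_cancel_right]
    · ext w
      refine Eq.trans ?_ (one_mul _).symm
      exact (hW w).1.trans (hW w).2.symm

end Kummer

section Covers

variable {k : Type} [Field k] {L : Type} [Field L] [Algebra k L] {m : ℕ}

theorem mulNat_injective (hm : m ≠ 0) : Function.Injective (mulNat m) := by
  intro a b h
  have h1 : m • natEquiv.symm a.toAdd = m • natEquiv.symm b.toAdd :=
    congrArg Multiplicative.toAdd h
  rw [smul_eq_mul, smul_eq_mul] at h1
  exact Multiplicative.toAdd.injective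
    (natEquiv.symm.injective (Nat.eq_of_mul_eq_mul_left (Nat.pos_of_ne_zero hm) h1))

theorem isKummer_truncMap (hm : m ≠ 0) : IsKummer (truncMap k L m) := by
  rw [truncMap]
  refine isKummer_constLogMap _ _ _ (mulNat_injective hm) fun j => ?_
  refine ⟨m, Multiplicative.ofAdd (natElt j.toAdd), hm, ?_⟩
  rw [mulNat_ofAdd]
  rfl

theorem base_truncMap : Hom.base (truncMap k L m) =
    Spec.map (CommRingCat.ofHom (algebraMap k (TruncRing L m))) := rfl

theorem isFinite_truncMap [FiniteDimensional k L] : IsFinite (Hom.base (truncMap k L m)) := by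
  rw [base_truncMap]
  refine (IsFinite.SpecMap_iff (CommRingCat.ofHom (algebraMap k (TruncRing L m)))).2 ?_
  have : Module.Finite k (TruncRing L m) := Module.Finite.trans L (TruncRing L m)
  exact RingHom.finite_algebraMap.2 this

theorem etale_of_finite [Finite k] [FiniteDimensional k L] :
    Etale (Spec.map (CommRingCat.ofHom (algebraMap k L))) := by
  refine (HasRingHomProperty.Spec_iff (P := @Etale)).2 ?_
  have : Algebra.Etale k L :=
    { formallyEtale := Algebra.FormallyEtale.of_isSeparable k L
      finitePresentation := Algebra.FinitePresentation.of_finiteType.1 inferInstance }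
  exact (RingHom.etale_algebraMap).2 this

/-- The square that presents `L[x]/(x^m)` as the tensor product of `L` and `ℤ[ℕ]` over `ℤ[ℕ]`,
where `ℕ → ℕ` is multiplication by `m`. -/
theorem isPushout_truncRing (hm : m ≠ 0) (f : MonoidAlgebra ℤ (Multiplicative ℕ) →+* L)
    (hf : ∀ n : ℕ, f (.of _ _ (Multiplicative.ofAdd n)) = 0 ^ n)
    (g : MonoidAlgebra ℤ (Multiplicative ℕ) →+* TruncRing L m)
    (hg : ∀ n : ℕ, g (.of _ _ (Multiplicative.ofAdd n)) = TruncRing.x L m ^ n) :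
    IsPushout (CommRingCat.ofHom f) (CommRingCat.ofHom (MonoidAlgebra.mapDomainRingHom ℤ
        (powMonoidHom m : Multiplicative ℕ →* Multiplicative ℕ)))
      (CommRingCat.ofHom (algebraMap L (TruncRing L m))) (CommRingCat.ofHom g) := by
  have hpow : ∀ n : ℕ, MonoidAlgebra.mapDomainRingHom ℤ
      (powMonoidHom m : Multiplicative ℕ →* Multiplicative ℕ)
        (.of ℤ _ (Multiplicative.ofAdd n)) = .of ℤ _ (Multiplicative.ofAdd (m * n)) := by
    intro n
    refine (MonoidAlgebra.mapDomain_single).trans ?_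
    rfl
  have hw : CommRingCat.ofHom f ≫ CommRingCat.ofHom (algebraMap L (TruncRing L m)) =
      CommRingCat.ofHom (MonoidAlgebra.mapDomainRingHom ℤ
        (powMonoidHom m : Multiplicative ℕ →* Multiplicative ℕ)) ≫ CommRingCat.ofHom g := by
    ext1
    refine MonoidAlgebra.ringHom_ext' (RingHom.ext_int _ _) (MonoidHom.ext fun n => ?_)
    change algebraMap L _ (f (.of _ _ n)) = g (MonoidAlgebra.mapDomainRingHom ℤ _ (.of _ _ n))
    obtain ⟨n, rfl⟩ := Multiplicative.ofAdd.surjective n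
    rw [hpow, hf, hg]
    by_cases hn : n = 0
    · simp [hn]
    · rw [TruncRing.x_pow_mul hn, zero_pow hn, map_zero]
  have hy : ∀ s : PushoutCocone (CommRingCat.ofHom f) (CommRingCat.ofHom
      (MonoidAlgebra.mapDomainRingHom ℤ (powMonoidHom m : Multiplicative ℕ →* Multiplicative ℕ))),
      (s.inr.hom (.of ℤ _ (Multiplicative.ofAdd (1 : ℕ)))) ^ m = 0 := by
    intro s
    rw [← map_pow, ← map_pow, ← ofAdd_nsmul]
    have h1 := congr($(s.condition).hom (.of ℤ _ (Multiplicative.ofAdd (1 : ℕ))))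
    change s.inl.hom (f (.of ℤ _ (Multiplicative.ofAdd (1 : ℕ)))) =
      s.inr.hom (MonoidAlgebra.mapDomainRingHom ℤ _ (.of ℤ _ (Multiplicative.ofAdd (1 : ℕ)))) at h1
    rw [hpow, hf, pow_one, map_zero, mul_one] at h1
    rw [smul_eq_mul, mul_one]
    exact h1.symm
  refine ⟨⟨hw⟩, ⟨PushoutCocone.IsColimit.mk hw
    (fun s => CommRingCat.ofHom (TruncRing.lift s.inl.hom _ (hy s))) ?_ ?_ ?_⟩⟩
  · intro s
    ext a
    exact TruncRing.lift_algebraMap _ _ (hy s) a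
  · intro s
    ext1
    refine MonoidAlgebra.ringHom_ext' (RingHom.ext_int _ _) (MonoidHom.ext fun n => ?_)
    obtain ⟨n, rfl⟩ := Multiplicative.ofAdd.surjective n
    change TruncRing.lift _ _ (hy s) (g (.of _ _ (Multiplicative.ofAdd n))) =
      s.inr.hom (.of _ _ (Multiplicative.ofAdd n))
    rw [hg, map_pow, TruncRing.lift_x, ← map_pow, ← map_pow, ← ofAdd_nsmul, smul_eq_mul, mul_one]
  · intro s l h1 h2
    ext1
    refine TruncRing.hom_ext (fun a => ?_) ?_
    · change _ = TruncRing.lift _ _ (hy s) _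
      rw [TruncRing.lift_algebraMap, ← h1]
      rfl
    · change _ = TruncRing.lift _ _ (hy s) _
      rw [TruncRing.lift_x, ← h2]
      change _ = l.hom (g _)
      rw [hg, pow_one]

end Covers

/-! ### The standard covers are log étale -/

theorem toSpecΓ_comp_map {R B : CommRingCat.{0}} (f : R ⟶ Γ(Spec B, ⊤)) :
    (Spec B).toSpecΓ ≫ Spec.map f = Spec.map (f ≫ (Scheme.ΓSpecIso B).hom) := by
  rw [← SpecMap_ΓSpecIso_hom, ← Spec.map_comp]

section

variable {k : Type} [Field k] [Finite k] {L : Type} [Field L] [Algebra k L] {m : ℕ}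

/-- The charts `ℕ` of the log point over `Spec L` and of the cover, with `n ↦ mn` between them,
satisfy the conditions: `L[x]/(x^m)` is the tensor product of `L` and `ℤ[ℕ]` over `ℤ[ℕ]`. -/
theorem isLogEtale_truncMap [FiniteDimensional k L] (hm : (m : k) ≠ 0) :
    IsLogEtale (truncMap k L m) := by
  have hm0 : m ≠ 0 := by rintro rfl; simp at hm
  intro y
  have := etale_of_finite (k := k) (L := L)
  let X := logPoint k
  let Y := truncLog L m
  let U : Et X.scheme := Et.mk (Spec.map (CommRingCat.ofHom (algebraMap k L)))
  let V : Et Y.scheme := Y.top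
  let g : V.left ⟶ U.left := Spec.map (CommRingCat.ofHom (algebraMap L (TruncRing L m)))
  have hgb : Spec.map (CommRingCat.ofHom (algebraMap L (TruncRing L m))) ≫
      Spec.map (CommRingCat.ofHom (algebraMap k L)) = Hom.base (truncMap k L m) := by
    rw [← Spec.map_comp, base_truncMap]
    rfl
  have hg : g ≫ U.hom = V.hom ≫ Hom.base (truncMap k L m) := hgb.trans (Category.id_comp _).symm
  let e : Multiplicative ℕ ≃* Multiplicative natMonoid := AddEquiv.toMultiplicative natEquiv
  let cX : Multiplicative natMonoid →* X.sec X.top :=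
    constChart (indic natMonoid _) (indic_isNilpotent _ _)
  let cQ : Multiplicative ℕ →* X.sec U := ((X.res (X.toTop U)).comp cX).comp e.toMonoidHom
  let cP : Multiplicative ℕ →* Y.sec V :=
    constChart (truncAlpha L m) (truncAlpha_isNilpotent L m)
  have hcQ : ∀ n : ℕ, cQ (Multiplicative.ofAdd n) =
      X.res (X.toTop U) (constTop 1 (Multiplicative.ofAdd (natElt n))) := fun n => rfl
  have hcP : ∀ n : ℕ, cP (Multiplicative.ofAdd n) = specSec 1 (Multiplicative.ofAdd n) :=
    fun n => constTop_one_eq _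
  have hQ : X.IsChart U cQ := (isChart_constChart.restrict (X.toTop U)).comp_mulEquiv e
  have hP : Y.IsChart V cP := isChart_constChart
  have hcomm : cP.comp (powMonoidHom m) = (Hom.flat (truncMap k L m) V U g hg).comp cQ := by
    refine MonoidHom.ext fun n => ?_
    obtain ⟨n, rfl⟩ := Multiplicative.ofAdd.surjective n
    rw [MonoidHom.comp_apply, MonoidHom.comp_apply, hcQ]
    have h1 := Hom.flat_res (truncMap k L m) (X.toTop U) g hg
      (by rw [Category.assoc, Et.homLeft_w, hg])
      (constTop (hα := indic_isNilpotent _ _) 1 (Multiplicative.ofAdd (natElt n)))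
    refine Eq.trans ?_ h1.symm
    have h2 : Hom.base (truncMap k L m) = g ≫ Et.homLeft (X.toTop U) := hgb.symm
    refine Eq.trans ?_ (Hom.flat_congr (truncMap k L m) (U := V) (V := X.top) h2
      ((Category.comp_id _).trans (Category.id_comp _).symm) _)
    have h3 := globalFlat_truncMap k L m n
    rw [hollowSec_eq, ← constTop_one_eq] at h3
    refine Eq.trans ?_ h3.symm
    rw [powMonoidHom_apply, ← ofAdd_nsmul, smul_eq_mul]
    exact hcP _
  -- the morphisms to `Spec ℤ[ℕ]` defined by the charts, as homomorphisms of rings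
  let f₀ : MonoidAlgebra ℤ (Multiplicative ℕ) →+* Γ(Spec (.of L), ⊤) :=
    (MonoidAlgebra.lift ℤ Γ(Spec (.of L), ⊤) _ ((X.α U).comp cQ)).toRingHom
  let f : MonoidAlgebra ℤ (Multiplicative ℕ) →+* L :=
    ((specFun L).symm : Γ(Spec (.of L), ⊤) →+* L).comp f₀
  let g₀ : MonoidAlgebra ℤ (Multiplicative ℕ) →+* Γ(Spec (.of (TruncRing L m)), ⊤) :=
    (MonoidAlgebra.lift ℤ Γ(Spec (.of (TruncRing L m)), ⊤) _ ((Y.α V).comp cP)).toRingHom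
  let g' : MonoidAlgebra ℤ (Multiplicative ℕ) →+* TruncRing L m :=
    ((specFun (TruncRing L m)).symm :
      Γ(Spec (.of (TruncRing L m)), ⊤) →+* TruncRing L m).comp g₀
  have hf : ∀ n : ℕ, f (.of _ _ (Multiplicative.ofAdd n)) = 0 ^ n := by
    intro n
    change (specFun L).symm (f₀ (.of _ _ (Multiplicative.ofAdd n))) = _
    rw [RingEquiv.symm_apply_eq]
    have h1 : f₀ (.of _ _ (Multiplicative.ofAdd n)) = X.α U (cQ (Multiplicative.ofAdd n)) :=
      MonoidAlgebra.lift_of _ _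
    rw [h1, hcQ]
    refine (congrArg (X.α U) (res_constTop_one _ _)).trans ?_
    refine (α_constSec_const _ _).trans ?_
    refine (one_mul _).trans ?_
    rw [indic_eq]
    refine (appTop_specFun (algebraMap k L) _).trans ?_
    refine congrArg (specFun L) ?_
    by_cases hn : n = 0
    · subst hn
      have : Multiplicative.ofAdd (natElt 0) = 1 :=
        congrArg Multiplicative.ofAdd natEquiv.map_zero
      rw [this, map_one, map_one, pow_zero]
    · rw [zero_pow hn, indic_of_ne, map_zero]
      intro h'
      refine hn (natEquiv.injective ?_)
      rw [map_zero]
      exact congrArg Multiplicative.toAdd h'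
  have hg' : ∀ n : ℕ, g' (.of _ _ (Multiplicative.ofAdd n)) = TruncRing.x L m ^ n := by
    intro n
    change (specFun _).symm (g₀ (.of _ _ (Multiplicative.ofAdd n))) = _
    rw [RingEquiv.symm_apply_eq]
    have h1 : g₀ (.of _ _ (Multiplicative.ofAdd n)) = Y.α V (cP (Multiplicative.ofAdd n)) :=
      MonoidAlgebra.lift_of _ _
    rw [h1, hcP]
    refine (α_specSec _ _).trans ?_
    rw [Units.val_one, map_one, one_mul, truncAlpha_ofAdd]
  have hpush := isPushout_truncRing hm0 f hf g' hg'
  have hpull := isPullback_SpecMap_of_isPushout _ _ _ _ hpush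
  have hU : X.toSpec U cQ = Spec.map (CommRingCat.ofHom f) :=
    toSpecΓ_comp_map (CommRingCat.ofHom (S := Γ(Spec (CommRingCat.of L), ⊤)) f₀)
  have hV : Y.toSpec V cP = Spec.map (CommRingCat.ofHom g') :=
    toSpecΓ_comp_map (CommRingCat.ofHom (S := Γ(Spec (CommRingCat.of (TruncRing L m)), ⊤)) g₀)
  have hcard : (Nat.card (Algebra.GrothendieckGroup (Multiplicative ℕ) ⧸
      (gpMap (powMonoidHom m : Multiplicative ℕ →* Multiplicative ℕ)).range)) = m := card_gpMap_pow
  have hker : Subsingleton (gpMap (powMonoidHom m : Multiplicative ℕ →* Multiplicative ℕ)).ker := by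
    rw [gpMap_pow_ker hm0]
    infer_instance
  have hunit : IsUnit (m : Γ(V.left, ⊤)) := by
    have h1 : IsUnit ((m : k)) := hm.isUnit
    have h2 := h1.map (((specFun (TruncRing L m)) :
      TruncRing L m →+* Γ(Spec (.of (TruncRing L m)), ⊤)).comp
      (algebraMap k (TruncRing L m)))
    rwa [map_natCast] at h2
  refine ⟨U, V, g, hg, Multiplicative ℕ, Multiplicative ℕ, inferInstance, inferInstance,
    powMonoidHom m, cQ, cP, ⟨(y : Spec (.of (TruncRing L m))), rfl⟩, isFSMonoid_nat,
    isFSMonoid_nat, hQ, hP, hcomm, inferInstance, ?_, ?_, ?_, ?_⟩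
  · rw [Nat.card_of_subsingleton (1 : (gpMap (powMonoidHom m : _ →* Multiplicative ℕ)).ker),
      Nat.cast_one]
    exact isUnit_one
  · exact Nat.finite_of_card_ne_zero (by rw [hcard]; exact hm0)
  · rw [hcard]; exact hunit
  · have hp : IsPullback g (Y.toSpec V cP) (X.toSpec U cQ) (specMap (powMonoidHom m)) := by
      rw [hU, hV]
      exact hpull
    refine ⟨hp.w, ?_⟩
    have : pullback.lift g (Y.toSpec V cP) hp.w = hp.isoPullback.hom := by
      refine pullback.hom_ext ?_ ?_
      · exact (pullback.lift_fst _ _ _).trans hp.isoPullback_hom_fst.symm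
      · exact (pullback.lift_snd _ _ _).trans hp.isoPullback_hom_snd.symm
    rw [this]
    infer_instance

/-- The standard Kummer étale covers are finite Kummer étale covers. -/
theorem isFiniteKummerEtale_truncCover [FiniteDimensional k L] (hm : (m : k) ≠ 0) :
    isFiniteKummerEtale (logPoint k) (truncCover k L m) :=
  ⟨constLog_isFS (hα := truncAlpha_isNilpotent L m) isFSMonoid_nat, isFinite_truncMap,
    isKummer_truncMap (by rintro rfl; simp at hm), isLogEtale_truncMap hm⟩

end

/-! ### Points and lifts of étale morphisms -/

/-- A point with values in a separably closed field lifts along an étale morphism that meets it. -/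
theorem exists_lift_of_etale {K : Type} [Field K] [IsSepClosed K] {S V : Scheme.{0}} (f : V ⟶ S)
    [Etale f] (b : Spec (CommRingCat.of K) ⟶ S) (h : ∀ p, b p ∈ Set.range f) :
    ∃ b' : Spec (CommRingCat.of K) ⟶ V, b' ≫ f = b := by
  obtain ⟨⟨x, a⟩, rfl⟩ := (Scheme.SpecToEquivOfField K S).symm.surjective b
  have hx : x ∈ Set.range f := by
    have := h (IsLocalRing.closedPoint K)
    have h2 : ((Scheme.SpecToEquivOfField K S).symm ⟨x, a⟩) (IsLocalRing.closedPoint K) = x :=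
      S.fromSpecResidueField_apply x _
    rwa [h2] at this
  obtain ⟨y, rfl⟩ := hx
  obtain ⟨b, hb⟩ : ∃ b : V.residueField y ⟶ CommRingCat.of K, f.residueFieldMap y ≫ b = a := by
    algebraize [(f.residueFieldMap y).hom, a.hom]
    let b : V.residueField y →ₐ[S.residueField (f y)] K := IsSepClosed.lift
    exact ⟨CommRingCat.ofHom b.toRingHom, by ext1; exact b.comp_algebraMap⟩
  refine ⟨Spec.map b ≫ V.fromSpecResidueField y, ?_⟩
  change _ = Spec.map a ≫ S.fromSpecResidueField (f y)
  rw [← hb, Spec.map_comp, Category.assoc, Category.assoc,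
    Scheme.Hom.SpecMap_residueFieldMap_fromSpecResidueField]

/-- A morphism from a one-point affine scheme factors through an affine open that meets it. -/
theorem exists_spec_map_fromSpec {A : CommRingCat.{0}} {N : Scheme.{0}}
    (n : Spec A ⟶ N) {W : N.Opens} (hW : IsAffineOpen W) (h : ∀ p, n p ∈ W) :
    ∃ f : Γ(N, W) ⟶ A, Spec.map f ≫ hW.fromSpec = n := by
  have hr : Set.range n ⊆ Set.range hW.fromSpec := by
    rw [hW.range_fromSpec]
    rintro _ ⟨p, rfl⟩
    exact h p
  refine ⟨Spec.preimage (IsOpenImmersion.lift hW.fromSpec n hr), ?_⟩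
  rw [Spec.map_preimage, IsOpenImmersion.lift_fac]

/-- A geometric point of a scheme locally of finite type over `k` is defined over a finite
extension of `k`, which may be taken to contain a given one. -/
theorem exists_factor_finite {k K : Type} [Field k] [Field K] [Algebra k K]
    [Algebra.IsAlgebraic k K] {N : Scheme.{0}} (π : N ⟶ Spec (CommRingCat.of k))
    [LocallyOfFiniteType π] (n : Spec (CommRingCat.of K) ⟶ N)
    (hn : n ≫ π = Spec.map (CommRingCat.ofHom (algebraMap k K))) (L₀ : IntermediateField k K)
    [FiniteDimensional k L₀] :
    ∃ (L : IntermediateField k K) (_ : FiniteDimensional k L) (_ : L₀ ≤ L)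
      (n' : Spec (CommRingCat.of L) ⟶ N),
      Spec.map (CommRingCat.ofHom (algebraMap L K)) ≫ n' = n ∧
      n' ≫ π = Spec.map (CommRingCat.ofHom (algebraMap k L)) := by
  let x : Spec (CommRingCat.of K) := IsLocalRing.closedPoint K
  have hx : ∀ p : Spec (CommRingCat.of K), p = x := fun p => Subsingleton.elim (α := PrimeSpectrum K) _ _
  obtain ⟨W, hW, hxW, -⟩ := exists_isAffineOpen_mem_and_subset (TopologicalSpace.Opens.mem_top (n x))
  obtain ⟨f, hf⟩ := exists_spec_map_fromSpec n hW (fun p => hx p ▸ hxW)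
  let B : Type := Γ(N, W)
  obtain ⟨g, hg⟩ : ∃ g : CommRingCat.of k ⟶ Γ(N, W), Spec.map g = hW.fromSpec ≫ π :=
    ⟨_, Spec.map_preimage _⟩
  have hft : g.hom.FiniteType := by
    rw [← HasRingHomProperty.Spec_iff (P := @LocallyOfFiniteType), hg]
    infer_instance
  have hfg : g ≫ f = CommRingCat.ofHom (algebraMap k K) := by
    apply Spec.map_injective
    rw [Spec.map_comp, hg, ← Category.assoc, hf, hn]
  algebraize [g.hom]
  obtain ⟨s, hs⟩ := hft.1
  let F : Γ(N, W) →ₐ[k] K := { f.hom with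
    commutes' := fun a => by
      have := congrArg (fun z : CommRingCat.of k ⟶ CommRingCat.of K => z.hom a) hfg
      exact this }
  let L₁ : IntermediateField k K := IntermediateField.adjoin k (F '' (s : Set Γ(N, W)))
  have : FiniteDimensional k L₁ :=
    IntermediateField.finiteDimensional_adjoin fun x _ => Algebra.IsIntegral.isIntegral x
  let L := L₀ ⊔ L₁
  have hL : FiniteDimensional k L := IntermediateField.finiteDimensional_sup _ _
  have hr : ∀ b : Γ(N, W), f.hom b ∈ L := by
    intro b
    have hb : b ∈ Algebra.adjoin k (s : Set Γ(N, W)) := hs ▸ Algebra.mem_top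
    have h2 : F b ∈ (Algebra.adjoin k (s : Set Γ(N, W))).map F := ⟨b, hb, rfl⟩
    rw [AlgHom.map_adjoin] at h2
    have h3 : Algebra.adjoin k (F '' (s : Set Γ(N, W))) ≤ L₁.toSubalgebra :=
      IntermediateField.algebra_adjoin_le_adjoin k _
    exact (le_sup_right : L₁ ≤ L) (h3 h2)
  refine ⟨L, hL, le_sup_left,
    Spec.map (CommRingCat.ofHom (f.hom.codRestrict L.toSubring hr)) ≫ hW.fromSpec, ?_, ?_⟩
  · rw [← hf, ← Category.assoc, ← Spec.map_comp]
    rfl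
  · rw [Category.assoc, ← hg, ← Spec.map_comp]
    congr 1
    ext1
    refine RingHom.ext fun a => Subtype.ext ?_
    exact congrArg (fun z : CommRingCat.of k ⟶ CommRingCat.of K => z.hom a) hfg

/-- Infinitesimal lifting for étale morphisms, along the closed immersion of one-point affine
schemes given by a surjective homomorphism with nilpotent kernel. -/
theorem exists_etale_lift {A L : Type} [CommRing A] [CommRing L] [Subsingleton (PrimeSpectrum A)]
    [Nontrivial L] (ρ : A →+* L) (hρ : Function.Surjective ρ) (hker : IsNilpotent (RingHom.ker ρ))
    {V Z : Scheme.{0}} (e : V ⟶ Z) [Etale e] (t : Spec (CommRingCat.of A) ⟶ Z)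
    (v : Spec (CommRingCat.of L) ⟶ V)
    (h : Spec.map (CommRingCat.ofHom ρ) ≫ t = v ≫ e) :
    ∃ t' : Spec (CommRingCat.of A) ⟶ V, t' ≫ e = t ∧ Spec.map (CommRingCat.ofHom ρ) ≫ t' = v := by
  obtain ⟨x⟩ : Nonempty (PrimeSpectrum L) := inferInstance
  let x' : Spec (CommRingCat.of L) := x
  let ι := Spec.map (CommRingCat.ofHom ρ)
  have hA : ∀ p : Spec (CommRingCat.of A), p = ι x' :=
    fun p => Subsingleton.elim (α := PrimeSpectrum A) _ _
  have hιi : Function.Injective ι :=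
    PrimeSpectrum.comap_injective_of_surjective ρ hρ
  have hL : ∀ p : Spec (CommRingCat.of L), p = x' := fun p => hιi (hA _)
  obtain ⟨W, hW, hxW, -⟩ :=
    exists_isAffineOpen_mem_and_subset (TopologicalSpace.Opens.mem_top (e (v x')))
  obtain ⟨W', hW', hxW', hle'⟩ := exists_isAffineOpen_mem_and_subset
    (show v x' ∈ e ⁻¹ᵁ W from hxW)
  have hle : W' ≤ e ⁻¹ᵁ W := hle'
  obtain ⟨v₁, hv₁⟩ := exists_spec_map_fromSpec v hW' (fun p => hL p ▸ hxW')
  have hpt : t (ι x') = e (v x') := by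
    have := congrArg (fun z : Spec (CommRingCat.of L) ⟶ Z => z x') h
    simpa using this
  obtain ⟨t₁, ht₁⟩ := exists_spec_map_fromSpec t hW (fun p => by rw [hA p, hpt]; exact hxW)
  have he := Etale.etale_appLE (f := e) hW hW' hle
  have hsq : e.appLE W W' hle ≫ v₁ = t₁ ≫ CommRingCat.ofHom ρ := by
    apply Spec.map_injective
    rw [← cancel_mono hW.fromSpec, Spec.map_comp, Spec.map_comp, Category.assoc, Category.assoc,
      IsAffineOpen.SpecMap_appLE_fromSpec _ hW hW', ht₁, reassoc_of% hv₁, h]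
  algebraize [(e.appLE W W' hle).hom, t₁.hom, (t₁ ≫ CommRingCat.ofHom ρ).hom]
  have : Algebra.Etale Γ(Z, W) Γ(V, W') := he
  let V₁ : Γ(V, W') →ₐ[Γ(Z, W)] L := { v₁.hom with
    commutes' := fun a => congrArg (fun z : Γ(Z, W) ⟶ CommRingCat.of L => z.hom a) hsq }
  let R : A →ₐ[Γ(Z, W)] L := { ρ with commutes' := fun a => rfl }
  let T' : Γ(V, W') →ₐ[Γ(Z, W)] A := Algebra.FormallySmooth.liftOfSurjective V₁ R hρ hker
  have h1 : CommRingCat.ofHom T'.toRingHom ≫ CommRingCat.ofHom ρ = v₁ := by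
    ext1
    refine RingHom.ext fun a => ?_
    exact Algebra.FormallySmooth.liftOfSurjective_apply V₁ R hρ hker a
  have h2 : e.appLE W W' hle ≫ CommRingCat.ofHom T'.toRingHom = t₁ := by
    ext1
    exact T'.comp_algebraMap
  refine ⟨Spec.map (CommRingCat.ofHom T'.toRingHom) ≫ hW'.fromSpec, ?_, ?_⟩
  · rw [Category.assoc, ← IsAffineOpen.SpecMap_appLE_fromSpec e hW hW' hle, ← Category.assoc,
      ← Spec.map_comp, h2, ht₁]
  · rw [← Category.assoc, ← Spec.map_comp, h1, hv₁]

/-! ### Homomorphisms to rings of functions as morphisms to `Spec ℤ[P]` -/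

section

variable {P Q : Type} [CommMonoid P] [CommMonoid Q]

/-- The morphism `T → Spec ℤ[P]` given by a monoid homomorphism `P → Γ(T, 𝒪)`. -/
noncomputable def charSpec (T : Scheme.{0}) (γ : P →* Γ(T, ⊤)) :
    T ⟶ Spec (CommRingCat.of (MonoidAlgebra ℤ P)) :=
  T.toSpecΓ ≫ Spec.map (CommRingCat.ofHom (MonoidAlgebra.lift ℤ Γ(T, ⊤) P γ).toRingHom)

theorem comp_charSpec {T U : Scheme.{0}} (h : T ⟶ U) (γ : P →* Γ(U, ⊤)) :
    h ≫ charSpec U γ = charSpec T ((h.appTop.hom : Γ(U, ⊤) →* Γ(T, ⊤)).comp γ) := by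
  rw [charSpec, charSpec, ← Category.assoc, Scheme.toSpecΓ_naturality, Category.assoc,
    ← Spec.map_comp]
  congr 2
  ext1
  refine MonoidAlgebra.ringHom_ext (fun n => ?_) fun p => ?_
  · simp
  · simp

theorem charSpec_specMap {T : Scheme.{0}} (φ : Q →* P) (γ : P →* Γ(T, ⊤)) :
    charSpec T γ ≫ specMap φ = charSpec T (γ.comp φ) := by
  rw [charSpec, charSpec, specMap, Category.assoc, ← Spec.map_comp]
  congr 2
  ext1
  refine MonoidAlgebra.ringHom_ext (fun n => ?_) fun p => ?_
  · simp
  · simp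

theorem charSpec_injective {T : Scheme.{0}} {γ γ' : P →* Γ(T, ⊤)}
    (h : charSpec T γ = charSpec T γ') : γ = γ' := by
  have key : ∀ γ : P →* Γ(T, ⊤), ∀ p, (charSpec T γ).appTop
      ((Scheme.ΓSpecIso _).inv (MonoidAlgebra.of ℤ P p)) = γ p := by
    intro γ p
    rw [charSpec, Scheme.Hom.comp_appTop, Scheme.toSpecΓ_appTop, CommRingCat.comp_apply]
    have h1 := Scheme.ΓSpecIso_inv_naturality
      (CommRingCat.ofHom (MonoidAlgebra.lift ℤ Γ(T, ⊤) P γ).toRingHom)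
    have h2 := congrArg (fun z => z.hom (MonoidAlgebra.of ℤ P p)) h1
    have h3 := congrArg (Scheme.ΓSpecIso Γ(T, ⊤)).hom h2.symm
    refine h3.trans ?_
    refine Eq.trans (congrArg (fun z => z.hom (MonoidAlgebra.lift ℤ Γ(T, ⊤) P γ
      (MonoidAlgebra.of ℤ P p))) (Scheme.ΓSpecIso Γ(T, ⊤)).inv_hom_id) ?_
    simp
  refine MonoidHom.ext fun p => ?_
  rw [← key γ, ← key γ', h]

end

/-! ### The truncated polynomial ring as a thickening of a field -/

namespace TruncRing

variable (L : Type) [Field L] (m : ℕ)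

/-- The residue homomorphism `L[x]/(x^m) → L`. -/
noncomputable def residue (hm : m ≠ 0) : TruncRing L m →+* L :=
  lift (RingHom.id L) 0 (zero_pow hm)

variable {L m}

@[simp] theorem residue_algebraMap (hm : m ≠ 0) (a : L) :
    residue L m hm (algebraMap L _ a) = a := lift_algebraMap _ _ _ _

@[simp] theorem residue_x (hm : m ≠ 0) : residue L m hm (x L m) = 0 := lift_x _ _ _

theorem residue_surjective (hm : m ≠ 0) : Function.Surjective (residue L m hm) :=
  fun a => ⟨algebraMap L _ a, residue_algebraMap hm a⟩

theorem sub_residue_mem (hm : m ≠ 0) (a : TruncRing L m) :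
    a - algebraMap L _ (residue L m hm a) ∈ Ideal.span {x L m} := by
  rw [← Ideal.Quotient.eq]
  have : (Ideal.Quotient.mk (Ideal.span {x L m})) = (Ideal.Quotient.mk (Ideal.span {x L m})).comp
      ((algebraMap L (TruncRing L m)).comp (residue L m hm)) := by
    refine hom_ext (fun a => ?_) ?_
    · exact congrArg (fun z => (Ideal.Quotient.mk (Ideal.span {x L m})) (algebraMap L _ z))
        (residue_algebraMap hm a).symm
    · simp only [RingHom.comp_apply, residue_x, map_zero]
      exact Ideal.Quotient.eq_zero_iff_mem.2 (Ideal.mem_span_singleton_self _)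
  exact congrArg (fun z => z a) this

theorem ker_residue_le (hm : m ≠ 0) : RingHom.ker (residue L m hm) ≤ Ideal.span {x L m} := by
  intro a ha
  have := sub_residue_mem hm a
  rwa [(RingHom.mem_ker).1 ha, map_zero, sub_zero] at this

theorem isNilpotent_ker_residue (hm : m ≠ 0) : IsNilpotent (RingHom.ker (residue L m hm)) := by
  refine ⟨m, ?_⟩
  have h : (Ideal.span {x L m}) ^ m = ⊥ := by
    rw [Ideal.span_singleton_pow, x_pow, Ideal.span_singleton_eq_bot]
  exact le_bot_iff.1 ((Ideal.pow_right_mono (ker_residue_le hm) m).trans h.le)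

theorem subsingleton_primeSpectrum (hm : m ≠ 0) : Subsingleton (PrimeSpectrum (TruncRing L m)) := by
  have key : ∀ p : PrimeSpectrum (TruncRing L m), p.asIdeal = RingHom.ker (residue L m hm) := by
    intro p
    have h1 : RingHom.ker (residue L m hm) ≤ p.asIdeal := by
      refine (ker_residue_le hm).trans ?_
      rw [Ideal.span_singleton_le_iff_mem]
      refine p.isPrime.mem_of_pow_mem m ?_
      rw [x_pow]
      exact zero_mem _
    have h2 := RingHom.ker_isMaximal_of_surjective _ (residue_surjective (L := L) hm)
    exact (h2.eq_of_le p.isPrime.ne_top h1).symm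
  exact ⟨fun p q => PrimeSpectrum.ext ((key p).trans (key q).symm)⟩

/-- Homomorphisms to reduced rings factor through the residue homomorphism. -/
theorem eq_comp_residue (hm : m ≠ 0) {R : Type} [CommRing R] [IsReduced R]
    (f : TruncRing L m →+* R) :
    f = (f.comp (algebraMap L _)).comp (residue L m hm) := by
  refine hom_ext
    (fun a => congrArg (fun z => f (algebraMap L _ z)) (residue_algebraMap hm a).symm) ?_
  rw [RingHom.comp_apply, residue_x, map_zero]
  exact (IsNilpotent.map ⟨m, x_pow L m⟩ f).eq_zero

end TruncRing

/-! ### Fractions with denominator prime to the characteristic -/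

section

variable {k : Type} [Field k]

theorem div_mem_kumMonoid {m : ℕ} (hm : (m : k) ≠ 0) (j : ℕ) :
    ((j : ℚ≥0) / m) ∈ kumMonoid k := by
  intro h
  have h1 : ((j : ℚ≥0) / m).den ∣ m := by
    have := Rat.den_dvd (j : ℤ) (m : ℤ)
    rw [← NNRat.den_coe]
    have h2 : ((((j : ℚ≥0) / m : ℚ≥0) : ℚ)) = Rat.divInt j m := by
      rw [Rat.divInt_eq_div]; push_cast; rfl
    rw [h2]
    exact_mod_cast this
  obtain ⟨c, hc⟩ := h1
  apply hm
  rw [hc, Nat.cast_mul, h, zero_mul]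

/-- The homomorphism `j ↦ j/m`, for `m` prime to the characteristic. -/
noncomputable def kumFrac {m : ℕ} (hm : (m : k) ≠ 0) :
    Multiplicative ℕ →* Multiplicative (kumMonoid k) :=
  AddMonoidHom.toMultiplicative
    { toFun := fun j => ⟨(j : ℚ≥0) / m, div_mem_kumMonoid hm j⟩
      map_zero' := Subtype.ext (by simp)
      map_add' := fun a b => Subtype.ext (by simp [add_div]) }

theorem coe_kumFrac {m : ℕ} (hm : (m : k) ≠ 0) (j : ℕ) :
    ((kumFrac hm (Multiplicative.ofAdd j)).toAdd : ℚ≥0) = (j : ℚ≥0) / m := rfl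

theorem natCast_ne_zero {m : ℕ} (hm : (m : k) ≠ 0) : m ≠ 0 := by
  rintro rfl
  exact hm Nat.cast_zero

theorem kumFrac_injective {m : ℕ} (hm : (m : k) ≠ 0) : Function.Injective (kumFrac hm) := by
  intro a b h
  have h1 : ((a.toAdd : ℕ) : ℚ≥0) / m = ((b.toAdd : ℕ) : ℚ≥0) / m :=
    congrArg (fun z => (z.toAdd : ℚ≥0)) h
  have h2 : (m : ℚ≥0) ≠ 0 := by exact_mod_cast natCast_ne_zero hm
  rw [div_left_inj' h2] at h1
  exact Multiplicative.toAdd.injective (by exact_mod_cast h1)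

/-- A homomorphism from a finitely generated monoid to `ℕ_(p)` has a common denominator. -/
theorem exists_common_denominator {P : Type} [CommMonoid P] (hP : Monoid.FG P)
    (ρ : P →* Multiplicative (kumMonoid k)) :
    ∃ (m : ℕ) (hm : (m : k) ≠ 0) (j : P →* Multiplicative ℕ), (kumFrac hm).comp j = ρ := by
  obtain ⟨S, hS⟩ := hP.1
  let m : ℕ := ∏ s ∈ S, ((ρ s).toAdd : ℚ≥0).den
  have hm : (m : k) ≠ 0 := by
    rw [Nat.cast_prod]
    exact Finset.prod_ne_zero_iff.2 fun s _ => (ρ s).toAdd.2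
  have hS' : ∀ s ∈ S, ρ s ∈ MonoidHom.mrange (kumFrac hm) := by
    intro s hs
    obtain ⟨c, hc⟩ : ((ρ s).toAdd : ℚ≥0).den ∣ m := Finset.dvd_prod_of_mem _ hs
    refine ⟨Multiplicative.ofAdd (c * ((ρ s).toAdd : ℚ≥0).num), ?_⟩
    refine Multiplicative.toAdd.injective (Subtype.ext ?_)
    refine (coe_kumFrac hm _).trans ?_
    have h1 := NNRat.num_div_den ((ρ s).toAdd : ℚ≥0)
    have h2 : (m : ℚ≥0) ≠ 0 := by exact_mod_cast natCast_ne_zero hm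
    rw [div_eq_iff h2, hc]
    push_cast
    nth_rw 2 [← h1]
    have h3 : ((((ρ s).toAdd : ℚ≥0).den : ℕ) : ℚ≥0) ≠ 0 := by
      exact_mod_cast ((ρ s).toAdd : ℚ≥0).den_ne_zero
    field_simp
  have hall : ∀ p, ρ p ∈ MonoidHom.mrange (kumFrac hm) := by
    have : Submonoid.closure (S : Set P) ≤ (MonoidHom.mrange (kumFrac hm)).comap ρ :=
      Submonoid.closure_le.2 hS'
    rw [hS] at this
    exact fun p => this trivial
  choose j hj using hall
  refine ⟨m, hm, ⟨⟨j, ?_⟩, ?_⟩, MonoidHom.ext hj⟩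
  · exact kumFrac_injective hm (by rw [hj, map_one, map_one])
  · exact fun a b => kumFrac_injective hm (by rw [hj, map_mul, map_mul, hj, hj])

/-- A homomorphism from a finitely generated monoid to an algebraic extension has values in a
finite extension. -/
theorem exists_finite_extension {K : Type} [Field K] [Algebra k K] [Algebra.IsAlgebraic k K]
    {P : Type} [CommMonoid P] (hP : Monoid.FG P) (χ : P →* K) :
    ∃ (L : IntermediateField k K) (_ : FiniteDimensional k L), ∀ p, χ p ∈ L := by
  obtain ⟨S, hS⟩ := hP.1
  let L : IntermediateField k K := IntermediateField.adjoin k (χ '' (S : Set P))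
  refine ⟨L, IntermediateField.finiteDimensional_adjoin
    fun x _ => Algebra.IsIntegral.isIntegral x, ?_⟩
  have : Submonoid.closure (S : Set P) ≤ L.toSubfield.toSubmonoid.comap χ :=
    Submonoid.closure_le.2 fun s hs => IntermediateField.subset_adjoin k _ ⟨s, hs, rfl⟩
  rw [hS] at this
  exact fun p => this trivial

end

/-! ### The points of the standard covers over the universal Kummer cover -/

section

variable (k : Type) [Field k] [Finite k]

/-- The log geometric point, as a log scheme. -/
noncomputable abbrev kumPoint : LogScheme := hollow (AlgebraicClosure k) (kumMonoid k)

/-- The structure morphism of the log geometric point. -/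
noncomputable abbrev kumPointMap : kumPoint k ⟶ logPoint k :=
  hollowMap k (AlgebraicClosure k) (natMonoid_le_kumMonoid k)

variable {k} {L : Type} [Field L] [Algebra k L] {m : ℕ}

theorem natElt_induction (p : Multiplicative natMonoid) :
    ∃ n : ℕ, p = Multiplicative.ofAdd (natElt 1) ^ n := by
  obtain ⟨n, hn⟩ := natEquiv.surjective p.toAdd
  refine ⟨n, Multiplicative.toAdd.injective ?_⟩
  rw [← hn, toAdd_pow, toAdd_ofAdd, ← natEquiv_apply, ← map_nsmul, smul_eq_mul, mul_one]

/-- Two morphisms to the standard log point are equal if they agree on schemes and on the generator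
of the monoid `ℕ`. -/
theorem logPoint_hom_ext {k : Type} [Field k] {Z : LogScheme} {f f' : Z ⟶ logPoint k}
    (hb : Hom.base f = Hom.base f')
    (h : globalFlat f (hollowSec 1 (natElt 1)) = globalFlat f' (hollowSec 1 (natElt 1))) :
    f = f' := by
  refine constLog_hom_ext (hα := indic_isNilpotent natMonoid _) hb fun p => ?_
  obtain ⟨n, rfl⟩ := natElt_induction p
  have : constTop (hα := indic_isNilpotent natMonoid _) 1 (Multiplicative.ofAdd (natElt 1) ^ n) =
      (constTop (hα := indic_isNilpotent natMonoid Γ(Spec (.of k), ⊤)) 1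
        (Multiplicative.ofAdd (natElt 1))) ^ n :=
    map_pow (constChart (indic natMonoid Γ(Spec (.of k), ⊤)) (indic_isNilpotent _ _)) _ n
  refine (congrArg (globalFlat f) this).trans ?_
  refine Eq.trans ?_ (congrArg (globalFlat f') this).symm
  rw [hollowSec_eq, ← constTop_one_eq] at h
  refine (map_pow (globalFlat f) _ _).trans (Eq.trans ?_ (map_pow (globalFlat f') _ _).symm)
  exact congrArg (· ^ n) h

/-- The points of the standard cover over the log geometric point: the variable goes to `0`, the
element `j` of the chart to `(ζ^j, j/m)`, for an `m`-th root of unity `ζ`. -/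
theorem exists_truncPoint (hm : (m : k) ≠ 0) (τ : L →ₐ[k] AlgebraicClosure k)
    (ζ : (AlgebraicClosure k)ˣ) (hζ : ζ ^ m = 1) :
    ∃ y : kumPoint k ⟶ truncLog L m, y ≫ truncMap k L m = kumPointMap k ∧
      Hom.base y = Spec.map (CommRingCat.ofHom
        ((τ : L →+* AlgebraicClosure k).comp (TruncRing.residue L m (natCast_ne_zero hm)))) ∧
      ∀ j, globalFlat y (specSec 1 j) = hollowSec (powersHom _ ζ j) (kumFrac hm j).toAdd := by
  have hm0 := natCast_ne_zero hm
  obtain ⟨y, hy, hy'⟩ := exists_spec_hom (hα := truncAlpha_isNilpotent L m)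
    (hβ := indic_isNilpotent (kumMonoid k) _)
    ((τ : L →+* AlgebraicClosure k).comp (TruncRing.residue L m hm0)) (powersHom _ ζ) (kumFrac hm)
    (fun j => by
      obtain ⟨j, rfl⟩ := Multiplicative.ofAdd.surjective j
      rw [indic_eq, truncAlpha_ofAdd, appTop_specFun, ← map_mul, map_pow, RingHom.comp_apply,
        TruncRing.residue_x, map_zero]
      refine congrArg (specFun _) ?_
      by_cases hj : j = 0
      · subst hj
        rw [ofAdd_zero, map_one, map_one, map_one, pow_zero, Units.val_one, mul_one]
      · rw [zero_pow hj, indic_of_ne, mul_zero]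
        intro h
        refine hj (Multiplicative.ofAdd.injective (kumFrac_injective hm ?_))
        rw [h, ofAdd_zero, map_one])
  have hs : ∀ j, globalFlat y (specSec 1 j) = hollowSec (powersHom _ ζ j) (kumFrac hm j).toAdd := by
    intro j
    refine (hy' 1 j).trans ?_
    rw [map_one, one_mul]
    rfl
  refine ⟨y, logPoint_hom_ext ?_ ?_, hy, hs⟩
  · rw [base_comp, hy, base_truncMap]
    refine (Spec.map_comp _ _).symm.trans ?_
    refine congrArg Spec.map ?_
    ext1
    refine RingHom.ext fun a => ?_
    change τ (TruncRing.residue L m hm0 (algebraMap k (TruncRing L m) a)) = _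
    rw [IsScalarTower.algebraMap_apply k L (TruncRing L m), TruncRing.residue_algebraMap]
    exact τ.commutes a
  · rw [globalFlat_comp, globalFlat_truncMap, hs, globalFlat_hollowMap, map_one]
    congr 1
    · rw [mul_one]
      exact hζ
    · refine Subtype.ext ?_
      refine (coe_kumFrac hm _).trans ?_
      have : (m : ℚ≥0) ≠ 0 := by exact_mod_cast hm0
      rw [mul_one, div_self this]
      exact Nat.cast_one.symm

end

/-! ### Factorization of geometric points through the standard covers -/

theorem LogScheme.Hom.flat_congr_hom {X Y : LogScheme} {f f' : X ⟶ Y} (e : f = f')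
    {U : Et X.scheme} {V : Et Y.scheme} (g : U.left ⟶ V.left) (h : g ≫ V.hom = U.hom ≫ Hom.base f)
    (m : Y.sec V) : Hom.flat f U V g h m = Hom.flat f' U V g (e ▸ h) m := by
  subst e; rfl

/-- The pull-back of a global section `m` along `h ≫ f`, when `m` is étale locally, over `W → U`,
the product of a section `e` and of a section `c` over `U`. -/
theorem globalFlat_comp_eq_mul {X Y Z : LogScheme} (h : Z ⟶ Y) (f : Y ⟶ X)
    {U W : Et X.scheme} {V : Et Y.scheme} (a : W ⟶ U) (v : Z.top.left ⟶ V.left)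
    (g : V.left ⟶ U.left) (w : Z.top.left ⟶ W.left) (hv : v ≫ V.hom = Z.top.hom ≫ Hom.base h)
    (hg : g ≫ U.hom = V.hom ≫ Hom.base f) (hw : w ≫ Et.homLeft a = v ≫ g)
    {m : X.sec X.top} {e : X.sec W} {c : X.sec U}
    (hm : X.res (X.toTop W) m = e * X.res a c) :
    ∃ E : Z.sec Z.top, Z.α Z.top E = w.appTop (X.α W e) ∧
      globalFlat (h ≫ f) m = E * Hom.flat h Z.top V v hv (Hom.flat f V U g hg c) := by
  have hvg : (v ≫ g) ≫ U.hom = Z.top.hom ≫ Hom.base (h ≫ f) := by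
    rw [Category.assoc, hg, ← Category.assoc, hv, Category.assoc]
    rfl
  have hwa : w ≫ W.hom = Z.top.hom ≫ Hom.base (h ≫ f) := by
    rw [← Et.homLeft_w a, ← Category.assoc, hw, hvg]
  have h1 := Hom.flat_res (h ≫ f) (X.toTop W) w hwa
    (by rw [Category.assoc, Et.homLeft_w, hwa]) m
  have h2 := Hom.flat_res (h ≫ f) a w hwa (by rw [Category.assoc, Et.homLeft_w, hwa]) c
  refine ⟨Hom.flat (h ≫ f) Z.top W w hwa e, Hom.α_flat _ _ _ _ _ _, ?_⟩
  have h3 : Hom.base (h ≫ f) = w ≫ Et.homLeft (X.toTop W) := by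
    have h4 : Et.homLeft (X.toTop W) = W.hom :=
      (Category.comp_id _).symm.trans (Et.homLeft_w (X.toTop W))
    refine Eq.trans ?_ (congrArg (fun z => w ≫ z) h4).symm
    exact (Category.id_comp _).symm.trans hwa.symm
  have h5 : globalFlat (h ≫ f) m =
      Hom.flat (h ≫ f) Z.top W w hwa (X.res (X.toTop W) m) :=
    (Hom.flat_congr (h ≫ f) h3 _ _).trans h1.symm
  rw [h5, hm, map_mul, h2]
  refine congrArg _ ?_
  exact Hom.comp_flat h f v g hv hg _ hw _ _

section

variable {A : Type} [CommRing A] {P : Type} [CommMonoid P]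
  {α : P →* Γ(Spec (.of A), ⊤)} {hα : ∀ p, p ≠ 1 → IsNilpotent (α p)}

theorem eq_specSec_of_α {E : (constLog (Spec (.of A)) P α hα).sec (constLog _ P α hα).top} (u : Aˣ)
    (h : (constLog (Spec (.of A)) P α hα).α _ E = specFun A u) : E = specSec u 1 := by
  have h1 : (constLog (Spec (.of A)) P α hα).α _ (specSec u 1) = specFun A u := by
    refine (α_specSec u 1).trans ?_
    rw [map_one, mul_one]
  refine sec_ext_of_isUnit ?_ (h.trans h1.symm)
  rw [h]
  exact u.isUnit.map (specFun A)

variable [Subsingleton (PrimeSpectrum A)] [Nontrivial A]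

theorem exists_specSec_monoidHom {Q : Type} [CommMonoid Q]
    (c : Q →* (constLog (Spec (.of A)) P α hα).sec (constLog _ P α hα).top) :
    ∃ (χ : Q →* Aˣ) (ρ : Q →* P), ∀ q, c q = specSec (χ q) (ρ q) := by
  choose χ ρ h using fun q => exists_specSec (c q)
  have h1 : ∀ q, specSec (hα := hα) (χ q) (ρ q) = c q := fun q => (h q).symm
  refine ⟨⟨⟨χ, ?_⟩, fun a b => ?_⟩, ⟨⟨ρ, ?_⟩, fun a b => ?_⟩, h⟩
  · exact (specSec_inj ((h1 1).trans ((map_one c).trans (specSec_one (hα := hα)).symm))).1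
  · exact (specSec_inj ((h1 (a * b)).trans ((map_mul c a b).trans
      ((congrArg₂ (· * ·) (h a) (h b)).trans (specSec_mul _ _ _ _))))).1
  · exact (specSec_inj ((h1 1).trans ((map_one c).trans (specSec_one (hα := hα)).symm))).2
  · exact (specSec_inj ((h1 (a * b)).trans ((map_mul c a b).trans
      ((congrArg₂ (· * ·) (h a) (h b)).trans (specSec_mul _ _ _ _))))).2

end

section

variable {S : Scheme.{0}} {P : Type} [CommMonoid P] {α : P →* Γ(S, ⊤)}
  {hα : ∀ p, p ≠ 1 → IsNilpotent (α p)}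

/-- A section of a constant log structure is of the form `(u, p)` near a point `x`. -/
theorem exists_value {U : Et (constLog S P α hα).scheme} (c : (constLog S P α hα).sec U)
    (x : U.left) : ∃ (u : Γ(U.left, ⊤)ˣ) (p : P),
      (∀ {T : Scheme.{0}} (g : T ⟶ U.left), (∀ t, g t = x) →
        g.appTop ((constLog S P α hα).α U c) = g.appTop u * (g ≫ U.hom).appTop (α p)) ∧
      ∀ {S' : Scheme.{0}} {P' : Type} [CommMonoid P'] {α' : P' →* Γ(S', ⊤)}
        {hα' : ∀ p, p ≠ 1 → IsNilpotent (α' p)} (b : S' ⟶ S) (φ : P →* P')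
        (h : ∀ p, b.appTop (α p) = α' (φ p)) (g : S' ⟶ U.left)
        (hg : g ≫ U.hom = 𝟙 S' ≫ b), (∀ t, g t = x) →
        Hom.flat (constLogMap (hα := hα) (hβ := hα') b φ h) (constLog S' P' α' hα').top U g hg c =
          constTop (Units.map g.appTop.hom.toMonoidHom u) (φ p) := by
  obtain ⟨u, f, rfl⟩ := exists_constSec c
  refine ⟨u, f x, fun {T} g hg => ?_, fun b φ h g hg hx => ?_⟩
  · refine (map_mul g.appTop.hom _ _).trans ?_
    refine congrArg (fun z => g.appTop u * z) ?_
    refine (glue_spec ((U.hom.appTop.hom : Γ(S, ⊤) →* Γ(U.left, ⊤)).comp α) f g (f x)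
      fun t => congrArg f (hg t)).trans ?_
    rw [Scheme.Hom.comp_appTop]
    rfl
  · refine Prod.ext rfl ?_
    refine LocallyConstant.ext fun t => ?_
    exact congrArg (fun z => φ (f z)) (hx t)

end

theorem comp_appTop_eq_specFun {A B : Type} [CommRing A] [CommRing B] (ψ : A →+* B)
    {S : Scheme.{0}} (w : Spec (.of A) ⟶ S) {a : A} {c : Γ(S, ⊤)}
    (h : specFun A a = w.appTop c) :
    (Spec.map (CommRingCat.ofHom ψ) ≫ w).appTop c = specFun B (ψ a) := by
  rw [Scheme.Hom.comp_appTop, ← appTop_specFun, h]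
  rfl

section

variable {k : Type} [Field k] [Finite k]

theorem comp_pullback_lift_eq_iff {C : Type*} [Category C] {A B D S T : C} {f : A ⟶ D} {g : B ⟶ D}
    [HasPullback f g] {a : S ⟶ A} {b : S ⟶ B} (h : a ≫ f = b ≫ g) {a' : T ⟶ A} {b' : T ⟶ B}
    (h' : a' ≫ f = b' ≫ g) (t : T ⟶ S) :
    t ≫ pullback.lift a b h = pullback.lift a' b' h' ↔ t ≫ a = a' ∧ t ≫ b = b' := by
  constructor
  · intro e
    have e1 := congrArg (fun z => z ≫ pullback.fst _ _) e
    have e2 := congrArg (fun z => z ≫ pullback.snd _ _) e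
    simp only [Category.assoc, pullback.lift_fst, pullback.lift_snd] at e1 e2
    exact ⟨e1, e2⟩
  · rintro ⟨rfl, rfl⟩
    apply pullback.hom_ext
    · rw [Category.assoc, pullback.lift_fst, pullback.lift_fst]
    · rw [Category.assoc, pullback.lift_snd, pullback.lift_snd]

omit [Finite k] in
theorem indic_kumFrac {m : ℕ} (hm : (m : k) ≠ 0) (A : Type) [CommRing A] (j : Multiplicative ℕ) :
    indic (kumMonoid k) A (kumFrac hm j) = 0 ^ j.toAdd := by
  obtain ⟨j, rfl⟩ := Multiplicative.ofAdd.surjective j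
  by_cases hj : j = 0
  · subst hj
    rw [ofAdd_zero, map_one, map_one, toAdd_one, pow_zero]
  · rw [toAdd_ofAdd, zero_pow hj, indic_of_ne]
    intro h
    refine hj (Multiplicative.ofAdd.injective (kumFrac_injective hm ?_))
    rw [h, ofAdd_zero, map_one]

theorem indic_eq_x_pow {m : ℕ} (hm : (m : k) ≠ 0) {L : Type} [Field L] {j : Multiplicative ℕ}
    {p : Multiplicative natMonoid} (h : kumFrac hm j =
      AddMonoidHom.toMultiplicative (AddSubmonoid.inclusion (natMonoid_le_kumMonoid k)) p) :
    indic natMonoid (TruncRing L m) p = TruncRing.x L m ^ j.toAdd := by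
  obtain ⟨n, hn⟩ := natEquiv.surjective p.toAdd
  obtain rfl : p = Multiplicative.ofAdd (natElt n) := congrArg Multiplicative.ofAdd hn.symm
  have h1 : ((j.toAdd : ℕ) : ℚ≥0) / m = n := congrArg (fun z => (z.toAdd : ℚ≥0)) h
  have h2 : (m : ℚ≥0) ≠ 0 := by exact_mod_cast natCast_ne_zero hm
  have h3 : j.toAdd = m * n := by
    rw [div_eq_iff h2] at h1
    rw [mul_comm]
    exact_mod_cast h1
  rw [h3]
  by_cases hn : n = 0
  · subst hn
    have : Multiplicative.ofAdd (natElt 0) = 1 := congrArg Multiplicative.ofAdd natEquiv.map_zero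
    rw [this, map_one, mul_zero, pow_zero]
  · rw [TruncRing.x_pow_mul hn, indic_of_ne]
    intro h'
    refine hn (natEquiv.injective ?_)
    rw [map_zero]
    exact congrArg Multiplicative.toAdd h'

/-- The section `c` is `(u, p)` near the image `x` of the geometric point `y`, so its pull-back
`(v, r)` to the point is given by the value of `u` and by `p`, regarded as an element of `ℕ_(p)`. -/
theorem exists_value_comp {Y : LogScheme} (f : Y ⟶ logPoint k) (y : kumPoint k ⟶ Y)
    (hy : y ≫ f = kumPointMap k) {U : Et (logPoint k).scheme} {V : Et Y.scheme}
    (g : V.left ⟶ U.left) (hg : g ≫ U.hom = V.hom ≫ Hom.base f)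
    (yV : (kumPoint k).top.left ⟶ V.left) (hyV : yV ≫ V.hom = (kumPoint k).top.hom ≫ Hom.base y)
    (c : (logPoint k).sec U) (x : U.left) (hx : ∀ t, (yV ≫ g) t = x) :
    ∃ (u : Γ(U.left, ⊤)ˣ) (p : Multiplicative natMonoid),
      (∀ {T : Scheme.{0}} (g : T ⟶ U.left), (∀ t, g t = x) →
        g.appTop ((logPoint k).α U c) = g.appTop u *
          (g ≫ U.hom).appTop (indic natMonoid Γ(Spec (.of k), ⊤) p)) ∧
      ∀ (v : (AlgebraicClosure k)ˣ) (r : Multiplicative (kumMonoid k)),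
        Hom.flat y (kumPoint k).top V yV hyV (Hom.flat f V U g hg c) =
          specSec (hα := indic_isNilpotent (kumMonoid k) _) v r →
        specFun (AlgebraicClosure k) v = (yV ≫ g).appTop u ∧
          r = AddMonoidHom.toMultiplicative
            (AddSubmonoid.inclusion (natMonoid_le_kumMonoid k)) p := by
  obtain ⟨u, p, h1, h2⟩ := exists_value (hα := indic_isNilpotent natMonoid _) c x
  refine ⟨u, p, h1, fun v r hvr => ?_⟩
  have hyU' : (yV ≫ g) ≫ U.hom = (kumPoint k).top.hom ≫ Hom.base (y ≫ f) := by
    rw [Category.assoc, hg, ← Category.assoc, hyV, Category.assoc]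
    rfl
  have hyU : (yV ≫ g) ≫ U.hom = (kumPoint k).top.hom ≫ Hom.base (kumPointMap k) := hy ▸ hyU'
  have h3 := (h2 (hα' := indic_isNilpotent (kumMonoid k) _) _ _
    (fun r => map_indic natMonoid (kumMonoid k) (natMonoid_le_kumMonoid k)
      (Spec.map (CommRingCat.ofHom (algebraMap k (AlgebraicClosure k)))).appTop.hom r)
    (yV ≫ g) hyU hx)
  have h4 := (Hom.comp_flat y f yV g hyV hg _ rfl hyU' c).symm.trans
    (LogScheme.Hom.flat_congr_hom hy _ _ _)
  obtain ⟨h5, h6⟩ := constTop_inj (hα := indic_isNilpotent (kumMonoid k) _)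
    (hvr.symm.trans (h4.trans h3))
  exact ⟨congrArg Units.val h5, h6⟩

set_option maxHeartbeats 1000000 in
/-- Every geometric point of a finite Kummer étale cover of the standard log point factors through
the standard point of a standard cover. -/
theorem exists_factor_truncPoint {Y : LogScheme} (f : Y ⟶ logPoint k)
    (hf : LocallyOfFiniteType (Hom.base f)) (hét : IsLogEtale f) (y : kumPoint k ⟶ Y)
    (hy : y ≫ f = kumPointMap k) :
    ∃ (L : IntermediateField k (AlgebraicClosure k)) (_ : FiniteDimensional k L) (m : ℕ)
      (hm : (m : k) ≠ 0) (F : truncLog L m ⟶ Y), F ≫ f = truncMap k L m ∧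
      ∀ p : kumPoint k ⟶ truncLog L m,
        Hom.base p = Spec.map (CommRingCat.ofHom
          ((algebraMap L (AlgebraicClosure k)).comp
            (TruncRing.residue L m (natCast_ne_zero hm)))) →
        (∀ j, globalFlat p (specSec 1 j) = hollowSec 1 (kumFrac hm j).toAdd) → p ≫ F = y := by
  let K := AlgebraicClosure k
  let X := logPoint k
  let s := kumPoint k
  let pt : Spec (CommRingCat.of K) := IsLocalRing.closedPoint K
  have hpt : ∀ p : Spec (CommRingCat.of K), p = pt :=
    fun p => Subsingleton.elim (α := PrimeSpectrum K) _ _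
  let by' : Spec (CommRingCat.of K) ⟶ Y.scheme := Hom.base y
  obtain ⟨U, V, g, hg, Q, P, _, _, φ, cQ, cP, hyV, hQ, hP, hcQ, hcP, hcomm, -, -, -, -, hsq, hδ⟩ :=
    hét (by' pt)
  have hbase : Hom.base y ≫ Hom.base f = Spec.map (CommRingCat.ofHom (algebraMap k K)) :=
    congrArg Hom.base hy
  -- lift the point to `V` and to `V ×_U W`, where the generator of `ℕ` is a multiple of `cQ q`
  obtain ⟨yV, hyV'⟩ := exists_lift_of_etale V.hom by' (fun p => hpt p ▸ hyV)
  obtain ⟨W, a, e, q, hxW, he, hm0⟩ := hcQ.1 U (𝟙 U)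
    (X.res (X.toTop U) (hollowSec 1 (natElt 1))) (g (yV pt))
  rw [X.res_res, comp_toTop, Category.comp_id] at hm0
  obtain ⟨N, b, gW, hgW, hxN⟩ := Et.exists_pull g a (yV pt) hxW
  have hb := Et.etale_homLeft b
  obtain ⟨yN, hyN⟩ := exists_lift_of_etale (Et.homLeft b) yV (fun p => hpt p ▸ hxN)
  -- the values of the chart at the point, and a finite extension over which all is defined
  have hyV : yV ≫ V.hom = s.top.hom ≫ Hom.base y := hyV'.trans (Category.id_comp _).symm
  obtain ⟨χ, ρ, hχρ⟩ := exists_specSec_monoidHom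
    (hα := indic_isNilpotent (kumMonoid k) _) ((Hom.flat y s.top V yV hyV).comp cP)
  obtain ⟨m, hm, j, rfl⟩ := exists_common_denominator hP.1 ρ
  obtain ⟨L₀, hL₀, hχL⟩ := exists_finite_extension (k := k) hP.1 ((Units.coeHom K).comp χ)
  have hlft : LocallyOfFiniteType (N.hom ≫ Hom.base f) := inferInstance
  have hyNk : yN ≫ N.hom ≫ Hom.base f = Spec.map (CommRingCat.ofHom (algebraMap k K)) := by
    rw [← hbase, ← Et.homLeft_w b, Category.assoc, reassoc_of% hyN, reassoc_of% hyV']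
  obtain ⟨L, hL, hLL, nL, hnL, hnLk⟩ :=
    exists_factor_finite (k := k) (K := K) (N.hom ≫ Hom.base f) yN hyNk L₀
  have hmne := natCast_ne_zero hm
  let T := TruncRing L m
  have hT1 : Subsingleton (PrimeSpectrum T) := TruncRing.subsingleton_primeSpectrum hmne
  let κ : Spec (CommRingCat.of K) ⟶ Spec (CommRingCat.of L) :=
    Spec.map (CommRingCat.ofHom (algebraMap L K))
  let π : Spec (CommRingCat.of T) ⟶ Spec (CommRingCat.of L) :=
    Spec.map (CommRingCat.ofHom (algebraMap L T))
  let ι : Spec (CommRingCat.of L) ⟶ Spec (CommRingCat.of T) :=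
    Spec.map (CommRingCat.ofHom (TruncRing.residue L m hmne))
  have hιπ : ι ≫ π = 𝟙 _ := by
    refine (Spec.map_comp _ _).symm.trans (Eq.trans ?_ (Spec.map_id _))
    refine congrArg Spec.map ?_
    ext1
    exact RingHom.ext (TruncRing.residue_algebraMap hmne)
  let vL : Spec (CommRingCat.of L) ⟶ V.left := nL ≫ Et.homLeft b
  have hκv : κ ≫ vL = yV := by rw [← Category.assoc, hnL, hyN]
  let wL : Spec (CommRingCat.of L) ⟶ W.left := nL ≫ gW
  have hwv : wL ≫ Et.homLeft a = vL ≫ g := by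
    rw [Category.assoc, hgW, ← Category.assoc]
  have hxT : ∀ t, (π ≫ vL ≫ g) t = g (yV pt) := by
    intro t
    obtain rfl : t = ι (κ pt) := Subsingleton.elim (α := PrimeSpectrum T) _ _
    rw [← Scheme.Hom.comp_apply, reassoc_of% hιπ, ← Scheme.Hom.comp_apply, reassoc_of% hκv]
    rfl
  have hinj : Function.Injective (algebraMap L K) := (algebraMap L K).injective
  have hκinj : Function.Injective κ.appTop.hom := by
    intro s t hst
    obtain ⟨s, rfl⟩ := (specFun L).surjective s
    obtain ⟨t, rfl⟩ := (specFun L).surjective t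
    have := (appTop_specFun _ s).symm.trans (hst.trans (appTop_specFun _ t))
    rw [hinj ((specFun K).injective this)]
  -- the values of the chart in `Lˣ × ℕ`
  obtain ⟨χL, hχL'⟩ : ∃ χL : P →* Lˣ, ∀ p, algebraMap L K (χL p) = χ p := by
    have h1 : ∀ p, ((χ p : Kˣ) : K) ∈ L := fun p => hLL (hχL p)
    refine ⟨⟨⟨fun p => Units.mk0 (⟨χ p, h1 p⟩ : L) fun h => (χ p).ne_zero (congrArg Subtype.val h),
      Units.ext (Subtype.ext ?_)⟩, fun p p' => Units.ext (Subtype.ext ?_)⟩, fun p => rfl⟩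
    · exact congrArg Units.val (map_one χ)
    · exact congrArg Units.val (map_mul χ p p')
  let cT : P →* (truncLog L m).sec (truncLog L m).top :=
    { toFun := fun p => specSec (Units.map (algebraMap L T : L →* T) (χL p)) (j p)
      map_one' := by
        rw [map_one, map_one, map_one]
        exact specSec_one
      map_mul' := fun p p' => by
        rw [map_mul, map_mul, map_mul]
        exact (specSec_mul _ _ _ _).symm }
  have hαcT : ∀ p, (truncLog L m).α _ (cT p) =
      specFun T (algebraMap L T (χL p) * TruncRing.x L m ^ (j p).toAdd) := by
    intro p
    refine (α_specSec _ _).trans ?_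
    rw [map_mul]
    rfl
  -- `(u, j) ↦ u x^j` makes `Spec L[x]/(x^m)` a scheme over the fibre product `U ×_{ℤ[Q]} ℤ[P]`
  have hcond : (π ≫ vL ≫ g) ≫ X.toSpec U cQ =
      charSpec (Spec (CommRingCat.of T)) (((truncLog L m).α (truncLog L m).top).comp cT) ≫
        specMap φ := by
    refine (comp_charSpec _ _).trans (Eq.trans ?_ (charSpec_specMap φ _).symm)
    refine congrArg (charSpec _) (MonoidHom.ext fun q' => ?_)
    obtain ⟨u, p₀, h1, h2⟩ := exists_value_comp f y hy g hg yV hyV (cQ q') (g (yV pt))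
      (fun t => by rw [hpt t]; rfl)
    refine (h1 _ hxT).trans (Eq.trans ?_ (hαcT _).symm)
    obtain ⟨h4, h5⟩ := h2 _ _
      ((congrArg (Hom.flat y s.top V yV hyV) (DFunLike.congr_fun hcomm q')).symm.trans (hχρ (φ q')))
    obtain ⟨uL, huL⟩ := (specFun L).surjective ((vL ≫ g).appTop u)
    have h6 : ((χL (φ q') : Lˣ) : L) = uL := by
      apply hinj
      apply (specFun K).injective
      rw [hχL', ← appTop_specFun, huL]
      refine h4.trans ?_
      change (yV ≫ g).appTop u = κ.appTop _
      rw [← hκv, Category.assoc, Scheme.Hom.comp_appTop κ]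
      rfl
    have h7 : (π ≫ vL ≫ g).appTop u = specFun T (algebraMap L T uL) := by
      rw [← appTop_specFun, huL, Scheme.Hom.comp_appTop π]
      rfl
    rw [h6, map_mul, ← indic_eq_x_pow hm h5, ← indic_eq, h7]
    refine congrArg _ ?_
    exact map_indic natMonoid natMonoid le_rfl ((π ≫ vL ≫ g) ≫ U.hom).appTop.hom p₀
  have hαcP : ∀ p, ι.appTop ((truncLog L m).α _ (cT p)) = vL.appTop (Y.α V (cP p)) := by
    intro p
    apply hκinj
    rw [hαcT]
    refine (congrArg κ.appTop (appTop_specFun _ _)).trans ((appTop_specFun _ _).trans ?_)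
    have h1 : κ.appTop (vL.appTop (Y.α V (cP p))) = yV.appTop (Y.α V (cP p)) := by
      rw [← hκv, Scheme.Hom.comp_appTop]
      rfl
    refine Eq.trans ?_ h1.symm
    refine Eq.trans ?_ (Hom.α_flat y s.top V yV hyV (cP p))
    refine Eq.trans ?_ (congrArg (s.α s.top) (hχρ p)).symm
    refine Eq.trans ?_ (α_specSec _ _).symm
    rw [indic_eq, ← map_mul, map_mul, map_pow, TruncRing.residue_algebraMap, TruncRing.residue_x,
      map_mul, map_pow, map_zero, hχL']
    exact congrArg (fun z => specFun K (χ p * z)) (indic_kumFrac hm K (j p)).symm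
  -- on the closed point this morphism to the fibre product lifts to `V`
  have hι : ι ≫ pullback.lift (π ≫ vL ≫ g) _ hcond = vL ≫ pullback.lift g (Y.toSpec V cP) hsq := by
    have h1 : ι ≫ π ≫ vL ≫ g = vL ≫ g := by rw [reassoc_of% hιπ]
    have h2 : ι ≫ charSpec (Spec (CommRingCat.of T))
        (((truncLog L m).α (truncLog L m).top).comp cT) = vL ≫ Y.toSpec V cP :=
      (comp_charSpec _ _).trans ((congrArg (charSpec _) (MonoidHom.ext hαcP)).trans
        (comp_charSpec _ _).symm)
    have h3 : (vL ≫ g) ≫ X.toSpec U cQ = (vL ≫ Y.toSpec V cP) ≫ specMap φ :=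
      (Category.assoc _ _ _).trans
        ((congrArg (fun z => vL ≫ z) hsq).trans (Category.assoc _ _ _).symm)
    exact ((comp_pullback_lift_eq_iff hcond h3 ι).2 ⟨h1, h2⟩).trans
      ((comp_pullback_lift_eq_iff hsq h3 vL).2 ⟨rfl, rfl⟩).symm
  -- `V` is étale over the fibre product, and the closed point has a nilpotent ideal
  obtain ⟨t', ht', hιt'⟩ := exists_etale_lift (TruncRing.residue L m hmne)
    (TruncRing.residue_surjective hmne) (TruncRing.isNilpotent_ker_residue hmne)
    (pullback.lift g (Y.toSpec V cP) hsq) (pullback.lift (π ≫ vL ≫ g) _ hcond) vL hι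
  obtain ⟨ht'g, ht'c⟩ := (comp_pullback_lift_eq_iff hsq hcond t').1 ht'
  have hαt' : ∀ p, (truncLog L m).α _ (cT p) = t'.appTop (Y.α V (cP p)) := by
    have := charSpec_injective ((comp_charSpec _ _).symm.trans ht'c)
    exact fun p => (DFunLike.congr_fun this p).symm
  -- the chart `cP` turns the lift `t'` into a morphism of log schemes
  obtain ⟨F, hF, hFc⟩ := hcP.exists_hom (Z := truncLog L m) (c' := cT) (v := t')
    (b := t' ≫ V.hom) (Category.id_comp _).symm hαt'
  refine ⟨L, hL, m, hm, F, logPoint_hom_ext ?_ ?_, fun p hp hp' => ?_⟩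
  -- `F ≫ f` is the structure morphism: on the schemes, on the generator of `ℕ`, and then `p ≫ F = y`
  · have h1 : vL ≫ V.hom ≫ Hom.base f = Spec.map (CommRingCat.ofHom (algebraMap k L)) := by
      rw [← hnLk, ← Et.homLeft_w b, Category.assoc, Category.assoc]
    rw [base_comp, hF, Category.assoc, ← hg, reassoc_of% ht'g, hg, h1]
    exact (Spec.map_comp _ _).symm
  · obtain ⟨ε, hε⟩ : ∃ ε : Lˣ, specFun L ε = wL.appTop (X.α W e) := by
      obtain ⟨u, hu⟩ := he.map wL.appTop.hom
      refine ⟨Units.map ((specFun L).symm : Γ(Spec (.of L), ⊤) →* L) u, ?_⟩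
      exact ((specFun L).apply_symm_apply _).trans hu
    have hκw : (κ ≫ wL) ≫ Et.homLeft a = yV ≫ g := by
      rw [Category.assoc, hwv, reassoc_of% hκv]
    obtain ⟨E, hE, hE'⟩ := globalFlat_comp_eq_mul y f a yV g (κ ≫ wL) hyV hg hκw hm0
    have hE1 : E = specSec (hα := indic_isNilpotent (kumMonoid k) _)
        (Units.map (algebraMap L K : L →* K) ε) 1 := by
      exact eq_specSec_of_α _ (hE.trans (comp_appTop_eq_specFun _ wL hε))
    have hvF : t' ≫ V.hom = (truncLog L m).top.hom ≫ Hom.base F := by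
      rw [hF]
      exact (Category.id_comp _).symm
    have hπw : (π ≫ wL) ≫ Et.homLeft a = t' ≫ g := by
      rw [Category.assoc, hwv, ht'g]
    obtain ⟨E', hE₁, hE₂⟩ := globalFlat_comp_eq_mul F f a t' g (π ≫ wL) hvF hg hπw hm0
    have hE2 : E' = specSec (hα := truncAlpha_isNilpotent L m)
        (Units.map (algebraMap L T : L →* T) ε) 1 := by
      exact eq_specSec_of_α _ (hE₁.trans (comp_appTop_eq_specFun _ wL hε))
    have hq : Hom.flat f V U g hg (cQ q) = cP (φ q) := (DFunLike.congr_fun hcomm q).symm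
    -- the equation over the geometric point
    have h1 : specSec (hα := indic_isNilpotent (kumMonoid k) _) 1
        (kumFrac hm (Multiplicative.ofAdd m)) =
        specSec (Units.map (algebraMap L K : L →* K) ε * χ (φ q)) (1 * kumFrac hm (j (φ q))) := by
      refine Eq.trans ?_ (specSec_mul _ _ _ _)
      refine Eq.trans ?_ (congrArg₂ (· * ·) hE1 (hχρ (φ q)))
      refine Eq.trans ?_ (congrArg (fun z => E * Hom.flat y s.top V yV hyV z) hq)
      refine Eq.trans ?_ hE'
      rw [hy]
      refine Eq.trans ?_ (globalFlat_hollowMap _ _ _).symm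
      rw [map_one, hollowSec_eq]
      refine congrArg _ (Multiplicative.toAdd.injective (Subtype.ext ?_))
      refine (coe_kumFrac hm _).trans ?_
      have : (m : ℚ≥0) ≠ 0 := by exact_mod_cast hmne
      rw [div_self this]
      exact Nat.cast_one.symm
    obtain ⟨h2, h3⟩ := specSec_inj h1
    rw [one_mul] at h3
    have h4 : ε * χL (φ q) = 1 := by
      refine Units.ext (hinj ?_)
      rw [Units.val_mul, map_mul, hχL', Units.val_one, map_one]
      exact congrArg Units.val h2.symm
    have h5 := kumFrac_injective hm h3
    rw [hE₂, hq, globalFlat_truncMap, hE2]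
    refine (congrArg _ (hFc (φ q))).trans ?_
    refine (specSec_mul _ _ _ _).trans ?_
    rw [← map_mul, h4, map_one, one_mul, ← h5, mul_one]
  · have h1 : Hom.base p ≫ t' = yV := by
      rw [hp, ← hκv, ← hιt', ← Category.assoc]
      exact congrArg (fun z => z ≫ t') (Spec.map_comp
        (CommRingCat.ofHom (TruncRing.residue L m hmne)) (CommRingCat.ofHom (algebraMap L K)))
    have h2 : yV ≫ V.hom = s.top.hom ≫ Hom.base (p ≫ F) := by
      rw [base_comp, hF, ← h1, Category.assoc]
      exact (Category.id_comp _).symm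
    refine hcP.hom_ext yV h2 hyV fun p' => ?_
    have hvF : t' ≫ V.hom = (truncLog L m).top.hom ≫ Hom.base F := by
      rw [hF]
      exact (Category.id_comp _).symm
    refine (Hom.comp_flat p F (U := s.top) (V := (truncLog L m).top) (Hom.base p) t'
      ((Category.comp_id _).trans (Category.id_comp _).symm) hvF yV h1.symm h2 (cP p')).trans ?_
    refine (congrArg (globalFlat p) (hFc p')).trans ?_
    refine (globalFlat_specSec p hp _ _ (hp' (j p'))).trans ?_
    refine Eq.trans ?_ (hχρ p').symm
    rw [mul_one]
    refine congrArg (fun z => specSec z _) (Units.ext ?_)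
    refine (congrArg (algebraMap L K) (TruncRing.residue_algebraMap hmne _)).trans ?_
    exact hχL' p'

end

/-! ### Morphisms between the universal covers -/

section

variable {k : Type} [Field k] {K : Type} [Field K] [Algebra k K] {S S' T : AddSubmonoid ℚ≥0}

/-- The morphism `f : (Spec K, T) → (Spec K, S)` is given on rings by `ψ` and on the monoid `S ⊆ T`
by `r ↦ (χ r, r)`. -/
def IsGivenBy (h : S ≤ T) (f : hollow K T ⟶ hollow K S) (ψ : K →ₐ[k] K)
    (χ : Multiplicative S →* Kˣ) : Prop :=
  Hom.base f = Spec.map (CommRingCat.ofHom (ψ : K →+* K)) ∧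
    ∀ (x : Kˣ) (r : S), globalFlat f (hollowSec x r) =
      hollowSec (Units.map (ψ : K →* K) x * χ (Multiplicative.ofAdd r)) (AddSubmonoid.inclusion h r)

theorem IsGivenBy.eq {h : S ≤ T} {f f' : hollow K T ⟶ hollow K S} {ψ : K →ₐ[k] K}
    {χ : Multiplicative S →* Kˣ} (hf : IsGivenBy h f ψ χ) (hf' : IsGivenBy h f' ψ χ) : f = f' :=
  hollow_hom_ext (hf.1.trans hf'.1.symm) fun r => (hf.2 1 r).trans (hf'.2 1 r).symm

theorem IsGivenBy.unique {h : S ≤ T} {f : hollow K T ⟶ hollow K S} {ψ ψ' : K →ₐ[k] K}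
    {χ χ' : Multiplicative S →* Kˣ} (hf : IsGivenBy h f ψ χ) (hf' : IsGivenBy h f ψ' χ') :
    ψ = ψ' ∧ χ = χ' := by
  have h1 : ψ = ψ' := by
    have := Spec.map_injective (hf.1.symm.trans hf'.1)
    refine AlgHom.ext fun x => ?_
    exact congrArg (fun z : CommRingCat.of K ⟶ CommRingCat.of K => z.hom x) this
  refine ⟨h1, MonoidHom.ext fun r => ?_⟩
  have := (hollowSec_inj ((hf.2 1 r.toAdd).symm.trans (hf'.2 1 r.toAdd))).1
  rw [map_one, map_one, one_mul, one_mul] at this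
  exact this

theorem IsGivenBy.eq_iff {h : S ≤ T} {f f' : hollow K T ⟶ hollow K S} {ψ ψ' : K →ₐ[k] K}
    {χ χ' : Multiplicative S →* Kˣ} (hf : IsGivenBy h f ψ χ) (hf' : IsGivenBy h f' ψ' χ') :
    f = f' ↔ ψ = ψ' ∧ χ = χ' := by
  constructor
  · rintro rfl
    exact hf.unique hf'
  · rintro ⟨rfl, rfl⟩
    exact hf.eq hf'

theorem IsGivenBy.comp {h : S ≤ T} {h' : S' ≤ S} {f : hollow K T ⟶ hollow K S}
    {f' : hollow K S ⟶ hollow K S'} {ψ ψ' : K →ₐ[k] K}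
    {χ : Multiplicative S →* Kˣ} {χ' : Multiplicative S' →* Kˣ}
    (hf : IsGivenBy h f ψ χ) (hf' : IsGivenBy h' f' ψ' χ') :
    IsGivenBy (h'.trans h) (f ≫ f') (ψ.comp ψ') ((Units.map (ψ : K →* K)).comp χ' *
      χ.comp (AddMonoidHom.toMultiplicative (AddSubmonoid.inclusion h'))) := by
  refine ⟨?_, fun x r => ?_⟩
  · rw [base_comp, hf.1, hf'.1]
    exact (Spec.map_comp _ _).symm
  · rw [globalFlat_comp, hf'.2, hf.2, map_mul]
    refine congrArg₂ hollowSec ?_ rfl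
    rw [mul_assoc]
    rfl

theorem IsGivenBy.id (h : S ≤ S) : IsGivenBy h (𝟙 (hollow K S)) (AlgHom.id k K) 1 := by
  refine ⟨(Spec.map_id _).symm, fun x r => ?_⟩
  rw [globalFlat_id]
  refine congrArg₂ hollowSec ?_ rfl
  rw [MonoidHom.one_apply, mul_one]
  rfl

theorem isGivenBy_hollowMap (h : S ≤ T) :
    IsGivenBy h (hollowMap K K h) (AlgHom.id k K) 1 := by
  refine ⟨rfl, fun x r => ?_⟩
  rw [globalFlat_hollowMap, MonoidHom.one_apply, mul_one]
  rfl

variable (k) in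
/-- The generator of `natMonoid` as an element of a larger monoid. -/
def oneElt (hS : natMonoid ≤ S) : Multiplicative S :=
  Multiplicative.ofAdd (AddSubmonoid.inclusion hS (natElt 1))

theorem coe_oneElt (hS : natMonoid ≤ S) : ((oneElt hS).toAdd : ℚ≥0) = 1 := Nat.cast_one

theorem eq_inclusion_of_map_oneElt (hS : natMonoid ≤ S) (hT : natMonoid ≤ T) (h : S ≤ T)
    (ρ : Multiplicative S →* Multiplicative T) (hρ : ρ (oneElt hS) = oneElt hT)
    (r : Multiplicative S) :
    ρ r = AddMonoidHom.toMultiplicative (AddSubmonoid.inclusion h) r := by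
  let n := (r.toAdd : ℚ≥0).den
  let a := (r.toAdd : ℚ≥0).num
  have hn : (n : ℚ≥0) ≠ 0 := by exact_mod_cast (r.toAdd : ℚ≥0).den_ne_zero
  have hr : (n : ℚ≥0) * (r.toAdd : ℚ≥0) = a := by
    conv_lhs => rw [← NNRat.num_div_den (r.toAdd : ℚ≥0)]
    exact mul_div_cancel₀ _ hn
  have h1 : r ^ n = oneElt hS ^ a := by
    refine Multiplicative.toAdd.injective (Subtype.ext ?_)
    rw [toAdd_pow, toAdd_pow, AddSubmonoidClass.coe_nsmul, AddSubmonoidClass.coe_nsmul, nsmul_eq_mul,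
      nsmul_eq_mul, coe_oneElt, mul_one, hr]
  have h2 := congrArg ρ h1
  rw [map_pow, map_pow, hρ] at h2
  have h3 := congrArg (fun z => (z.toAdd : ℚ≥0)) h2
  simp only [toAdd_pow, AddSubmonoidClass.coe_nsmul, nsmul_eq_mul, coe_oneElt, mul_one] at h3
  refine Multiplicative.toAdd.injective (Subtype.ext ?_)
  exact mul_left_cancel₀ hn (h3.trans hr.symm)

theorem exists_isGivenBy (hS : natMonoid ≤ S) (hT : natMonoid ≤ T) (h : S ≤ T)
    (f : hollow K T ⟶ hollow K S) (hf : f ≫ hollowMap k K hS = hollowMap k K hT) :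
    ∃ (ψ : K →ₐ[k] K) (χ : Multiplicative S →* Kˣ), IsGivenBy h f ψ χ ∧ χ (oneElt hS) = 1 := by
  obtain ⟨ψ, hψ⟩ := exists_base_eq f
  have hψk : ψ.comp (algebraMap k K) = algebraMap k K := by
    have h1 := congrArg Hom.base hf
    rw [base_comp, hψ] at h1
    have h2 := Spec.map_injective ((Spec.map_comp _ _).trans h1)
    exact congrArg (fun z : CommRingCat.of k ⟶ CommRingCat.of K => z.hom) h2
  obtain ⟨χ, ρ, hχ⟩ := exists_specSec_monoidHom (hα := indic_isNilpotent T _)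
    ((globalFlat f).comp (constChart (indic S _) (indic_isNilpotent S _)))
  have hf1 : ∀ r, globalFlat f (hollowSec 1 r) =
      hollowSec (χ (Multiplicative.ofAdd r)) (ρ (Multiplicative.ofAdd r)).toAdd := by
    intro r
    rw [hollowSec_eq, ← constTop_one_eq]
    exact hχ (Multiplicative.ofAdd r)
  have h1 := congrArg (fun z => globalFlat z (hollowSec 1 (natElt 1))) hf
  simp only [globalFlat_comp, globalFlat_hollowMap, map_one] at h1
  obtain ⟨h2, h3⟩ := hollowSec_inj ((hf1 _).symm.trans h1)
  have hρ := eq_inclusion_of_map_oneElt hS hT h ρ (Multiplicative.toAdd.injective h3)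
  refine ⟨⟨ψ, fun a => congrArg (fun z : k →+* K => z a) hψk⟩, χ, ⟨hψ, fun x r => ?_⟩, h2⟩
  refine (hollow_globalFlat f hψ x r (hf1 r)).trans ?_
  rw [hρ]
  rfl

theorem exists_hom_isGivenBy (hS : natMonoid ≤ S) (hT : natMonoid ≤ T) (h : S ≤ T)
    (ψ : K →ₐ[k] K) (χ : Multiplicative S →* Kˣ) (hχ : χ (oneElt hS) = 1) :
    ∃ f : hollow K T ⟶ hollow K S, f ≫ hollowMap k K hS = hollowMap k K hT ∧
      IsGivenBy h f ψ χ := by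
  obtain ⟨f, hf, hf'⟩ := exists_hollow_hom (ψ : K →+* K) h χ
  refine ⟨f, logPoint_hom_ext ?_ ?_, hf, hf'⟩
  · rw [base_comp, hf]
    refine (Spec.map_comp _ _).symm.trans ?_
    refine congrArg Spec.map ?_
    ext1
    exact ψ.comp_algebraMap
  · rw [globalFlat_comp, globalFlat_hollowMap, hf', map_one, map_one, one_mul,
      globalFlat_hollowMap, map_one]
    exact congrArg₂ hollowSec hχ rfl

end

/-! ### The points of the standard covers -/

section

variable {k : Type} [Field k] {L : Type} [Field L] [Algebra k L] {m : ℕ}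

/-- The point `y` of the standard cover is given by the embedding `τ` of `L` and by the element `ζ`:
the variable goes to `0`, the element `j` of the chart to `(ζ^j, j/m)`. -/
def IsPointOf (hm : (m : k) ≠ 0) (y : kumPoint k ⟶ truncLog L m) (τ : L →ₐ[k] AlgebraicClosure k)
    (ζ : (AlgebraicClosure k)ˣ) : Prop :=
  Hom.base y = Spec.map (CommRingCat.ofHom
    ((τ : L →+* AlgebraicClosure k).comp (TruncRing.residue L m (natCast_ne_zero hm)))) ∧
  ∀ j, globalFlat y (specSec 1 j) = hollowSec (powersHom _ ζ j) (kumFrac hm j).toAdd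

theorem IsPointOf.eq {hm : (m : k) ≠ 0} {y y' : kumPoint k ⟶ truncLog L m}
    {τ : L →ₐ[k] AlgebraicClosure k} {ζ : (AlgebraicClosure k)ˣ} (h : IsPointOf hm y τ ζ)
    (h' : IsPointOf hm y' τ ζ) : y = y' :=
  spec_hom_ext (hα := truncAlpha_isNilpotent L m) (hβ := indic_isNilpotent _ _) (h.1.trans h'.1.symm)
    fun p => (h.2 p).trans (h'.2 p).symm

theorem IsPointOf.unique {hm : (m : k) ≠ 0} {y : kumPoint k ⟶ truncLog L m}
    {τ τ' : L →ₐ[k] AlgebraicClosure k} {ζ ζ' : (AlgebraicClosure k)ˣ} (h : IsPointOf hm y τ ζ)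
    (h' : IsPointOf hm y τ' ζ') : τ = τ' ∧ ζ = ζ' := by
  constructor
  · have h1 := Spec.map_injective (h.1.symm.trans h'.1)
    refine AlgHom.ext fun x => ?_
    have h2 := congrArg (fun z : CommRingCat.of (TruncRing L m) ⟶
      CommRingCat.of (AlgebraicClosure k) => z.hom (algebraMap L _ x)) h1
    have h3 : ∀ τ : L →ₐ[k] AlgebraicClosure k, τ (TruncRing.residue L m (natCast_ne_zero hm)
        (algebraMap L _ x)) = τ x := fun τ => congrArg τ (TruncRing.residue_algebraMap _ x)
    exact (h3 τ).symm.trans (Eq.trans h2 (h3 τ'))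
  · have := (hollowSec_inj ((h.2 (Multiplicative.ofAdd 1)).symm.trans
      (h'.2 (Multiplicative.ofAdd 1)))).1
    simpa using this

/-- All points of a standard cover over the log geometric point are of this form. -/
theorem exists_isPointOf [Finite k] (hm : (m : k) ≠ 0) (y : kumPoint k ⟶ truncLog L m)
    (hy : y ≫ truncMap k L m = kumPointMap k) :
    ∃ (τ : L →ₐ[k] AlgebraicClosure k) (ζ : (AlgebraicClosure k)ˣ), IsPointOf hm y τ ζ := by
  have hm0 := natCast_ne_zero hm
  obtain ⟨ψ, hψ⟩ := exists_base_eq (hα := truncAlpha_isNilpotent L m)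
    (hβ := indic_isNilpotent (kumMonoid k) _) y
  have hψk : ψ.comp (algebraMap k (TruncRing L m)) = algebraMap k (AlgebraicClosure k) := by
    have h1 := congrArg Hom.base hy
    rw [base_comp, hψ, base_truncMap] at h1
    have h2 := Spec.map_injective ((Spec.map_comp _ _).trans h1)
    exact congrArg (fun z : CommRingCat.of k ⟶ CommRingCat.of (AlgebraicClosure k) => z.hom) h2
  let τ : L →ₐ[k] AlgebraicClosure k :=
    { ψ.comp (algebraMap L (TruncRing L m)) with
      commutes' := fun a => congrArg (fun z : k →+* AlgebraicClosure k => z a) hψk }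
  obtain ⟨ζ, r, hζ⟩ := exists_hollowSec (globalFlat y (specSec 1 (Multiplicative.ofAdd 1)))
  have hj : ∀ j : ℕ, globalFlat y (specSec 1 (Multiplicative.ofAdd j)) =
      specSec (hα := indic_isNilpotent _ _) (ζ ^ j) (Multiplicative.ofAdd r ^ j) := by
    intro j
    induction j with
    | zero =>
      rw [pow_zero, pow_zero, ofAdd_zero]
      exact (congrArg (globalFlat y) specSec_one).trans ((map_one _).trans specSec_one.symm)
    | succ j ih =>
      have h1 : specSec (hα := truncAlpha_isNilpotent L m) 1 (Multiplicative.ofAdd (j + 1)) =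
          specSec 1 (Multiplicative.ofAdd j) * specSec 1 (Multiplicative.ofAdd 1) := by
        rw [specSec_mul, mul_one, ofAdd_add]
      rw [h1, map_mul, ih, hζ, hollowSec_eq, pow_succ, pow_succ]
      exact specSec_mul _ _ _ _
  have h1 := congrArg (fun z => globalFlat z (hollowSec 1 (natElt 1))) hy
  simp only [globalFlat_comp, globalFlat_hollowMap, globalFlat_truncMap, map_one] at h1
  have h2 := (specSec_inj ((hj _).symm.trans h1)).2
  have h3 : (m : ℚ≥0) * r = 1 := by
    have := congrArg (fun z => (z.toAdd : ℚ≥0)) h2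
    simp only [toAdd_pow, mul_one, toAdd_ofAdd, AddSubmonoidClass.coe_nsmul, nsmul_eq_mul] at this
    exact this.trans Nat.cast_one
  have h4 : Multiplicative.ofAdd r = kumFrac hm (Multiplicative.ofAdd 1) := by
    refine Multiplicative.toAdd.injective (Subtype.ext ?_)
    refine Eq.trans ?_ (coe_kumFrac hm _).symm
    have : (m : ℚ≥0) ≠ 0 := by exact_mod_cast hm0
    rw [eq_div_iff this, mul_comm, Nat.cast_one]
    exact h3
  refine ⟨τ, ζ, ?_, fun j => ?_⟩
  · rw [hψ]
    congr 2
    exact TruncRing.eq_comp_residue hm0 ψ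
  · refine (hj j.toAdd).trans ?_
    rw [h4, ← map_pow, ← ofAdd_nsmul, nsmul_one]
    rfl

/-- Composition of a point with an endomorphism of the log geometric point. -/
theorem IsPointOf.comp {hm : (m : k) ≠ 0} {y : kumPoint k ⟶ truncLog L m}
    {τ : L →ₐ[k] AlgebraicClosure k} {ζ : (AlgebraicClosure k)ˣ} (hy : IsPointOf hm y τ ζ)
    {f : kumPoint k ⟶ kumPoint k} {ψ : AlgebraicClosure k →ₐ[k] AlgebraicClosure k}
    {χ : Multiplicative (kumMonoid k) →* (AlgebraicClosure k)ˣ} (hf : IsGivenBy le_rfl f ψ χ) :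
    IsPointOf hm (f ≫ y) (ψ.comp τ)
      (Units.map (ψ : AlgebraicClosure k →* AlgebraicClosure k) ζ *
        χ (kumFrac hm (Multiplicative.ofAdd 1))) := by
  refine ⟨?_, fun j => ?_⟩
  · rw [base_comp, hf.1, hy.1]
    exact (Spec.map_comp _ _).symm
  · rw [globalFlat_comp, hy.2, hf.2]
    refine congrArg₂ hollowSec ?_ rfl
    have h1 : kumFrac hm j = kumFrac hm (Multiplicative.ofAdd 1) ^ j.toAdd := by
      rw [← map_pow, ← ofAdd_nsmul, nsmul_one]
      rfl
    rw [ofAdd_toAdd, h1, map_pow, powersHom_apply, powersHom_apply, map_pow, mul_pow]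

/-- The transition maps between the standard covers. -/
theorem exists_truncTrans [Finite k] {L' : Type} [Field L'] [Algebra k L'] (ι : L →ₐ[k] L') {m' d : ℕ}
    (hd : m' = m * d) (hm : (m : k) ≠ 0) (hm' : (m' : k) ≠ 0) :
    ∃ F : truncLog L' m' ⟶ truncLog L m, F ≫ truncMap k L m = truncMap k L' m' ∧
      ∀ (y : kumPoint k ⟶ truncLog L' m') (τ : L' →ₐ[k] AlgebraicClosure k)
        (ζ : (AlgebraicClosure k)ˣ), IsPointOf hm' y τ ζ →
          IsPointOf hm (y ≫ F) (τ.comp ι) (ζ ^ d) := by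
  have hxd : (TruncRing.x L' m' ^ d) ^ m = 0 := by
    rw [← pow_mul, mul_comm, ← hd, TruncRing.x_pow]
  let ψ : TruncRing L m →+* TruncRing L' m' :=
    TruncRing.lift ((algebraMap L' (TruncRing L' m')).comp (ι : L →+* L'))
      (TruncRing.x L' m' ^ d) hxd
  obtain ⟨F, hF, hF'⟩ := exists_spec_hom (hα := truncAlpha_isNilpotent L m)
    (hβ := truncAlpha_isNilpotent L' m') ψ 1 (powMonoidHom d) (fun j => by
      obtain ⟨j, rfl⟩ := Multiplicative.ofAdd.surjective j
      have h1 : ψ (TruncRing.x L m) = TruncRing.x L' m' ^ d := TruncRing.lift_x _ _ _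
      rw [powMonoidHom_apply, ← ofAdd_nsmul, truncAlpha_ofAdd, truncAlpha_ofAdd, appTop_specFun,
        map_pow ψ, h1, MonoidHom.one_apply, Units.val_one, map_one, one_mul, smul_eq_mul, pow_mul])
  have hs : ∀ j, globalFlat F (specSec 1 j) = specSec 1 (j ^ d) := by
    intro j
    refine (hF' 1 j).trans ?_
    rw [map_one, one_mul]
    rfl
  refine ⟨F, logPoint_hom_ext ?_ ?_, fun y τ ζ hy => ⟨?_, fun j => ?_⟩⟩
  · rw [base_comp, hF, base_truncMap, base_truncMap]
    refine (Spec.map_comp _ _).symm.trans ?_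
    refine congrArg Spec.map ?_
    ext1
    refine RingHom.ext fun a => ?_
    change ψ (algebraMap k (TruncRing L m) a) = _
    rw [IsScalarTower.algebraMap_apply k L (TruncRing L m), TruncRing.lift_algebraMap]
    refine Eq.trans ?_ (IsScalarTower.algebraMap_apply k L' (TruncRing L' m') a).symm
    exact congrArg (algebraMap L' _) (ι.commutes a)
  · rw [globalFlat_comp, globalFlat_truncMap, hs, globalFlat_truncMap, ← ofAdd_nsmul, hd]
    congr 2
    rw [smul_eq_mul]
    ring
  · rw [base_comp, hy.1, hF]
    refine (Spec.map_comp _ _).symm.trans ?_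
    refine congrArg Spec.map ?_
    ext1
    refine TruncRing.hom_ext (fun a => ?_) ?_
    · change τ (TruncRing.residue L' m' _ (ψ (algebraMap L _ a))) =
        τ (ι (TruncRing.residue L m _ (algebraMap L _ a)))
      rw [TruncRing.lift_algebraMap, TruncRing.residue_algebraMap]
      exact congrArg τ (TruncRing.residue_algebraMap _ _)
    · change τ (TruncRing.residue L' m' _ (ψ (TruncRing.x L m))) =
        τ (ι (TruncRing.residue L m _ (TruncRing.x L m)))
      have hd0 : d ≠ 0 := by
        rintro rfl
        exact natCast_ne_zero hm' (by rw [hd, mul_zero])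
      rw [TruncRing.lift_x, TruncRing.residue_x, map_pow, TruncRing.residue_x, zero_pow hd0,
        map_zero, map_zero, map_zero]
  · rw [globalFlat_comp, hs, hy.2]
    have h1 : kumFrac hm' (j ^ d) = kumFrac hm j := by
      refine Multiplicative.toAdd.injective (Subtype.ext ?_)
      refine (coe_kumFrac hm' (d * j.toAdd)).trans (Eq.trans ?_ (coe_kumFrac hm j.toAdd).symm)
      have hd0 : d ≠ 0 := by
        rintro rfl
        exact natCast_ne_zero hm' (by rw [hd, mul_zero])
      have hd1 : (d : ℚ≥0) ≠ 0 := by exact_mod_cast hd0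
      rw [hd, Nat.cast_mul, Nat.cast_mul, mul_comm (m : ℚ≥0), mul_div_mul_left _ _ hd1]
    rw [h1]
    refine congrArg₂ hollowSec ?_ rfl
    rw [map_pow, powersHom_apply, powersHom_apply, ← pow_mul, ← pow_mul, mul_comm]

end

section

variable {k : Type} [Field k]

theorem eq_kumFrac {m : ℕ} (hm : (m : k) ≠ 0) (r : Multiplicative (kumMonoid k)) {c : ℕ}
    (hc : m = (r.toAdd : ℚ≥0).den * c) :
    r = kumFrac hm (Multiplicative.ofAdd (c * (r.toAdd : ℚ≥0).num)) := by
  refine Multiplicative.toAdd.injective (Subtype.ext ?_)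
  refine Eq.trans ?_ (coe_kumFrac hm _).symm
  have h1 := NNRat.num_div_den (r.toAdd : ℚ≥0)
  have h2 : (m : ℚ≥0) ≠ 0 := by exact_mod_cast natCast_ne_zero hm
  rw [eq_div_iff h2, hc]
  push_cast
  nth_rw 1 [← h1]
  have h3 : ((((r.toAdd : ℚ≥0).den : ℕ)) : ℚ≥0) ≠ 0 := by
    exact_mod_cast (r.toAdd : ℚ≥0).den_ne_zero
  field_simp

end

/-! ### Automorphisms of the universal covers -/

section

variable {k : Type} [Field k] {S : AddSubmonoid ℚ≥0}

/-- The cover of the standard log point with the monoid `S` over the algebraic closure. -/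
noncomputable abbrev hollowCover (k : Type) [Field k] {S : AddSubmonoid ℚ≥0}
    (hS : natMonoid ≤ S) : Over (logPoint k) :=
  Over.mk (hollowMap k (AlgebraicClosure k) hS)

/-- The inverse of the automorphism `g` is given by `(ψ, χ)`. This is the description of the action
of `g` on sections by pull-back along `g⁻¹`. -/
def IsActBy {hS : natMonoid ≤ S} (g : Aut (hollowCover k hS))
    (ψ : AlgebraicClosure k ≃ₐ[k] AlgebraicClosure k)
    (χ : Multiplicative S →* (AlgebraicClosure k)ˣ) : Prop :=
  IsGivenBy (K := AlgebraicClosure k) (S := S) (T := S) le_rfl g.inv.left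
    (ψ : AlgebraicClosure k →ₐ[k] AlgebraicClosure k) χ

theorem IsActBy.eq {hS : natMonoid ≤ S} {g g' : Aut (hollowCover k hS)}
    {ψ : AlgebraicClosure k ≃ₐ[k] AlgebraicClosure k}
    {χ : Multiplicative S →* (AlgebraicClosure k)ˣ} (h : IsActBy g ψ χ) (h' : IsActBy g' ψ χ) :
    g = g' :=
  Iso.ext_inv (Over.OverMorphism.ext (IsGivenBy.eq h h'))

theorem IsActBy.unique {hS : natMonoid ≤ S} {g : Aut (hollowCover k hS)}
    {ψ ψ' : AlgebraicClosure k ≃ₐ[k] AlgebraicClosure k}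
    {χ χ' : Multiplicative S →* (AlgebraicClosure k)ˣ} (h : IsActBy g ψ χ) (h' : IsActBy g ψ' χ') :
    ψ = ψ' ∧ χ = χ' := by
  obtain ⟨h1, h2⟩ := IsGivenBy.unique h h'
  exact ⟨AlgEquiv.coe_toAlgHom_injective h1, h2⟩

theorem exists_isActBy {hS : natMonoid ≤ S} (g : Aut (hollowCover k hS)) :
    ∃ ψ χ, IsActBy g ψ χ ∧ χ (oneElt hS) = 1 := by
  obtain ⟨ψ, χ, h, h1⟩ := exists_isGivenBy hS hS le_rfl g.inv.left (Over.w g.inv)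
  refine ⟨AlgEquiv.ofBijective ψ (Algebra.IsAlgebraic.algHom_bijective ψ), χ, ?_, h1⟩
  exact h

theorem exists_aut_isActBy (hS : natMonoid ≤ S)
    (ψ : AlgebraicClosure k ≃ₐ[k] AlgebraicClosure k)
    (χ : Multiplicative S →* (AlgebraicClosure k)ˣ) (hχ : χ (oneElt hS) = 1) :
    ∃ g : Aut (hollowCover k hS), IsActBy g ψ χ := by
  let χ' : Multiplicative S →* (AlgebraicClosure k)ˣ :=
    ((Units.map ((ψ.symm : AlgebraicClosure k →ₐ[k] AlgebraicClosure k) :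
      AlgebraicClosure k →* AlgebraicClosure k)).comp χ)⁻¹
  have hχ' : χ' (oneElt hS) = 1 := by
    rw [MonoidHom.inv_apply, MonoidHom.comp_apply, hχ, map_one, inv_one]
  obtain ⟨f, hf, hfψ⟩ := exists_hom_isGivenBy hS hS le_rfl
    (ψ : AlgebraicClosure k →ₐ[k] AlgebraicClosure k) χ hχ
  obtain ⟨f', hf', hfψ'⟩ := exists_hom_isGivenBy hS hS le_rfl
    (ψ.symm : AlgebraicClosure k →ₐ[k] AlgebraicClosure k) χ' hχ'
  have h1 : f' ≫ f = 𝟙 _ := by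
    refine IsGivenBy.eq ?_ (IsGivenBy.id (k := k) le_rfl)
    convert hfψ'.comp hfψ using 1
    · refine AlgHom.ext fun x => ?_
      exact (ψ.symm_apply_apply x).symm
    · refine MonoidHom.ext fun r => ?_
      exact (mul_inv_cancel _).symm
  have h2 : f ≫ f' = 𝟙 _ := by
    refine IsGivenBy.eq ?_ (IsGivenBy.id (k := k) le_rfl)
    convert hfψ.comp hfψ' using 1
    · refine AlgHom.ext fun x => ?_
      exact (ψ.apply_symm_apply x).symm
    · refine MonoidHom.ext fun r => Units.ext ?_
      have h3 : ψ (((χ' r)⁻¹ : (AlgebraicClosure k)ˣ) : AlgebraicClosure k) = χ r := by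
        rw [MonoidHom.inv_apply, inv_inv]
        exact ψ.apply_symm_apply _
      change (1 : AlgebraicClosure k) = ψ (χ' r) * χ r
      rw [← h3, ← map_mul, Units.mul_inv, map_one]
  exact ⟨⟨Over.homMk f' hf', Over.homMk f hf, Over.OverMorphism.ext h1,
    Over.OverMorphism.ext h2⟩, hfψ⟩

theorem IsActBy.mul {hS : natMonoid ≤ S} {g g' : Aut (hollowCover k hS)}
    {ψ ψ' : AlgebraicClosure k ≃ₐ[k] AlgebraicClosure k}
    {χ χ' : Multiplicative S →* (AlgebraicClosure k)ˣ} (h : IsActBy g ψ χ) (h' : IsActBy g' ψ' χ') :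
    IsActBy (g * g') (ψ * ψ') ((Units.map ((ψ : AlgebraicClosure k →ₐ[k] AlgebraicClosure k) :
      AlgebraicClosure k →* AlgebraicClosure k)).comp χ' * χ) := by
  have h1 := IsGivenBy.comp h h'
  have h2 : χ.comp (AddMonoidHom.toMultiplicative (AddSubmonoid.inclusion le_rfl)) = χ :=
    MonoidHom.ext fun r => rfl
  rw [h2] at h1
  exact h1

theorem IsActBy.one {hS : natMonoid ≤ S} : IsActBy (1 : Aut (hollowCover k hS)) 1 1 :=
  IsGivenBy.id le_rfl

end

theorem IsPointOf.pow_eq_one {k : Type} [Field k] [Finite k] {L : Type} [Field L] [Algebra k L]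
    {m : ℕ} {hm : (m : k) ≠ 0} {y : kumPoint k ⟶ truncLog L m}
    {τ : L →ₐ[k] AlgebraicClosure k} {ζ : (AlgebraicClosure k)ˣ} (h : IsPointOf hm y τ ζ)
    (hy : y ≫ truncMap k L m = kumPointMap k) : ζ ^ m = 1 := by
  have h2 := congrArg (fun z => globalFlat z (hollowSec 1 (natElt 1))) hy
  simp only [globalFlat_comp, globalFlat_hollowMap, globalFlat_truncMap, map_one] at h2
  have h3 := (hollowSec_inj ((h.2 _).symm.trans h2)).1
  rwa [mul_one] at h3

/-! ### The fundamental group acts through automorphisms of the universal cover -/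

section

variable {k : Type} [Field k] [Finite k]

/-- The standard cover given by a finite extension `L` of `k` in the algebraic closure and an
index `m` prime to the characteristic. -/
noncomputable def stdCov (L : IntermediateField k (AlgebraicClosure k)) [FiniteDimensional k L]
    {m : ℕ} (hm : (m : k) ≠ 0) : KCov (logPoint k) :=
  ⟨truncCover k L m, isFiniteKummerEtale_truncCover hm⟩

theorem exists_stdPt (L : IntermediateField k (AlgebraicClosure k))
    {m : ℕ} (hm : (m : k) ≠ 0) : ∃ y : kumCover k ⟶ truncCover k L m,
      IsPointOf hm y.left L.val 1 := by
  obtain ⟨y, hy, hy'⟩ := exists_truncPoint hm L.val 1 (one_pow m)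
  exact ⟨Over.homMk y hy, hy'⟩

/-- The standard point of a standard cover over the log geometric point. -/
noncomputable def stdPt (L : IntermediateField k (AlgebraicClosure k)) [FiniteDimensional k L]
    {m : ℕ} (hm : (m : k) ≠ 0) : (Fib (kumCover k)).obj (stdCov L hm) :=
  (exists_stdPt L hm).choose

/-- The point `y` of a standard cover, in the fibre of the log geometric point, is given by the
embedding `τ` and the element `ζ`. -/
def IsFibPt {L : IntermediateField k (AlgebraicClosure k)} [FiniteDimensional k L]
    {m : ℕ} {hm : (m : k) ≠ 0} (y : (Fib (kumCover k)).obj (stdCov L hm))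
    (τ : L →ₐ[k] AlgebraicClosure k) (ζ : (AlgebraicClosure k)ˣ) : Prop :=
  IsPointOf hm (show kumCover k ⟶ truncCover k L m from y).left τ ζ

theorem isFibPt_stdPt (L : IntermediateField k (AlgebraicClosure k)) [FiniteDimensional k L]
    {m : ℕ} (hm : (m : k) ≠ 0) : IsFibPt (stdPt L hm) L.val 1 := (exists_stdPt L hm).choose_spec

section

variable {L : IntermediateField k (AlgebraicClosure k)} [FiniteDimensional k L]
  {m : ℕ} {hm : (m : k) ≠ 0}

theorem IsFibPt.eq {y y' : (Fib (kumCover k)).obj (stdCov L hm)}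
    {τ : L →ₐ[k] AlgebraicClosure k} {ζ : (AlgebraicClosure k)ˣ} (h : IsFibPt y τ ζ)
    (h' : IsFibPt y' τ ζ) : y = y' :=
  Over.OverMorphism.ext (IsPointOf.eq h h')

theorem IsFibPt.unique {y : (Fib (kumCover k)).obj (stdCov L hm)}
    {τ τ' : L →ₐ[k] AlgebraicClosure k} {ζ ζ' : (AlgebraicClosure k)ˣ} (h : IsFibPt y τ ζ)
    (h' : IsFibPt y τ' ζ') : τ = τ' ∧ ζ = ζ' := IsPointOf.unique h h'

theorem exists_isFibPt (y : (Fib (kumCover k)).obj (stdCov L hm)) : ∃ τ ζ, IsFibPt y τ ζ :=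
  exists_isPointOf hm _ (Over.w (show kumCover k ⟶ truncCover k L m from y))

theorem IsFibPt.pow_eq_one {y : (Fib (kumCover k)).obj (stdCov L hm)}
    {τ : L →ₐ[k] AlgebraicClosure k} {ζ : (AlgebraicClosure k)ˣ} (h : IsFibPt y τ ζ) :
    ζ ^ m = 1 :=
  IsPointOf.pow_eq_one h (Over.w (show kumCover k ⟶ truncCover k L m from y))

/-- The action of the automorphism `g` of the log geometric point on a standard cover. -/
theorem IsFibPt.deck {y : (Fib (kumCover k)).obj (stdCov L hm)}
    {τ : L →ₐ[k] AlgebraicClosure k} {ζ : (AlgebraicClosure k)ˣ} (h : IsFibPt y τ ζ)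
    {g : Aut (kumCover k)} {ψ : AlgebraicClosure k ≃ₐ[k] AlgebraicClosure k}
    {χ : Multiplicative (kumMonoid k) →* (AlgebraicClosure k)ˣ}
    (hg : IsActBy (hS := natMonoid_le_kumMonoid k) g ψ χ) :
    IsFibPt ((LogScheme.deck (kumCover k) g).act _ y)
      ((ψ : AlgebraicClosure k →ₐ[k] AlgebraicClosure k).comp τ)
      (Units.map ((ψ : AlgebraicClosure k →ₐ[k] AlgebraicClosure k) :
        AlgebraicClosure k →* AlgebraicClosure k) ζ * χ (kumFrac hm (Multiplicative.ofAdd 1))) :=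
  IsPointOf.comp h hg

end

theorem exists_stdCov_hom {L L' : IntermediateField k (AlgebraicClosure k)} [FiniteDimensional k L]
    [FiniteDimensional k L'] (hL : L ≤ L') {m m' d : ℕ} (hd : m' = m * d) (hm : (m : k) ≠ 0)
    (hm' : (m' : k) ≠ 0) :
    ∃ F : stdCov L' hm' ⟶ stdCov L hm, ∀ y τ ζ, IsFibPt y τ ζ →
      IsFibPt ((Fib (kumCover k)).map F y) (τ.comp (IntermediateField.inclusion hL)) (ζ ^ d) := by
  obtain ⟨F, hF, hF'⟩ := exists_truncTrans (IntermediateField.inclusion hL) hd hm hm'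
  exact ⟨ObjectProperty.homMk (Over.homMk F hF), fun y τ ζ h => hF' _ τ ζ h⟩

theorem LogScheme.LogPi1.act_map {X : LogScheme} {s : Over X} (σ : LogPi1 s) {Y Y' : KCov X}
    (F : Y ⟶ Y') (y : (Fib s).obj Y) : σ.act Y' ((Fib s).map F y) = (Fib s).map F (σ.act Y y) :=
  congrArg (fun z => z y) (σ.hom.naturality F)

theorem exists_act_stdPt (σ : LogPi1 (kumCover k)) :
    ∃ (ψ : AlgebraicClosure k ≃ₐ[k] AlgebraicClosure k)
      (χ : Multiplicative (kumMonoid k) →* (AlgebraicClosure k)ˣ),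
      χ (oneElt (natMonoid_le_kumMonoid k)) = 1 ∧
      ∀ (L : IntermediateField k (AlgebraicClosure k)) (_ : FiniteDimensional k L) (m : ℕ)
        (hm : (m : k) ≠ 0), IsFibPt (σ.act _ (stdPt L hm))
          ((ψ : AlgebraicClosure k →ₐ[k] AlgebraicClosure k).comp L.val)
          (χ (kumFrac hm (Multiplicative.ofAdd 1))) := by
  let K := AlgebraicClosure k
  choose τ ζ h using fun (L : IntermediateField k K) (_ : FiniteDimensional k L) (m : ℕ)
    (hm : (m : k) ≠ 0) => exists_isFibPt (σ.act _ (stdPt L hm))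
  have hcompat : ∀ (L L' : IntermediateField k K) (hf : FiniteDimensional k L)
      (hf' : FiniteDimensional k L') (hL : L ≤ L') (m m' d : ℕ) (hd : m' = m * d)
      (hm : (m : k) ≠ 0) (hm' : (m' : k) ≠ 0),
      (τ L' hf' m' hm').comp (IntermediateField.inclusion hL) = τ L hf m hm ∧
      ζ L' hf' m' hm' ^ d = ζ L hf m hm := by
    intro L L' hf hf' hL m m' d hd hm hm'
    obtain ⟨F, hF⟩ := exists_stdCov_hom hL hd hm hm'
    have h1 := hF _ _ _ (isFibPt_stdPt L' hm')
    rw [one_pow] at h1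
    have h2 : (Fib (kumCover k)).map F (stdPt L' hm') = stdPt L hm :=
      IsFibPt.eq h1 (isFibPt_stdPt L hm)
    have h3 := hF _ _ _ (h L' hf' m' hm')
    rw [← LogPi1.act_map, h2] at h3
    exact h3.unique (h L hf m hm)
  have h1k : ((1 : ℕ) : k) ≠ 0 := by simp
  have hfin : ∀ x : K, FiniteDimensional k (IntermediateField.adjoin k {x}) := fun x =>
    IntermediateField.adjoin.finiteDimensional (Algebra.IsIntegral.isIntegral x)
  let t : K → K := fun x => τ _ (hfin x) 1 h1k
    ⟨x, IntermediateField.mem_adjoin_simple_self k x⟩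
  have ht : ∀ (L : IntermediateField k K) (hf : FiniteDimensional k L) (m : ℕ) (hm : (m : k) ≠ 0)
      (x : L), τ L hf m hm x = t x := by
    intro L hf m hm x
    have hle : IntermediateField.adjoin k {(x : K)} ≤ L :=
      IntermediateField.adjoin_le_iff.2 (Set.singleton_subset_iff.2 x.2)
    have := (hcompat _ L (hfin x) hf hle 1 m m (one_mul m).symm h1k hm).1
    exact DFunLike.congr_fun this ⟨x, IntermediateField.mem_adjoin_simple_self k (x : K)⟩
  have hsup : ∀ x y : K, ∃ (L : IntermediateField k K) (_ : FiniteDimensional k L),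
      x ∈ L ∧ y ∈ L := by
    intro x y
    have := hfin x
    have := hfin y
    exact ⟨IntermediateField.adjoin k {x} ⊔ IntermediateField.adjoin k {y},
      IntermediateField.finiteDimensional_sup _ _,
      (le_sup_left : IntermediateField.adjoin k {x} ≤ _)
        (IntermediateField.mem_adjoin_simple_self k x),
      (le_sup_right : IntermediateField.adjoin k {y} ≤ _)
        (IntermediateField.mem_adjoin_simple_self k y)⟩
  let ψ : K →ₐ[k] K := AlgHom.mk'
    { toFun := t
      map_one' := by
        obtain ⟨L, hf, -, -⟩ := hsup 0 0
        exact (ht L hf 1 h1k 1).symm.trans (map_one _)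
      map_zero' := by
        obtain ⟨L, hf, -, -⟩ := hsup 0 0
        exact (ht L hf 1 h1k 0).symm.trans (map_zero _)
      map_add' := fun x y => by
        obtain ⟨L, hf, hx, hy⟩ := hsup x y
        have := map_add (τ L hf 1 h1k) ⟨x, hx⟩ ⟨y, hy⟩
        rwa [ht, ht, ht] at this
      map_mul' := fun x y => by
        obtain ⟨L, hf, hx, hy⟩ := hsup x y
        have := map_mul (τ L hf 1 h1k) ⟨x, hx⟩ ⟨y, hy⟩
        rwa [ht, ht, ht] at this } (fun c x => by
        obtain ⟨L, hf, hx, -⟩ := hsup x x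
        have := map_smul (τ L hf 1 h1k) c ⟨x, hx⟩
        rwa [ht, ht] at this)
  obtain ⟨L₀, hL₀, -, -⟩ := hsup 0 0
  let z : ∀ m : ℕ, (m : k) ≠ 0 → Kˣ := fun m hm => ζ L₀ hL₀ m hm
  have hz : ∀ (L : IntermediateField k K) (hf : FiniteDimensional k L) (m : ℕ) (hm : (m : k) ≠ 0),
      ζ L hf m hm = z m hm := by
    intro L hf m hm
    have h1 := (hcompat L (L ⊔ L₀) hf (IntermediateField.finiteDimensional_sup _ _) le_sup_left
      m m 1 (mul_one m).symm hm hm).2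
    have h2 := (hcompat L₀ (L ⊔ L₀) hL₀ (IntermediateField.finiteDimensional_sup _ _) le_sup_right
      m m 1 (mul_one m).symm hm hm).2
    exact h1.symm.trans h2
  let χ₀ : Multiplicative (kumMonoid k) → Kˣ := fun r => z _ r.toAdd.2 ^ (r.toAdd : ℚ≥0).num
  have hχ₀ : ∀ (r : Multiplicative (kumMonoid k)) (m c : ℕ) (hm : (m : k) ≠ 0),
      m = (r.toAdd : ℚ≥0).den * c → χ₀ r = z m hm ^ (c * (r.toAdd : ℚ≥0).num) := by
    intro r m c hm hc
    rw [pow_mul]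
    exact congrArg (fun u => u ^ (r.toAdd : ℚ≥0).num)
      (hcompat L₀ L₀ hL₀ hL₀ le_rfl _ m c hc r.toAdd.2 hm).2.symm
  have hχ₁ : ∀ (m : ℕ) (hm : (m : k) ≠ 0) (j : ℕ),
      χ₀ (kumFrac hm (Multiplicative.ofAdd j)) = z m hm ^ j := by
    intro m hm j
    let r := kumFrac hm (Multiplicative.ofAdd j)
    have h1 : (r.toAdd : ℚ≥0).den ∣ m := by
      have h2 := Rat.den_dvd (j : ℤ) (m : ℤ)
      have h3 : (((r.toAdd : ℚ≥0) : ℚ)) = Rat.divInt j m := by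
        rw [Rat.divInt_eq_div, coe_kumFrac hm j]
        push_cast
        rfl
      rw [← NNRat.den_coe, h3]
      exact_mod_cast h2
    obtain ⟨c, hc⟩ := h1
    rw [hχ₀ r m c hm hc]
    congr 1
    exact (Multiplicative.ofAdd.injective (kumFrac_injective hm (eq_kumFrac hm r hc))).symm
  let χ : Multiplicative (kumMonoid k) →* Kˣ :=
    { toFun := χ₀
      map_one' := by
        have := hχ₁ 1 h1k 0
        rwa [ofAdd_zero, map_one, pow_zero] at this
      map_mul' := fun r s => by
        obtain ⟨m, hm, i, j, rfl, rfl⟩ : ∃ (m : ℕ) (hm : (m : k) ≠ 0) (i j : ℕ),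
            r = kumFrac hm (Multiplicative.ofAdd i) ∧ s = kumFrac hm (Multiplicative.ofAdd j) := by
          have hm : (((r.toAdd : ℚ≥0).den * (s.toAdd : ℚ≥0).den : ℕ) : k) ≠ 0 := by
            rw [Nat.cast_mul]
            exact mul_ne_zero r.toAdd.2 s.toAdd.2
          exact ⟨_, hm, _, _, eq_kumFrac hm r rfl, eq_kumFrac hm s (mul_comm _ _)⟩
        rw [← map_mul, ← ofAdd_add, hχ₁, hχ₁, hχ₁, pow_add] }
  refine ⟨AlgEquiv.ofBijective ψ (Algebra.IsAlgebraic.algHom_bijective ψ), χ, ?_,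
    fun L hf m hm => ?_⟩
  · have h2 : oneElt (natMonoid_le_kumMonoid k) = kumFrac h1k (Multiplicative.ofAdd 1) := by
      refine Multiplicative.toAdd.injective (Subtype.ext ?_)
      refine (coe_oneElt _).trans (Eq.trans ?_ (coe_kumFrac h1k 1).symm)
      simp
    rw [h2]
    refine (hχ₁ 1 h1k 1).trans ?_
    exact (h L₀ hL₀ 1 h1k).pow_eq_one
  · have h2 := h L hf m hm
    have h3 : τ L hf m hm = ψ.comp L.val := AlgHom.ext fun x => ht L hf m hm x
    have h4 : ζ L hf m hm = χ (kumFrac hm (Multiplicative.ofAdd 1)) := by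
      rw [hz]
      exact ((hχ₁ m hm 1).trans (pow_one _)).symm
    rw [h3, h4] at h2
    exact h2

/-- Every point of a cover comes from the standard point of a standard cover. -/
theorem exists_stdPt_map (Y : KCov (logPoint k)) (y : (Fib (kumCover k)).obj Y) :
    ∃ (L : IntermediateField k (AlgebraicClosure k)) (_ : FiniteDimensional k L) (m : ℕ)
      (hm : (m : k) ≠ 0) (F : stdCov L hm ⟶ Y), (Fib (kumCover k)).map F (stdPt L hm) = y := by
  have hfin : IsFinite (Hom.base Y.obj.hom) := Y.property.2.1
  obtain ⟨L, hL, m, hm, F, hF, hF'⟩ := exists_factor_truncPoint Y.obj.hom inferInstance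
    Y.property.2.2.2 (show kumCover k ⟶ Y.obj from y).left
    (Over.w (show kumCover k ⟶ Y.obj from y))
  refine ⟨L, hL, m, hm, ObjectProperty.homMk (Over.homMk F hF), ?_⟩
  have h1 := isFibPt_stdPt L hm
  refine Over.OverMorphism.ext (hF' _ h1.1 fun j => ?_)
  have h2 := h1.2 j
  rwa [powersHom_apply, one_pow] at h2

/-- Every element of the fundamental group is defined by an automorphism of the universal cover. -/
theorem deck_surjective : Function.Surjective (deck (kumCover k)) := by
  intro σ
  obtain ⟨ψ, χ, hχ, h⟩ := exists_act_stdPt σ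
  obtain ⟨g, hg⟩ := exists_aut_isActBy (natMonoid_le_kumMonoid k) ψ χ hχ
  refine ⟨g, ?_⟩
  have key : ∀ (Y : KCov (logPoint k)) (y : (Fib (kumCover k)).obj Y),
      (deck (kumCover k) g).act Y y = σ.act Y y := by
    intro Y y
    obtain ⟨L, hL, m, hm, F, rfl⟩ := exists_stdPt_map Y y
    rw [LogPi1.act_map, LogPi1.act_map]
    congr 1
    have h1 := (isFibPt_stdPt L hm).deck hg
    rw [map_one, one_mul] at h1
    exact h1.eq (h L hL m hm)
  ext Y y
  exact key Y y

end

/-! ### The Galois group of a finite field -/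

theorem zhat_val_modEq (t : Zhat) {m n : ℕ+} (h : (m : ℕ) ∣ n) :
    (t.1 n).val ≡ (t.1 m).val [MOD m] := by
  rw [← ZMod.natCast_eq_natCast_iff, ZMod.natCast_zmod_val, ← t.2 m n h, ZMod.natCast_val,
    ZMod.castHom_apply]

section

variable {k : Type} [Field k] [Finite k]

variable (k) in
/-- The homomorphism `x ↦ x^(q^a)` of the algebraic closure, where `q` is the number of elements
of `k`. -/
noncomputable def frobPow (a : ℕ) : AlgebraicClosure k →ₐ[k] AlgebraicClosure k :=
  letI := Fintype.ofFinite k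
  FiniteField.frobeniusAlgHom k (AlgebraicClosure k) ^ a

theorem frobPow_apply (a : ℕ) (x : AlgebraicClosure k) : frobPow k a x = x ^ Nat.card k ^ a := by
  let := Fintype.ofFinite k
  rw [frobPow, AlgHom.coe_pow, FiniteField.coe_frobeniusAlgHom, pow_iterate,
    Fintype.card_eq_nat_card]

theorem pow_card_pow_eq {M : Type*} [Monoid M] {x : M} {q n : ℕ} (hx : x ^ q ^ n = x) {a b : ℕ}
    (h : a ≡ b [MOD n]) : x ^ q ^ a = x ^ q ^ b := by
  have h1 : Function.IsPeriodicPt (· ^ q) n x := by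
    rw [Function.IsPeriodicPt, Function.IsFixedPt, pow_iterate]
    exact hx
  have h2 : ∀ c, x ^ q ^ c = x ^ q ^ (c % n) := by
    intro c
    have := h1.iterate_mod_apply c
    rw [pow_iterate, pow_iterate] at this
    exact this.symm
  rw [h2 a, h2 b, h]

theorem pow_card_pow_mul {M : Type*} [Monoid M] {x : M} {q n : ℕ} (hx : x ^ q ^ n = x) (m : ℕ) :
    x ^ q ^ (n * m) = x :=
  (pow_card_pow_eq hx (b := 0) ((Nat.modEq_zero_iff_dvd).2 (dvd_mul_right n m))).trans (by simp)

theorem exists_pow_card_pow_of_finiteDimensional (L : IntermediateField k (AlgebraicClosure k))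
    [FiniteDimensional k L] : ∃ n : ℕ+, ∀ x ∈ L, x ^ Nat.card k ^ (n : ℕ) = x := by
  have : Finite L := Module.finite_of_finite k
  have := Fintype.ofFinite L
  refine ⟨⟨Module.finrank k L, Module.finrank_pos⟩, fun x hx => ?_⟩
  have h := FiniteField.pow_card (⟨x, hx⟩ : L)
  rw [Fintype.card_eq_nat_card, Module.natCard_eq_pow_finrank (K := k)] at h
  exact congrArg (fun z : L => (z : AlgebraicClosure k)) h

theorem exists_pow_card_pow (x : AlgebraicClosure k) : ∃ n : ℕ+, x ^ Nat.card k ^ (n : ℕ) = x := by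
  have := IntermediateField.adjoin.finiteDimensional (K := k) (Algebra.IsIntegral.isIntegral x)
  obtain ⟨n, hn⟩ := exists_pow_card_pow_of_finiteDimensional (IntermediateField.adjoin k {x})
  exact ⟨n, hn x (IntermediateField.mem_adjoin_simple_self k x)⟩

theorem exists_pow_card_pow₂ (x y : AlgebraicClosure k) :
    ∃ n : ℕ+, x ^ Nat.card k ^ (n : ℕ) = x ∧ y ^ Nat.card k ^ (n : ℕ) = y := by
  obtain ⟨n, hn⟩ := exists_pow_card_pow x
  obtain ⟨m, hm⟩ := exists_pow_card_pow y
  exact ⟨n * m, pow_card_pow_mul hn m, by rw [PNat.mul_coe, mul_comm]; exact pow_card_pow_mul hm n⟩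

/-- The power `x^(q^t)` of an element `x` of the algebraic closure for `t` in the profinite
integers. -/
noncomputable def zhatPow (t : Zhat) (x : AlgebraicClosure k) : AlgebraicClosure k :=
  frobPow k (t.1 (exists_pow_card_pow x).choose).val x

theorem zhatPow_eq (t : Zhat) {x : AlgebraicClosure k} {n : ℕ+}
    (hx : x ^ Nat.card k ^ (n : ℕ) = x) : zhatPow t x = frobPow k (t.1 n).val x := by
  rw [zhatPow]
  set n' := (exists_pow_card_pow x).choose
  have hx' : x ^ Nat.card k ^ (n' : ℕ) = x := (exists_pow_card_pow x).choose_spec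
  rw [frobPow_apply, frobPow_apply,
    ← pow_card_pow_eq hx' (zhat_val_modEq t (n := n' * n) (dvd_mul_right (n' : ℕ) n)),
    ← pow_card_pow_eq hx (zhat_val_modEq t (n := n' * n) (dvd_mul_left (n : ℕ) n'))]

theorem frobPow_pow_card_pow {x : AlgebraicClosure k} {n : ℕ}
    (hx : x ^ Nat.card k ^ n = x) (a : ℕ) :
    frobPow k a x ^ Nat.card k ^ n = frobPow k a x := by
  rw [← map_pow, hx]

variable (k) in
/-- The automorphism `x ↦ x^(q^t)` of the algebraic closure, for a profinite integer `t`, as an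
endomorphism. -/
noncomputable def frobZHom (t : Zhat) : AlgebraicClosure k →ₐ[k] AlgebraicClosure k where
  toFun := zhatPow t
  map_one' := (zhatPow_eq (n := 1) t (one_pow _)).trans (map_one _)
  map_zero' := (zhatPow_eq (n := 1) t (zero_pow (pow_ne_zero _ Nat.card_pos.ne'))).trans (map_zero _)
  map_add' x y := by
    obtain ⟨n, hx, hy⟩ := exists_pow_card_pow₂ x y
    have h : (x + y) ^ Nat.card k ^ (n : ℕ) = x + y := by
      have := map_add (frobPow k n) x y
      rwa [frobPow_apply, frobPow_apply, frobPow_apply, hx, hy] at this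
    rw [zhatPow_eq t hx, zhatPow_eq t hy, zhatPow_eq t h, map_add]
  map_mul' x y := by
    obtain ⟨n, hx, hy⟩ := exists_pow_card_pow₂ x y
    rw [zhatPow_eq t hx, zhatPow_eq t hy, zhatPow_eq t ((mul_pow _ _ _).trans (congrArg₂ _ hx hy)),
      map_mul]
  commutes' c := by
    have h : (algebraMap k (AlgebraicClosure k) c) ^ Nat.card k ^ ((1 : ℕ+) : ℕ) =
        algebraMap k (AlgebraicClosure k) c :=
      (frobPow_apply 1 _).symm.trans ((frobPow k 1).commutes c)
    rw [zhatPow_eq t h]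
    exact AlgHom.commutes _ c

variable (k) in
/-- The action of the profinite integers on the algebraic closure: `t` acts as `x ↦ x^(q^t)`. -/
noncomputable def frobZ :
    Multiplicative Zhat →* (AlgebraicClosure k ≃ₐ[k] AlgebraicClosure k) where
  toFun t := AlgEquiv.ofBijective (frobZHom k t.toAdd) (Algebra.IsAlgebraic.algHom_bijective _)
  map_one' := by
    refine AlgEquiv.ext fun x => ?_
    obtain ⟨n, hn⟩ := exists_pow_card_pow x
    refine (zhatPow_eq 0 hn).trans ?_
    rw [frobPow_apply]
    change x ^ Nat.card k ^ (0 : ZMod n).val = x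
    rw [ZMod.val_zero, pow_zero, pow_one]
  map_mul' s t := by
    refine AlgEquiv.ext fun x => ?_
    obtain ⟨n, hn⟩ := exists_pow_card_pow x
    change zhatPow (s.toAdd + t.toAdd) x = zhatPow s.toAdd (zhatPow t.toAdd x)
    rw [zhatPow_eq t.toAdd hn, zhatPow_eq s.toAdd (frobPow_pow_card_pow hn _), zhatPow_eq _ hn,
      frobPow_apply, frobPow_apply, frobPow_apply, ← pow_mul, ← pow_add]
    refine pow_card_pow_eq hn ?_
    change ((s.toAdd.1 n + t.toAdd.1 n : ZMod n)).val ≡ _ [MOD n]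
    rw [ZMod.val_add, add_comm (t.toAdd.1 n).val]
    exact Nat.mod_modEq _ _

theorem frobZ_apply (t : Multiplicative Zhat) {x : AlgebraicClosure k} {n : ℕ+}
    (hx : x ^ Nat.card k ^ (n : ℕ) = x) :
    frobZ k t x = x ^ Nat.card k ^ (t.toAdd.1 n).val :=
  (zhatPow_eq _ hx).trans (frobPow_apply _ _)

theorem exists_primitiveRoot_card_pow_sub_one (n : ℕ+) :
    ∃ ζ : AlgebraicClosure k, IsPrimitiveRoot ζ (Nat.card k ^ (n : ℕ) - 1) ∧
      ζ ^ Nat.card k ^ (n : ℕ) = ζ := by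
  have h1 : 1 < Nat.card k ^ (n : ℕ) := Nat.one_lt_pow n.ne_zero Finite.one_lt_card
  have h2 : ((Nat.card k ^ (n : ℕ) - 1 : ℕ) : k) ≠ 0 := by
    have := Fintype.ofFinite k
    rw [Nat.cast_sub h1.le, Nat.cast_pow, Nat.card_eq_fintype_card, FiniteField.cast_card_eq_zero,
      zero_pow n.ne_zero]
    simp
  have : NeZero ((Nat.card k ^ (n : ℕ) - 1 : ℕ) : AlgebraicClosure k) := by
    refine ⟨fun h => h2 ?_⟩
    rw [← map_natCast (algebraMap k (AlgebraicClosure k))] at h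
    exact (map_eq_zero _).1 h
  have : NeZero (Nat.card k ^ (n : ℕ) - 1) := ⟨by omega⟩
  obtain ⟨ζ, hζ⟩ := HasEnoughRootsOfUnity.exists_primitiveRoot (AlgebraicClosure k)
    (Nat.card k ^ (n : ℕ) - 1)
  refine ⟨ζ, hζ, ?_⟩
  conv_lhs => rw [← Nat.sub_add_cancel h1.le]
  rw [pow_succ, hζ.pow_eq_one, one_mul]

theorem pow_card_pow_injective {ζ : AlgebraicClosure k} {n : ℕ}
    (hζ : IsPrimitiveRoot ζ (Nat.card k ^ n - 1)) {a b : ℕ} (ha : a < n) (hb : b < n)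
    (h : ζ ^ Nat.card k ^ a = ζ ^ Nat.card k ^ b) : a = b := by
  have hq : 1 < Nat.card k := Finite.one_lt_card
  by_cases h1 : Nat.card k ^ n - 1 = 1
  · -- the exceptional case `q = 2`, `n = 1`
    have : n ≤ 1 := by
      by_contra! h2
      have h3 : 2 ^ 2 ≤ Nat.card k ^ n :=
        (Nat.pow_le_pow_left hq 2).trans (Nat.pow_le_pow_right (by omega) h2)
      omega
    omega
  have hlt : ∀ c < n, Nat.card k ^ c < Nat.card k ^ n - 1 := by
    intro c hc
    have h2 : Nat.card k ^ (c + 1) ≤ Nat.card k ^ n := Nat.pow_le_pow_right (by omega) hc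
    have h3 : Nat.card k ^ c * 2 ≤ Nat.card k ^ c * Nat.card k := Nat.mul_le_mul_left _ hq
    rw [← pow_succ] at h3
    have h4 : 1 ≤ Nat.card k ^ c := Nat.one_le_pow _ _ (by omega)
    by_contra! h5
    have h6 : Nat.card k ^ c = 1 := by omega
    omega
  exact Nat.pow_right_injective hq (hζ.pow_inj (hlt a ha) (hlt b hb) h)

theorem frobZ_injective : Function.Injective (frobZ k) := by
  intro s t h
  refine Multiplicative.toAdd.injective (Subtype.ext (funext fun n => ?_))
  obtain ⟨ζ, hζ, hζ'⟩ := exists_primitiveRoot_card_pow_sub_one (k := k) n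
  have h1 := congrArg (fun z => z ζ) h
  simp only [frobZ_apply _ hζ'] at h1
  exact ZMod.val_injective _ (pow_card_pow_injective hζ (ZMod.val_lt _) (ZMod.val_lt _) h1)

theorem exists_aut_eq_pow (σ : AlgebraicClosure k ≃ₐ[k] AlgebraicClosure k) (n : ℕ+) :
    ∃ a : ZMod n, ∀ x : AlgebraicClosure k, x ^ Nat.card k ^ (n : ℕ) = x →
      σ x = x ^ Nat.card k ^ a.val := by
  have := Fintype.ofFinite k
  obtain ⟨ζ, hζ, hζ'⟩ := exists_primitiveRoot_card_pow_sub_one (k := k) n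
  let E := IntermediateField.adjoin k {ζ}
  have : FiniteDimensional k E :=
    IntermediateField.adjoin.finiteDimensional (Algebra.IsIntegral.isIntegral ζ)
  have : Finite E := Module.finite_of_finite k
  obtain ⟨i, hi⟩ := (FiniteField.bijective_frobeniusAlgEquivOfAlgebraic_pow k E).2
    (σ.restrictNormal E)
  let z : E := ⟨ζ, IntermediateField.mem_adjoin_simple_self k ζ⟩
  have h1 : σ ζ = ζ ^ Nat.card k ^ (i : ℕ) := by
    have h2 := σ.restrictNormal_commutes E z
    rw [← hi] at h2
    refine h2.symm.trans ?_
    rw [AlgEquiv.coe_pow, FiniteField.coe_frobeniusAlgEquivOfAlgebraic_iterate,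
      Fintype.card_eq_nat_card]
    rfl
  refine ⟨(i : ℕ), fun x hx => ?_⟩
  have hq : 1 < Nat.card k := Finite.one_lt_card
  have h0 : 1 < Nat.card k ^ (n : ℕ) := Nat.one_lt_pow n.ne_zero hq
  have h3 : ∀ y : AlgebraicClosure k, y ^ Nat.card k ^ (n : ℕ) = y →
      y ^ Nat.card k ^ ((i : ℕ) : ZMod n).val = y ^ Nat.card k ^ (i : ℕ) := by
    intro y hy
    refine pow_card_pow_eq hy ?_
    rw [← ZMod.natCast_eq_natCast_iff, ZMod.natCast_zmod_val]
  rw [h3 x hx]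
  rcases eq_or_ne x 0 with rfl | hx0
  · rw [map_zero, zero_pow (pow_ne_zero _ (by omega))]
  · have h4 : x ^ (Nat.card k ^ (n : ℕ) - 1) = 1 := by
      refine mul_right_cancel₀ hx0 ?_
      rw [← pow_succ, Nat.sub_add_cancel h0.le, hx, one_mul]
    have : NeZero (Nat.card k ^ (n : ℕ) - 1) := ⟨by omega⟩
    obtain ⟨j, -, rfl⟩ := hζ.eq_pow_of_pow_eq_one h4
    rw [map_pow, h1, ← pow_mul, ← pow_mul, mul_comm]

theorem frobZ_surjective : Function.Surjective (frobZ k) := by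
  intro σ
  choose a ha using exists_aut_eq_pow σ
  have hmem : a ∈ Zhat := by
    intro m n h
    obtain ⟨ζ, hζ, hζ'⟩ := exists_primitiveRoot_card_pow_sub_one (k := k) m
    obtain ⟨c, hc⟩ := h
    have hn : ζ ^ Nat.card k ^ (n : ℕ) = ζ := by
      rw [hc]
      exact pow_card_pow_mul hζ' c
    have h1 := (ha n ζ hn).symm.trans (ha m ζ hζ')
    have h2 : (a n).val ≡ (ZMod.castHom ⟨c, hc⟩ (ZMod m) (a n)).val [MOD m] := by
      rw [← ZMod.natCast_eq_natCast_iff, ZMod.natCast_zmod_val, ZMod.natCast_val,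
        ZMod.castHom_apply]
    rw [pow_card_pow_eq hζ' h2] at h1
    exact ZMod.val_injective _ (pow_card_pow_injective hζ (ZMod.val_lt _) (ZMod.val_lt _) h1)
  refine ⟨Multiplicative.ofAdd ⟨a, hmem⟩, AlgEquiv.ext fun x => ?_⟩
  obtain ⟨n, hn⟩ := exists_pow_card_pow x
  rw [frobZ_apply _ hn, ha n x hn]
  rfl

end

/-! ### Characters of the monoids of rational numbers -/

/-- The multiplicative group of an algebraically closed field is divisible, so every element is the
value at `1/d` of a homomorphism from the rational numbers. -/
theorem exists_monoidHom_rat {K : Type*} [Field K] [IsAlgClosed K] (c : Kˣ) {d : ℕ} (hd : d ≠ 0) :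
    ∃ E : Multiplicative ℚ →* Kˣ, E (Multiplicative.ofAdd ((d : ℚ)⁻¹)) = c := by
  let : DivisibleBy (Additive Kˣ) ℕ := divisibleByOfSMulRightSurj _ _ fun {n} hn x => by
    obtain ⟨z, hz⟩ := IsAlgClosed.exists_pow_nat_eq (x.toMul : K) (Nat.pos_of_ne_zero hn)
    have hz0 : z ≠ 0 := by
      rintro rfl
      rw [zero_pow hn] at hz
      exact x.toMul.ne_zero hz.symm
    exact ⟨Additive.ofMul (Units.mk0 z hz0), Additive.toMul.injective (Units.ext hz)⟩
  let : DivisibleBy (Additive Kˣ) ℤ := AddGroup.divisibleByIntOfDivisibleByNat _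
  have hd' : (d : ℚ)⁻¹ ≠ 0 := inv_ne_zero (Nat.cast_ne_zero.2 hd)
  obtain ⟨E, hE⟩ := (Module.Baer.of_divisible (Additive Kˣ)).extension_property_addMonoidHom
    (zmultiplesHom ℚ (d : ℚ)⁻¹)
    (fun a b h => by
      have h' : a • (d : ℚ)⁻¹ = b • (d : ℚ)⁻¹ := h
      rw [zsmul_eq_mul, zsmul_eq_mul] at h'
      exact_mod_cast mul_right_cancel₀ hd' h')
    (zmultiplesHom _ (Additive.ofMul c))
  refine ⟨AddMonoidHom.toMultiplicativeLeft E, ?_⟩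
  have := DFunLike.congr_fun hE 1
  simp only [AddMonoidHom.comp_apply, zmultiplesHom_apply, one_zsmul] at this
  exact congrArg Additive.toMul this

section

variable {k : Type} [Field k] [Finite k]

theorem card_sub_one_ne_zero : Nat.card k - 1 ≠ 0 := by
  have := Finite.one_lt_card (α := k)
  omega

theorem card_sub_one_cast_ne_zero : ((Nat.card k - 1 : ℕ) : k) ≠ 0 := by
  have := Fintype.ofFinite k
  rw [Nat.cast_sub Finite.one_lt_card.le, Nat.card_eq_fintype_card,
    FiniteField.cast_card_eq_zero]
  simp

theorem ofAdd_abElt (m : ℕ) :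
    Multiplicative.ofAdd (abElt k m) = Multiplicative.ofAdd (abElt k 1) ^ m := by
  refine Multiplicative.toAdd.injective (Subtype.ext ?_)
  rw [toAdd_pow, AddSubmonoidClass.coe_nsmul]
  change m • _ = m • (1 • _)
  rw [one_nsmul]

theorem exists_eq_abElt (r : Multiplicative (abMonoid k)) :
    ∃ m : ℕ, r = Multiplicative.ofAdd (abElt k m) := by
  obtain ⟨m, hm⟩ := r.toAdd.2
  exact ⟨m, Multiplicative.toAdd.injective (Subtype.ext hm.symm)⟩

theorem abMonoid_hom_ext {M : Type*} [Monoid M] {χ χ' : Multiplicative (abMonoid k) →* M}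
    (h : χ (Multiplicative.ofAdd (abElt k 1)) = χ' (Multiplicative.ofAdd (abElt k 1))) :
    χ = χ' := by
  refine MonoidHom.ext fun r => ?_
  obtain ⟨m, rfl⟩ := exists_eq_abElt r
  rw [ofAdd_abElt, map_pow, map_pow, h]

theorem oneElt_eq_abElt :
    oneElt (natMonoid_le_abMonoid k) = Multiplicative.ofAdd (abElt k (Nat.card k - 1)) := by
  refine Multiplicative.toAdd.injective (Subtype.ext ((coe_oneElt _).trans ?_))
  change (1 : ℚ≥0) = (Nat.card k - 1) • ((Nat.card k - 1 : ℕ) : ℚ≥0)⁻¹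
  rw [nsmul_eq_mul, mul_inv_cancel₀]
  exact_mod_cast card_sub_one_ne_zero

theorem inclusion_abElt_one :
    AddMonoidHom.toMultiplicative (AddSubmonoid.inclusion (abMonoid_le_kumMonoid k))
      (Multiplicative.ofAdd (abElt k 1)) =
    kumFrac (card_sub_one_cast_ne_zero (k := k)) (Multiplicative.ofAdd 1) := by
  refine Multiplicative.toAdd.injective (Subtype.ext ?_)
  refine Eq.trans ?_ (coe_kumFrac card_sub_one_cast_ne_zero 1).symm
  change 1 • ((Nat.card k - 1 : ℕ) : ℚ≥0)⁻¹ = _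
  rw [one_nsmul, Nat.cast_one, one_div]

/-- Every element of the multiplicative group of the algebraic closure is the value at `1/(q-1)` of
a homomorphism from `ℕ_(p)`. -/
theorem exists_kumMonoid_hom (c : (AlgebraicClosure k)ˣ) :
    ∃ χ : Multiplicative (kumMonoid k) →* (AlgebraicClosure k)ˣ,
      χ (kumFrac (card_sub_one_cast_ne_zero (k := k)) (Multiplicative.ofAdd 1)) = c := by
  obtain ⟨E, hE⟩ := exists_monoidHom_rat c (card_sub_one_ne_zero (k := k))
  let i : kumMonoid k →+ ℚ := (NNRat.coeHom : ℚ≥0 →+* ℚ).toAddMonoidHom.comp (kumMonoid k).subtype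
  refine ⟨E.comp (AddMonoidHom.toMultiplicative i), ?_⟩
  rw [← hE]
  refine congrArg E (Multiplicative.toAdd.injective ?_)
  change (((kumFrac (card_sub_one_cast_ne_zero (k := k)) (Multiplicative.ofAdd 1)).toAdd : ℚ≥0) : ℚ)
    = ((Nat.card k - 1 : ℕ) : ℚ)⁻¹
  rw [coe_kumFrac card_sub_one_cast_ne_zero 1, Nat.cast_one, one_div, NNRat.cast_inv,
    NNRat.cast_natCast]

theorem exists_abMonoid_hom (c : (AlgebraicClosure k)ˣ) :
    ∃ χ : Multiplicative (abMonoid k) →* (AlgebraicClosure k)ˣ,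
      χ (Multiplicative.ofAdd (abElt k 1)) = c := by
  obtain ⟨χ, hχ⟩ := exists_kumMonoid_hom c
  refine ⟨χ.comp (AddMonoidHom.toMultiplicative
    (AddSubmonoid.inclusion (abMonoid_le_kumMonoid k))), ?_⟩
  rw [MonoidHom.comp_apply, inclusion_abElt_one, hχ]

/-- The homomorphism from `(1/(q-1)) ℕ` with value `c` at `1/(q-1)`. -/
noncomputable def abChar (c : (AlgebraicClosure k)ˣ) :
    Multiplicative (abMonoid k) →* (AlgebraicClosure k)ˣ := (exists_abMonoid_hom c).choose

theorem abChar_abElt (c : (AlgebraicClosure k)ˣ) (m : ℕ) :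
    abChar c (Multiplicative.ofAdd (abElt k m)) = c ^ m := by
  rw [ofAdd_abElt, map_pow]
  exact congrArg (· ^ m) (exists_abMonoid_hom c).choose_spec

theorem abChar_oneElt_eq_one (c : (AlgebraicClosure k)ˣ) :
    abChar c (oneElt (natMonoid_le_abMonoid k)) = c ^ (Nat.card k - 1) := by
  rw [oneElt_eq_abElt, abChar_abElt]

variable (k) in
/-- The embedding of the units of `k` in the units of the algebraic closure. -/
noncomputable abbrev unitsIncl : kˣ →* (AlgebraicClosure k)ˣ :=
  Units.map (algebraMap k (AlgebraicClosure k)).toMonoidHom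

theorem unitsIncl_injective : Function.Injective (unitsIncl k) :=
  Units.map_injective (algebraMap k (AlgebraicClosure k)).injective

theorem units_pow_card_sub_one (u : kˣ) : u ^ (Nat.card k - 1) = 1 := by
  have := Fintype.ofFinite k
  refine Units.ext ?_
  rw [Units.val_pow_eq_pow_val, Nat.card_eq_fintype_card]
  exact FiniteField.pow_card_sub_one_eq_one _ u.ne_zero

theorem map_unitsIncl (ψ : AlgebraicClosure k →ₐ[k] AlgebraicClosure k) (u : kˣ) :
    Units.map (ψ : AlgebraicClosure k →* AlgebraicClosure k) (unitsIncl k u) = unitsIncl k u :=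
  Units.ext (ψ.commutes u)

/-- The group of `(q-1)`-th roots of unity in the algebraic closure is `kˣ`. -/
theorem exists_unitsIncl_eq {c : (AlgebraicClosure k)ˣ} (hc : c ^ (Nat.card k - 1) = 1) :
    ∃ u, unitsIncl k u = c := by
  have h1 : (c : AlgebraicClosure k) ^ Nat.card k ^ ((1 : ℕ+) : ℕ) = c := by
    rw [← Units.val_pow_eq_pow_val, PNat.one_coe, pow_one]
    conv_lhs => rw [← Nat.sub_add_cancel (Finite.one_lt_card (α := k)).le]
    rw [pow_succ, hc, one_mul]
  obtain ⟨a, ha⟩ := (InfiniteGalois.mem_range_algebraMap_iff_fixed (k := k)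
    (c : AlgebraicClosure k)).2 fun σ => by
      obtain ⟨b, hb⟩ := exists_aut_eq_pow σ 1
      refine (hb _ h1).trans ?_
      have : b.val = 0 := Nat.lt_one_iff.1 (ZMod.val_lt b)
      rw [this, pow_zero, pow_one]
  have ha0 : a ≠ 0 := by
    rintro rfl
    rw [map_zero] at ha
    exact c.ne_zero ha.symm
  exact ⟨Units.mk0 a ha0, Units.ext ha⟩

/-! ### The automorphisms of the universal abelian Kummer cover -/

variable (k) in
theorem exists_gamma (z : kˣ × Multiplicative Zhat) :
    ∃ g : Aut (abCover k), IsActBy (hS := natMonoid_le_abMonoid k) g (frobZ k z.2)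
      (abChar (unitsIncl k z.1)) := by
  refine exists_aut_isActBy (natMonoid_le_abMonoid k) _ _ ?_
  rw [abChar_oneElt_eq_one, ← map_pow, units_pow_card_sub_one, map_one]

variable (k) in
/-- The homomorphism from `kˣ × Ẑ` to the automorphism group of the universal abelian Kummer
cover: `(u, t)` acts on sections as `(x, m/(q-1)) ↦ (u^m x^(q^t), m/(q-1))`. -/
noncomputable def gammaHom : kˣ × Multiplicative Zhat →* Aut (abCover k) :=
  MonoidHom.mk' (fun z => (exists_gamma k z).choose) fun z z' => by
    refine IsActBy.eq (exists_gamma k (z * z')).choose_spec ?_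
    have h := IsActBy.mul (exists_gamma k z).choose_spec (exists_gamma k z').choose_spec
    have h1 : abChar (unitsIncl k (z * z').1) =
        (Units.map ((frobZ k z.2 : AlgebraicClosure k →ₐ[k] AlgebraicClosure k) :
          AlgebraicClosure k →* AlgebraicClosure k)).comp (abChar (unitsIncl k z'.1)) *
            abChar (unitsIncl k z.1) := by
      refine abMonoid_hom_ext ?_
      rw [MonoidHom.mul_apply, MonoidHom.comp_apply, abChar_abElt, abChar_abElt, abChar_abElt,
        pow_one, pow_one, pow_one, map_unitsIncl, mul_comm, ← map_mul]
      rfl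
    rw [h1, Prod.snd_mul, map_mul]
    exact h

theorem isActBy_gammaHom (z : kˣ × Multiplicative Zhat) :
    IsActBy (hS := natMonoid_le_abMonoid k) (gammaHom k z) (frobZ k z.2)
      (abChar (unitsIncl k z.1)) := (exists_gamma k z).choose_spec

theorem gammaHom_injective : Function.Injective (gammaHom k) := by
  intro z z' h
  have h1 := isActBy_gammaHom z
  rw [h] at h1
  obtain ⟨h2, h3⟩ := h1.unique (isActBy_gammaHom z')
  refine Prod.ext (unitsIncl_injective ?_) (frobZ_injective h2)
  have h4 := DFunLike.congr_fun h3 (Multiplicative.ofAdd (abElt k 1))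
  rwa [abChar_abElt, abChar_abElt, pow_one, pow_one] at h4

theorem gammaHom_surjective : Function.Surjective (gammaHom k) := by
  intro g
  obtain ⟨ψ, χ, h, hχ⟩ := exists_isActBy (hS := natMonoid_le_abMonoid k) g
  obtain ⟨t, rfl⟩ := frobZ_surjective ψ
  rw [oneElt_eq_abElt, ofAdd_abElt, map_pow] at hχ
  obtain ⟨u, hu⟩ := exists_unitsIncl_eq hχ
  refine ⟨(u, t), IsActBy.eq (isActBy_gammaHom (u, t)) ?_⟩
  have h1 : abChar (unitsIncl k u) = χ := by
    refine abMonoid_hom_ext ?_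
    rw [abChar_abElt, pow_one, hu]
  rw [h1]
  exact h

variable (k) in
/-- The isomorphism of `kˣ × Ẑ` with the automorphism group of the universal abelian Kummer
cover. -/
noncomputable def gammaEquiv : kˣ × Multiplicative Zhat ≃* Aut (abCover k) :=
  MulEquiv.ofBijective (gammaHom k) ⟨gammaHom_injective, gammaHom_surjective⟩

theorem aut_abCover_comm (g h : Aut (abCover k)) : g * h = h * g := by
  obtain ⟨x, rfl⟩ := gammaHom_surjective g
  obtain ⟨y, rfl⟩ := gammaHom_surjective h
  rw [← map_mul, mul_comm, map_mul]

/-! ### Restriction of automorphisms to the universal abelian Kummer cover -/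

/-- The automorphism `g` of the universal Kummer cover lifts the automorphism `h` of the universal
abelian Kummer cover. -/
def IsLift (g : Aut (kumCover k)) (h : Aut (abCover k)) : Prop :=
  g.hom ≫ coverProj k = coverProj k ≫ h.hom

theorem iso_hom_comm_iff {C : Type*} [Category C] {A B : C} (g : A ≅ A) (h : B ≅ B)
    (p : A ⟶ B) : g.hom ≫ p = p ≫ h.hom ↔ g.inv ≫ p = p ≫ h.inv := by
  rw [← Iso.eq_inv_comp, ← Category.assoc, ← Iso.comp_inv_eq, eq_comm]

theorem isLift_iff_inv {g : Aut (kumCover k)} {h : Aut (abCover k)} :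
    IsLift g h ↔ g.inv ≫ coverProj k = coverProj k ≫ h.inv := iso_hom_comm_iff g h _

theorem IsLift.mul {g g' : Aut (kumCover k)} {h h' : Aut (abCover k)} (e : IsLift g h)
    (e' : IsLift g' h') : IsLift (g * g') (h * h') := by
  change (g'.hom ≫ g.hom) ≫ coverProj k = coverProj k ≫ h'.hom ≫ h.hom
  rw [Category.assoc, e, ← Category.assoc, e', Category.assoc]

theorem isLift_iff {g : Aut (kumCover k)} {h : Aut (abCover k)}
    {ψ ψ' : AlgebraicClosure k ≃ₐ[k] AlgebraicClosure k}
    {χ : Multiplicative (kumMonoid k) →* (AlgebraicClosure k)ˣ}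
    {χ' : Multiplicative (abMonoid k) →* (AlgebraicClosure k)ˣ}
    (hg : IsActBy (hS := natMonoid_le_kumMonoid k) g ψ χ)
    (hh : IsActBy (hS := natMonoid_le_abMonoid k) h ψ' χ') :
    IsLift g h ↔ ψ = ψ' ∧ χ (kumFrac card_sub_one_cast_ne_zero (Multiplicative.ofAdd 1)) =
      χ' (Multiplicative.ofAdd (abElt k 1)) := by
  have h0 := isGivenBy_hollowMap (k := k) (K := AlgebraicClosure k) (abMonoid_le_kumMonoid k)
  have h1 := IsGivenBy.comp hg h0
  have h2 := IsGivenBy.comp h0 hh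
  let ρ : Multiplicative (abMonoid k) →* (AlgebraicClosure k)ˣ :=
    (Units.map ((ψ : AlgebraicClosure k →ₐ[k] AlgebraicClosure k) :
      AlgebraicClosure k →* AlgebraicClosure k)).comp 1 *
      χ.comp (AddMonoidHom.toMultiplicative (AddSubmonoid.inclusion (abMonoid_le_kumMonoid k)))
  let ρ' : Multiplicative (abMonoid k) →* (AlgebraicClosure k)ˣ :=
    (Units.map ((AlgHom.id k (AlgebraicClosure k)) :
      AlgebraicClosure k →* AlgebraicClosure k)).comp χ' *
      (1 : Multiplicative (abMonoid k) →* (AlgebraicClosure k)ˣ).comp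
        (AddMonoidHom.toMultiplicative (AddSubmonoid.inclusion le_rfl))
  have h3 : ρ (Multiplicative.ofAdd (abElt k 1)) =
      χ (kumFrac card_sub_one_cast_ne_zero (Multiplicative.ofAdd 1)) := by
    rw [MonoidHom.mul_apply, MonoidHom.comp_apply, MonoidHom.comp_apply, MonoidHom.one_apply,
      map_one, one_mul, inclusion_abElt_one]
  have h4 : ρ' (Multiplicative.ofAdd (abElt k 1)) = χ' (Multiplicative.ofAdd (abElt k 1)) := by
    rw [MonoidHom.mul_apply, MonoidHom.comp_apply, MonoidHom.comp_apply, MonoidHom.one_apply,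
      mul_one]
    rfl
  rw [isLift_iff_inv]
  constructor
  · intro e
    obtain ⟨h5, h6⟩ := (IsGivenBy.eq_iff h1 h2).1 (congrArg CommaMorphism.left e)
    refine ⟨AlgEquiv.coe_toAlgHom_injective h5, ?_⟩
    rw [← h3, ← h4]
    exact DFunLike.congr_fun h6 _
  · rintro ⟨rfl, e⟩
    have h5 : ρ = ρ' := abMonoid_hom_ext (h3.trans (e.trans h4.symm))
    exact Over.OverMorphism.ext ((IsGivenBy.eq_iff h1 h2).2 ⟨rfl, h5⟩)

theorem IsLift.unique {g : Aut (kumCover k)} {h h' : Aut (abCover k)} (e : IsLift g h)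
    (e' : IsLift g h') : h = h' := by
  obtain ⟨ψ, χ, hg, -⟩ := exists_isActBy (hS := natMonoid_le_kumMonoid k) g
  obtain ⟨ψ₁, χ₁, hh, -⟩ := exists_isActBy (hS := natMonoid_le_abMonoid k) h
  obtain ⟨ψ₂, χ₂, hh', -⟩ := exists_isActBy (hS := natMonoid_le_abMonoid k) h'
  obtain ⟨rfl, h1⟩ := (isLift_iff hg hh).1 e
  obtain ⟨rfl, h2⟩ := (isLift_iff hg hh').1 e'
  obtain rfl : χ₁ = χ₂ := abMonoid_hom_ext (h1.symm.trans h2)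
  exact hh.eq hh'

theorem oneElt_kumMonoid_eq_pow : oneElt (natMonoid_le_kumMonoid k) =
    kumFrac (card_sub_one_cast_ne_zero (k := k)) (Multiplicative.ofAdd 1) ^ (Nat.card k - 1) := by
  rw [← inclusion_abElt_one, ← map_pow, ← ofAdd_abElt, ← oneElt_eq_abElt]
  rfl

theorem exists_isLift_of_aut_kumCover (g : Aut (kumCover k)) : ∃ h : Aut (abCover k), IsLift g h := by
  obtain ⟨ψ, χ, hg, hχ⟩ := exists_isActBy (hS := natMonoid_le_kumMonoid k) g
  obtain ⟨h, hh⟩ := exists_aut_isActBy (natMonoid_le_abMonoid k) ψ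
    (abChar (χ (kumFrac card_sub_one_cast_ne_zero (Multiplicative.ofAdd 1)))) (by
      rw [abChar_oneElt_eq_one, ← map_pow, ← oneElt_kumMonoid_eq_pow, hχ])
  refine ⟨h, (isLift_iff hg hh).2 ⟨rfl, ?_⟩⟩
  rw [abChar_abElt, pow_one]

theorem exists_isLift_of_aut_abCover (h : Aut (abCover k)) : ∃ g : Aut (kumCover k), IsLift g h := by
  obtain ⟨ψ, χ, hh, hχ⟩ := exists_isActBy (hS := natMonoid_le_abMonoid k) h
  obtain ⟨χ', hχ'⟩ := exists_kumMonoid_hom (χ (Multiplicative.ofAdd (abElt k 1)))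
  obtain ⟨g, hg⟩ := exists_aut_isActBy (natMonoid_le_kumMonoid k) ψ χ' (by
    rw [oneElt_kumMonoid_eq_pow, map_pow, hχ', ← map_pow, ← ofAdd_abElt, ← oneElt_eq_abElt, hχ])
  exact ⟨g, (isLift_iff hg hh).2 ⟨rfl, hχ'⟩⟩

variable (k) in
/-- Restriction of automorphisms from the universal Kummer cover to the universal abelian Kummer
cover. -/
noncomputable def restrictHom : Aut (kumCover k) →* Aut (abCover k) :=
  MonoidHom.mk' (fun g => (exists_isLift_of_aut_kumCover g).choose) fun g g' =>
    (exists_isLift_of_aut_kumCover (g * g')).choose_spec.unique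
      ((exists_isLift_of_aut_kumCover g).choose_spec.mul
        (exists_isLift_of_aut_kumCover g').choose_spec)

theorem isLift_restrictHom (g : Aut (kumCover k)) : IsLift g (restrictHom k g) :=
  (exists_isLift_of_aut_kumCover g).choose_spec

theorem isLift_iff_restrictHom {g : Aut (kumCover k)} {h : Aut (abCover k)} :
    IsLift g h ↔ restrictHom k g = h :=
  ⟨fun e => (isLift_restrictHom g).unique e, fun e => e ▸ isLift_restrictHom g⟩

theorem restrictHom_surjective : Function.Surjective (restrictHom k) := fun h =>
  (exists_isLift_of_aut_abCover h).imp fun _ => isLift_iff_restrictHom.1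

theorem restrictHom_eq_one_iff {g : Aut (kumCover k)}
    {ψ : AlgebraicClosure k ≃ₐ[k] AlgebraicClosure k}
    {χ : Multiplicative (kumMonoid k) →* (AlgebraicClosure k)ˣ}
    (hg : IsActBy (hS := natMonoid_le_kumMonoid k) g ψ χ) :
    restrictHom k g = 1 ↔
      ψ = 1 ∧ χ (kumFrac card_sub_one_cast_ne_zero (Multiplicative.ofAdd 1)) = 1 := by
  rw [← isLift_iff_restrictHom]
  exact isLift_iff hg IsActBy.one

/-- Division by `q - 1` is possible on `ℕ_(p)`, so the homomorphism `r ↦ χ (r / (q - 1))` has `χ` as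
its `(q - 1)`-th power. -/
theorem exists_root_kumMonoid (χ : Multiplicative (kumMonoid k) →* (AlgebraicClosure k)ˣ)
    (hχ : χ (kumFrac card_sub_one_cast_ne_zero (Multiplicative.ofAdd 1)) = 1) :
    ∃ χ' : Multiplicative (kumMonoid k) →* (AlgebraicClosure k)ˣ,
      χ' ^ (Nat.card k - 1) = χ ∧ χ' (oneElt (natMonoid_le_kumMonoid k)) = 1 := by
  have h0 : ((Nat.card k - 1 : ℕ) : ℚ≥0) ≠ 0 := by exact_mod_cast card_sub_one_ne_zero
  have hmem : ∀ r : kumMonoid k, (r : ℚ≥0) / (Nat.card k - 1 : ℕ) ∈ kumMonoid k := by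
    intro r
    have h1 : (((r : ℚ≥0).den * (Nat.card k - 1) : ℕ) : k) ≠ 0 := by
      rw [Nat.cast_mul]
      exact mul_ne_zero r.2 card_sub_one_cast_ne_zero
    have h2 := div_mem_kumMonoid h1 (r : ℚ≥0).num
    rwa [Nat.cast_mul, ← div_div, NNRat.num_div_den] at h2
  let D : kumMonoid k →+ kumMonoid k :=
    { toFun := fun r => ⟨_, hmem r⟩
      map_zero' := Subtype.ext (zero_div _)
      map_add' := fun r s => Subtype.ext (add_div _ _ _) }
  refine ⟨χ.comp (AddMonoidHom.toMultiplicative D), MonoidHom.ext fun r => ?_, ?_⟩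
  · rw [MonoidHom.pow_apply, MonoidHom.comp_apply, ← map_pow]
    refine congrArg χ (Multiplicative.toAdd.injective (Subtype.ext ?_))
    rw [toAdd_pow, AddSubmonoidClass.coe_nsmul, nsmul_eq_mul]
    exact mul_div_cancel₀ _ h0
  · rw [← hχ]
    refine congrArg χ (Multiplicative.toAdd.injective (Subtype.ext ?_))
    refine Eq.trans ?_ (coe_kumFrac card_sub_one_cast_ne_zero 1).symm
    change ((oneElt (natMonoid_le_kumMonoid k)).toAdd : ℚ≥0) / _ = _
    rw [coe_oneElt, Nat.cast_one]

open scoped commutatorElement in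
/-- An automorphism of the universal Kummer cover that is trivial on the universal abelian Kummer
cover is the commutator of a Frobenius lift and of an automorphism over the algebraic closure. -/
theorem ker_restrictHom_le_commutator : (restrictHom k).ker ≤ commutator (Aut (kumCover k)) := by
  intro g hg
  have := Fintype.ofFinite k
  obtain ⟨ψ, χ, hgψ, -⟩ := exists_isActBy (hS := natMonoid_le_kumMonoid k) g
  obtain ⟨rfl, hχ⟩ := (restrictHom_eq_one_iff hgψ).1 hg
  obtain ⟨χ', rfl, hχ'⟩ := exists_root_kumMonoid χ hχ
  let Fr := FiniteField.frobeniusAlgEquivOfAlgebraic k (AlgebraicClosure k)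
  obtain ⟨g₁, hg₁⟩ : ∃ g₁ : Aut (kumCover k), IsActBy (hS := natMonoid_le_kumMonoid k) g₁ Fr 1 :=
    exists_aut_isActBy (natMonoid_le_kumMonoid k) Fr 1 rfl
  obtain ⟨g₂, hg₂⟩ : ∃ g₂ : Aut (kumCover k), IsActBy (hS := natMonoid_le_kumMonoid k) g₂ 1 χ' :=
    exists_aut_isActBy (natMonoid_le_kumMonoid k) 1 χ' hχ'
  -- the Frobenius raises the values of `χ'` to the power `q`
  have h1 : g * (g₂ * g₁) = g₁ * g₂ := by
    refine IsActBy.eq (IsActBy.mul hgψ (IsActBy.mul hg₂ hg₁)) ?_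
    have h := IsActBy.mul hg₁ hg₂
    have h2 : (Units.map ((Fr : AlgebraicClosure k →ₐ[k] AlgebraicClosure k) :
          AlgebraicClosure k →* AlgebraicClosure k)).comp χ' * 1 =
        (Units.map (((1 : AlgebraicClosure k ≃ₐ[k] AlgebraicClosure k) :
          AlgebraicClosure k →ₐ[k] AlgebraicClosure k) :
            AlgebraicClosure k →* AlgebraicClosure k)).comp
          ((Units.map (((1 : AlgebraicClosure k ≃ₐ[k] AlgebraicClosure k) :
            AlgebraicClosure k →ₐ[k] AlgebraicClosure k) :
              AlgebraicClosure k →* AlgebraicClosure k)).comp 1 * χ') *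
            χ' ^ (Nat.card k - 1) := by
      refine MonoidHom.ext fun r => Units.ext ?_
      change (χ' r : AlgebraicClosure k) ^ Fintype.card k * 1 =
        1 * (χ' r : AlgebraicClosure k) * ((χ' r ^ (Nat.card k - 1) :
          (AlgebraicClosure k)ˣ) : AlgebraicClosure k)
      rw [one_mul, mul_one, Units.val_pow_eq_pow_val, ← pow_succ',
        Nat.sub_add_cancel (Finite.one_lt_card (α := k)).le, Fintype.card_eq_nat_card]
    rw [h2, mul_one, ← one_mul Fr, ← one_mul Fr] at h
    exact h
  have h3 : g = ⁅g₁, g₂⁆ := by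
    rw [commutatorElement_def, ← h1]
    group
  rw [h3]
  exact Subgroup.commutator_mem_commutator (Subgroup.mem_top _) (Subgroup.mem_top _)

end

section

variable {k : Type} [Field k] [Finite k]

/-! ### The abelianized fundamental group -/

/-- Two automorphisms of the log geometric point act in the same way on the standard point of a
standard cover if and only if they agree on the field `L` and at the element `1/m`. -/
theorem deck_act_stdPt_eq_iff {L : IntermediateField k (AlgebraicClosure k)} [FiniteDimensional k L]
    {m : ℕ} (hm : (m : k) ≠ 0) {g g' : Aut (kumCover k)}
    {ψ ψ' : AlgebraicClosure k ≃ₐ[k] AlgebraicClosure k}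
    {χ χ' : Multiplicative (kumMonoid k) →* (AlgebraicClosure k)ˣ}
    (hg : IsActBy (hS := natMonoid_le_kumMonoid k) g ψ χ)
    (hg' : IsActBy (hS := natMonoid_le_kumMonoid k) g' ψ' χ') :
    (deck (kumCover k) g).act _ (stdPt L hm) = (deck (kumCover k) g').act _ (stdPt L hm) ↔
      (∀ x ∈ L, ψ x = ψ' x) ∧
        χ (kumFrac hm (Multiplicative.ofAdd 1)) = χ' (kumFrac hm (Multiplicative.ofAdd 1)) := by
  have h := (isFibPt_stdPt L hm).deck hg
  have h' := (isFibPt_stdPt L hm).deck hg'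
  rw [map_one, one_mul] at h h'
  constructor
  · intro e
    rw [e] at h
    obtain ⟨h1, h2⟩ := h.unique h'
    exact ⟨fun x hx => DFunLike.congr_fun h1 ⟨x, hx⟩, h2⟩
  · rintro ⟨h1, h2⟩
    have h3 : (ψ : AlgebraicClosure k →ₐ[k] AlgebraicClosure k).comp L.val =
        (ψ' : AlgebraicClosure k →ₐ[k] AlgebraicClosure k).comp L.val :=
      AlgHom.ext fun x => h1 x x.2
    rw [h3, h2] at h
    exact h.eq h'

theorem deck_act_stdPt_of_restrictHom_eq_one (L : IntermediateField k (AlgebraicClosure k))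
    [FiniteDimensional k L] {g : Aut (kumCover k)} (hg : restrictHom k g = 1) :
    (deck (kumCover k) g).act _ (stdPt L card_sub_one_cast_ne_zero) =
      stdPt L card_sub_one_cast_ne_zero := by
  obtain ⟨ψ, χ, hgψ, -⟩ := exists_isActBy (hS := natMonoid_le_kumMonoid k) g
  obtain ⟨rfl, hχ⟩ := (restrictHom_eq_one_iff hgψ).1 hg
  have h := (deck_act_stdPt_eq_iff (L := L) card_sub_one_cast_ne_zero (g' := 1) hgψ
    IsActBy.one).2 ⟨fun x _ => rfl, hχ⟩
  rwa [map_one] at h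

theorem restrictHom_eq_one_of_deck_act_stdPt {g : Aut (kumCover k)}
    (hg : ∀ (L : IntermediateField k (AlgebraicClosure k)) (_ : FiniteDimensional k L),
      (deck (kumCover k) g).act _ (stdPt L card_sub_one_cast_ne_zero) =
        stdPt L card_sub_one_cast_ne_zero) : restrictHom k g = 1 := by
  obtain ⟨ψ, χ, hgψ, -⟩ := exists_isActBy (hS := natMonoid_le_kumMonoid k) g
  have h : ∀ (L : IntermediateField k (AlgebraicClosure k)) (_ : FiniteDimensional k L),
      (∀ x ∈ L, ψ x = x) ∧ χ (kumFrac card_sub_one_cast_ne_zero (Multiplicative.ofAdd 1)) = 1 := by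
    intro L hL
    refine (deck_act_stdPt_eq_iff (L := L) card_sub_one_cast_ne_zero (g' := 1) hgψ
      IsActBy.one).1 ?_
    rw [map_one]
    exact hg L hL
  refine (restrictHom_eq_one_iff hgψ).2 ⟨AlgEquiv.ext fun x => ?_, (h ⊥ inferInstance).2⟩
  have := IntermediateField.adjoin.finiteDimensional (K := k) (Algebra.IsIntegral.isIntegral x)
  exact (h (IntermediateField.adjoin k {x}) this).1 x (IntermediateField.mem_adjoin_simple_self k x)

/-- The stabilizer of a point of a cover. -/
def LogScheme.LogPi1.stab {X : LogScheme} {s : Over X} (Y : KCov X) (y : (Fib s).obj Y) :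
    Subgroup (LogPi1 s) where
  carrier := {σ | σ.act Y y = y}
  one_mem' := rfl
  mul_mem' {σ τ} hσ hτ := (congrArg (σ.act Y) hτ).trans hσ
  inv_mem' {σ} hσ := by
    change σ⁻¹.act Y y = y
    conv_lhs => rw [← show σ.act Y y = y from hσ]
    rw [← LogPi1.act_mul, inv_mul_cancel]
    rfl

theorem LogScheme.LogPi1.isClosed_stab {X : LogScheme} {s : Over X} (Y : KCov X)
    (y : (Fib s).obj Y) : IsClosed (LogPi1.stab Y y : Set (LogPi1 s)) :=
  Subgroup.isClosed_of_isOpen _ (LogPi1.isOpen_act Y y y)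

open scoped commutatorElement in
/-- The closure of the commutator subgroup acts trivially on the universal abelian Kummer cover,
because it fixes the standard points of the covers of index `q - 1`. -/
theorem restrictHom_eq_one_of_deck_mem {g : Aut (kumCover k)}
    (hg : deck (kumCover k) g ∈ (commutator (LogPi1 (kumCover k))).topologicalClosure) :
    restrictHom k g = 1 := by
  refine restrictHom_eq_one_of_deck_act_stdPt fun L hL => ?_
  refine Subgroup.topologicalClosure_minimal _ ?_
    (LogPi1.isClosed_stab (stdCov L card_sub_one_cast_ne_zero) (stdPt L _)) hg
  rw [commutator_def, Subgroup.commutator_le]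
  intro σ _ τ _
  obtain ⟨a, rfl⟩ := deck_surjective σ
  obtain ⟨b, rfl⟩ := deck_surjective τ
  rw [← map_commutatorElement]
  refine deck_act_stdPt_of_restrictHom_eq_one L ?_
  rw [map_commutatorElement, commutatorElement_eq_one_iff_mul_comm]
  exact aut_abCover_comm _ _

variable (k) in
/-- The class in the abelianized fundamental group of the element defined by an automorphism of the
log geometric point. -/
noncomputable def deckAb : Aut (kumCover k) →* Pi1Ab k :=
  (QuotientGroup.mk' _).comp (deck (kumCover k))

theorem ker_restrictHom_le_ker_deckAb : (restrictHom k).ker ≤ (deckAb k).ker :=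
  ker_restrictHom_le_commutator.trans (Abelianization.commutator_subset_ker (deckAb k))

variable (k) in
/-- The homomorphism from the automorphism group of the universal abelian Kummer cover to the
abelianized fundamental group: lift an automorphism to the universal Kummer cover. -/
noncomputable def psiHom : Aut (abCover k) →* Pi1Ab k :=
  (restrictHom k).liftOfSurjective restrictHom_surjective ⟨deckAb k, ker_restrictHom_le_ker_deckAb⟩

theorem psiHom_restrictHom (g : Aut (kumCover k)) : psiHom k (restrictHom k g) = deckAb k g :=
  MonoidHom.liftOfRightInverse_comp_apply _ _ _ _ g

theorem psiHom_surjective : Function.Surjective (psiHom k) := by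
  intro x
  obtain ⟨σ, rfl⟩ := QuotientGroup.mk_surjective x
  obtain ⟨g, rfl⟩ := deck_surjective σ
  exact ⟨restrictHom k g, psiHom_restrictHom g⟩

theorem psiHom_injective : Function.Injective (psiHom k) := by
  rw [injective_iff_map_eq_one]
  intro h hh
  obtain ⟨g, rfl⟩ := restrictHom_surjective h
  rw [psiHom_restrictHom] at hh
  exact restrictHom_eq_one_of_deck_mem ((QuotientGroup.eq_one_iff _).1 hh)

variable (k) in
/-- The automorphism group of the universal abelian Kummer cover is the abelianized fundamental
group. -/
noncomputable def psiEquiv : Aut (abCover k) ≃* Pi1Ab k :=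
  MulEquiv.ofBijective (psiHom k) ⟨psiHom_injective, psiHom_surjective⟩

/-! ### The topology of the abelianized fundamental group -/

theorem exists_lift_gamma (u : kˣ) : ∃ χ : Multiplicative (kumMonoid k) →* (AlgebraicClosure k)ˣ,
    χ (kumFrac card_sub_one_cast_ne_zero (Multiplicative.ofAdd 1)) = unitsIncl k u ∧
    χ (oneElt (natMonoid_le_kumMonoid k)) = 1 := by
  obtain ⟨χ, hχ⟩ := exists_kumMonoid_hom (unitsIncl k u)
  refine ⟨χ, hχ, ?_⟩
  rw [oneElt_kumMonoid_eq_pow, map_pow, hχ, ← map_pow, units_pow_card_sub_one, map_one]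

theorem exists_isActBy_lift (u : kˣ) (t : Multiplicative Zhat) : ∃ g : Aut (kumCover k),
    IsActBy (hS := natMonoid_le_kumMonoid k) g (frobZ k t) (exists_lift_gamma u).choose :=
  exists_aut_isActBy (natMonoid_le_kumMonoid k) _ _ (exists_lift_gamma u).choose_spec.2

theorem psiHom_gammaHom (z : kˣ × Multiplicative Zhat) :
    psiHom k (gammaHom k z) = deckAb k (exists_isActBy_lift z.1 z.2).choose := by
  have hg := (exists_isActBy_lift z.1 z.2).choose_spec
  have h : restrictHom k (exists_isActBy_lift z.1 z.2).choose = gammaHom k z := by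
    rw [← isLift_iff_restrictHom, isLift_iff hg (isActBy_gammaHom z)]
    refine ⟨rfl, ?_⟩
    rw [abChar_abElt, pow_one]
    exact (exists_lift_gamma z.1).choose_spec.1
  rw [← h, psiHom_restrictHom]

theorem continuous_deck_lift [TopologicalSpace k] [DiscreteTopology k] :
    Continuous fun z : kˣ × Multiplicative Zhat =>
      deck (kumCover k) (exists_isActBy_lift z.1 z.2).choose := by
  rw [LogPi1.continuous_iff]
  intro Y y w
  obtain ⟨L, hL, m, hm, F, rfl⟩ := exists_stdPt_map Y y
  obtain ⟨n, hn⟩ := exists_pow_card_pow_of_finiteDimensional L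
  let f : kˣ × Multiplicative Zhat → kˣ × ZMod n := fun z => (z.1, z.2.toAdd.1 n)
  have hf : Continuous f := by
    refine continuous_fst.prodMk ?_
    exact (continuous_apply n).comp
      (continuous_subtype_val.comp (continuous_toAdd.comp continuous_snd))
  -- the action on the point depends only on the image under `f`
  have key : ∀ z z', f z = f z' →
      (deck (kumCover k) (exists_isActBy_lift z.1 z.2).choose).act _ (stdPt L hm) =
      (deck (kumCover k) (exists_isActBy_lift z'.1 z'.2).choose).act _ (stdPt L hm) := by
    rintro ⟨u, t⟩ ⟨u', t'⟩ h
    obtain ⟨rfl, ht⟩ : u = u' ∧ t.toAdd.1 n = t'.toAdd.1 n := Prod.ext_iff.1 h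
    refine (deck_act_stdPt_eq_iff hm (exists_isActBy_lift u t).choose_spec
      (exists_isActBy_lift u t').choose_spec).2 ⟨fun x hx => ?_, rfl⟩
    rw [frobZ_apply _ (hn x hx), frobZ_apply _ (hn x hx), ht]
  let S := {z : kˣ × Multiplicative Zhat |
    (deck (kumCover k) (exists_isActBy_lift z.1 z.2).choose).act Y
      ((Fib (kumCover k)).map F (stdPt L hm)) = w}
  have hS : S = f ⁻¹' (f '' S) := by
    refine (Set.subset_preimage_image f S).antisymm ?_
    rintro z ⟨z', hz', e⟩
    change _ = w
    rw [← show _ = w from hz', LogPi1.act_map, LogPi1.act_map, key z' z e]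
  change IsOpen S
  rw [hS]
  exact (isOpen_discrete _).preimage hf

theorem isClosed_zhat : IsClosed (Zhat : Set (∀ n : ℕ+, ZMod n)) := by
  have h : (Zhat : Set (∀ n : ℕ+, ZMod n)) =
      ⋂ (m : ℕ+) (n : ℕ+) (h : (m : ℕ) ∣ n), {t | ZMod.castHom h (ZMod m) (t n) = t m} := by
    ext t
    simp only [Set.mem_iInter]
    rfl
  rw [h]
  refine isClosed_iInter fun m => isClosed_iInter fun n => isClosed_iInter fun h => ?_
  exact isClosed_eq (continuous_of_discreteTopology.comp (continuous_apply n)) (continuous_apply m)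

instance : CompactSpace Zhat := isCompact_iff_compactSpace.1 isClosed_zhat.isCompact

instance : T2Space (Pi1Ab k) := by
  have : IsClosed ((commutator (LogPi1 (kumCover k))).topologicalClosure :
      Set (LogPi1 (kumCover k))) := Subgroup.isClosed_topologicalClosure _
  infer_instance

theorem isHomeomorph_psi_gamma [TopologicalSpace k] [DiscreteTopology k] :
    IsHomeomorph fun z : kˣ × Multiplicative Zhat => psiEquiv k (gammaEquiv k z) := by
  rw [isHomeomorph_iff_continuous_bijective]
  refine ⟨?_, (psiEquiv k).bijective.comp (gammaEquiv k).bijective⟩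
  have h : (fun z : kˣ × Multiplicative Zhat => psiEquiv k (gammaEquiv k z)) = fun z =>
      QuotientGroup.mk (deck (kumCover k) (exists_isActBy_lift z.1 z.2).choose) :=
    funext psiHom_gammaHom
  rw [h]
  exact continuous_quot_mk.comp continuous_deck_lift

end

/-! ### A criterion for profinite completions -/

open ProfiniteGrp.ProfiniteCompletion in
/-- A homomorphism `ι` with dense image from `G` to a profinite group `A` is the profinite completion
as soon as every finite quotient map of `G` is the composition of `ι` and of a locally constant map
on `A`. -/
theorem exists_completion_equiv {G A : Type} [Group G] [Group A] [TopologicalSpace A]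
    [IsTopologicalGroup A] [CompactSpace A] [TotallyDisconnectedSpace A] (ι : G →* A)
    (hι : DenseRange ι)
    (hp : ∀ N : FiniteIndexNormalSubgroup G, ∃ p : A → G ⧸ N.toSubgroup,
      (∀ U, IsOpen (p ⁻¹' U)) ∧ ∀ g, p (ι g) = QuotientGroup.mk g) :
    ∃ e : completion (GrpCat.of G) ≃ₜ* A, ∀ g : G, e (etaFn (GrpCat.of G) g) = ι g := by
  let f : completion (GrpCat.of G) ⟶ ProfiniteGrp.of A :=
    lift (P := ProfiniteGrp.of A) (GrpCat.ofHom ι)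
  let F : completion (GrpCat.of G) →ₜ* A := f.hom
  have hF : ∀ g : G, F (etaFn (GrpCat.of G) g) = ι g := fun g =>
    ConcreteCategory.congr_hom (lift_eta (P := ProfiniteGrp.of A) (GrpCat.ofHom ι)) g
  have hcont : Continuous F := F.continuous_toFun
  have hsurj : Function.Surjective F := by
    rw [← Set.range_eq_univ, ← (isCompact_range hcont).isClosed.closure_eq]
    refine (hι.mono ?_).closure_eq
    rintro _ ⟨g, rfl⟩
    exact ⟨_, hF g⟩
  have hinj : Function.Injective F := by
    have key : ∀ (N : FiniteIndexNormalSubgroup G) (p : A → G ⧸ N.toSubgroup),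
        (∀ U, IsOpen (p ⁻¹' U)) → (∀ g, p (ι g) = QuotientGroup.mk g) →
        ∀ c : completion (GrpCat.of G), p (F c) = c.1 N := by
      intro N p hp1 hp2 c
      have h1 : IsOpen {y : completion (GrpCat.of G) | y.1 N = c.1 N} := by
        have : DiscreteTopology ((diagram (GrpCat.of G)).obj N) := ⟨rfl⟩
        have h2 : Continuous fun y : completion (GrpCat.of G) => y.1 N :=
          (continuous_apply N).comp continuous_subtype_val
        exact (isOpen_discrete {c.1 N}).preimage h2
      have h2 : IsOpen {y : completion (GrpCat.of G) | p (F y) = p (F c)} :=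
        (hp1 {p (F c)}).preimage hcont
      obtain ⟨y, ⟨hy1, hy2⟩, g, rfl⟩ := (denseRange (GrpCat.of G)).inter_open_nonempty _
        (h1.inter h2) ⟨c, rfl, rfl⟩
      refine hy2.symm.trans (Eq.trans ?_ hy1)
      rw [hF g]
      exact hp2 g
    intro c c' h
    refine Subtype.ext (funext fun N => ?_)
    obtain ⟨p, hp1, hp2⟩ := hp N
    rw [← key N p hp1 hp2 c, ← key N p hp1 hp2 c', h]
  let E := Continuous.homeoOfEquivCompactToT2 (f := Equiv.ofBijective F ⟨hinj, hsurj⟩) hcont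
  exact ⟨{ E with map_mul' := map_mul F }, hF⟩

/-! ### The profinite integers -/

theorem denseRange_intToZhat : DenseRange intToZhat := by
  refine dense_iff_inter_open.2 ?_
  rintro U ⟨V, hV, rfl⟩ ⟨t, ht⟩
  obtain ⟨I, W, hI, hW⟩ := isOpen_pi_iff.1 hV t.1 ht
  refine ⟨intToZhat ((t.1 (∏ m ∈ I, m)).val : ℤ), hW fun m hm => ?_, _, rfl⟩
  have h1 : (m : ℕ) ∣ (∏ m ∈ I, m : ℕ+) := PNat.dvd_iff.1 (Finset.dvd_prod_of_mem _ hm)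
  have h2 : (intToZhat ((t.1 (∏ m ∈ I, m)).val : ℤ)).1 m = t.1 m := by
    change (((t.1 (∏ m ∈ I, m)).val : ℤ) : ZMod m) = _
    rw [Int.cast_natCast, ← ZMod.natCast_zmod_val (t.1 m), ZMod.natCast_eq_natCast_iff]
    exact zhat_val_modEq t h1
  rw [h2]
  exact (hI m hm).2

section

variable {k : Type} [Field k]

/-! ### The logarithmic multiplicative group of the log point -/

variable (k) in
/-- The global sections of the log structure of the standard log point are `kˣ × ℕ`. -/
noncomputable def secEquiv :
    kˣ × Multiplicative ℕ ≃* (logPoint k).sec (logPoint k).top :=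
  MulEquiv.ofBijective
    ({ toFun := fun z => hollowSec z.1 (natElt z.2.toAdd)
       map_one' := (congrArg _ (Subtype.ext Nat.cast_zero)).trans hollowSec_one
       map_mul' := fun z z' =>
        (congrArg _ (Subtype.ext (Nat.cast_add z.2.toAdd z'.2.toAdd))).trans
          (hollowSec_mul z.1 z'.1 (natElt z.2.toAdd) (natElt z'.2.toAdd)).symm } :
      kˣ × Multiplicative ℕ →* (logPoint k).sec (logPoint k).top)
    ⟨fun z z' h => by
      obtain ⟨h1, h2⟩ := hollowSec_inj h
      exact Prod.ext h1 (Multiplicative.toAdd.injective (natEquiv.injective h2)), fun m => by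
      obtain ⟨x, r, rfl⟩ := exists_hollowSec m
      obtain ⟨n, rfl⟩ := natEquiv.surjective r
      exact ⟨(x, Multiplicative.ofAdd n), rfl⟩⟩

theorem secEquiv_apply (x : kˣ) (n : ℕ) :
    secEquiv k (x, Multiplicative.ofAdd n) = hollowSec x (natElt n) := rfl

variable (k) in
/-- The homomorphism `(x, n) ↦ (x, n)` from the global sections to `kˣ × ℤ`. -/
noncomputable def secHom : (logPoint k).sec (logPoint k).top →* kˣ × Multiplicative ℤ :=
  ((MonoidHom.id kˣ).prodMap (AddMonoidHom.toMultiplicative (Nat.castAddMonoidHom ℤ))).comp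
    (secEquiv k).symm.toMonoidHom

theorem secHom_hollowSec (x : kˣ) (n : ℕ) :
    secHom k (hollowSec x (natElt n)) = (x, Multiplicative.ofAdd (n : ℤ)) := by
  rw [← secEquiv_apply]
  exact congrArg ((MonoidHom.id kˣ).prodMap
    (AddMonoidHom.toMultiplicative (Nat.castAddMonoidHom ℤ))) ((secEquiv k).symm_apply_apply _)

theorem secHom_injective : Function.Injective (secHom k) :=
  (Prod.map_injective.2 ⟨Function.injective_id, fun a b h => Multiplicative.toAdd.injective
    (Nat.cast_injective (R := ℤ) (Multiplicative.ofAdd.injective h))⟩).comp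
    (secEquiv k).symm.injective

theorem exists_secHom_div (z : kˣ × Multiplicative ℤ) : ∃ a b, z = secHom k a / secHom k b := by
  refine ⟨hollowSec z.1 (natElt z.2.toAdd.toNat), hollowSec 1 (natElt (-z.2.toAdd).toNat), ?_⟩
  rw [secHom_hollowSec, secHom_hollowSec]
  refine Prod.ext (div_one _).symm (Multiplicative.toAdd.injective ?_)
  exact (Int.toNat_sub_toNat_neg _).symm

variable (k) in
/-- The logarithmic multiplicative group of the log point is `kˣ × ℤ`. -/
noncomputable def thetaEquiv : Gmlog (logPoint k) ≃* kˣ × Multiplicative ℤ :=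
  MulEquiv.ofBijective (Algebra.GrothendieckGroup.lift (secHom k))
    (bijective_grothendieckLift _ secHom_injective exists_secHom_div)

theorem thetaEquiv_of (x : kˣ) (n : ℕ) :
    thetaEquiv k (Algebra.GrothendieckGroup.of (hollowSec x (natElt n))) =
      (x, Multiplicative.ofAdd (n : ℤ)) :=
  (DFunLike.congr_fun (Algebra.GrothendieckGroup.lift.symm_apply_apply (secHom k)) _).trans
    (secHom_hollowSec x n)

theorem eq_thetaEquiv (θ : Gmlog (logPoint k) ≃* kˣ × Multiplicative ℤ)
    (h : ∀ (x : kˣ) (n : ℕ), θ (Algebra.GrothendieckGroup.of (hollowSec x (natElt n))) =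
      (x, Multiplicative.ofAdd (n : ℤ))) : θ = thetaEquiv k := by
  refine MulEquiv.toMonoidHom_injective (Algebra.GrothendieckGroup.lift.symm.injective ?_)
  refine MonoidHom.ext fun m => ?_
  obtain ⟨x, r, rfl⟩ := exists_hollowSec m
  obtain ⟨n, rfl⟩ := natEquiv.surjective r
  exact (h x n).trans (thetaEquiv_of x n).symm

/-! ### Characterization of the isomorphisms -/

variable [Finite k]

theorem globalFlat_gammaEquiv (u : kˣ) (t : Zhat) (n : ℕ+) (x : (AlgebraicClosure k)ˣ) (m : ℕ)
    (hx : x ^ Nat.card k ^ (n : ℕ) = x) :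
    globalFlat (gammaEquiv k (u, Multiplicative.ofAdd t)).inv.left (hollowSec x (abElt k m)) =
      hollowSec (unitsIncl k u ^ m * x ^ Nat.card k ^ (t.1 n).val) (abElt k m) := by
  refine ((isActBy_gammaHom (u, Multiplicative.ofAdd t)).2 x (abElt k m)).trans ?_
  refine congrArg₂ hollowSec ?_ rfl
  rw [abChar_abElt, mul_comm]
  refine congrArg _ (Units.ext ?_)
  have hx' : (x : AlgebraicClosure k) ^ Nat.card k ^ (n : ℕ) = x := congrArg Units.val hx
  exact frobZ_apply (Multiplicative.ofAdd t) hx'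

theorem eq_gammaEquiv (γ : kˣ × Multiplicative Zhat ≃* Aut (abCover k))
    (h : ∀ (u : kˣ) (t : Zhat) (n : ℕ+) (x : (AlgebraicClosure k)ˣ) (m : ℕ),
      x ^ Nat.card k ^ (n : ℕ) = x →
      globalFlat (γ (u, Multiplicative.ofAdd t)).inv.left (hollowSec x (abElt k m)) =
        hollowSec (unitsIncl k u ^ m * x ^ Nat.card k ^ (t.1 n).val) (abElt k m)) :
    γ = gammaEquiv k := by
  refine MulEquiv.ext fun ⟨u, t⟩ => ?_
  obtain ⟨ψ, χ, hγ, -⟩ := exists_isActBy (hS := natMonoid_le_abMonoid k) (γ (u, t))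
  obtain ⟨ψ', χ', hγ', -⟩ := exists_isActBy (hS := natMonoid_le_abMonoid k) (gammaEquiv k (u, t))
  have key : ∀ (x : (AlgebraicClosure k)ˣ) (m : ℕ),
      Units.map ((ψ : AlgebraicClosure k →ₐ[k] AlgebraicClosure k) :
        AlgebraicClosure k →* AlgebraicClosure k) x * χ (Multiplicative.ofAdd (abElt k m)) =
      Units.map ((ψ' : AlgebraicClosure k →ₐ[k] AlgebraicClosure k) :
        AlgebraicClosure k →* AlgebraicClosure k) x * χ' (Multiplicative.ofAdd (abElt k m)) := by
    intro x m
    obtain ⟨n, hn⟩ := exists_pow_card_pow (x : AlgebraicClosure k)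
    have hn' : x ^ Nat.card k ^ (n : ℕ) = x := Units.ext hn
    have h1 := (h u t.toAdd n x m hn').trans (globalFlat_gammaEquiv u t.toAdd n x m hn').symm
    exact (hollowSec_inj ((hγ.2 x (abElt k m)).symm.trans (h1.trans (hγ'.2 x (abElt k m))))).1
  have hχ : χ = χ' := abMonoid_hom_ext (by simpa using key 1 1)
  subst hχ
  have hψ : ψ = ψ' := by
    refine AlgEquiv.ext fun x => ?_
    rcases eq_or_ne x 0 with rfl | hx
    · rw [map_zero, map_zero]
    · exact congrArg Units.val (mul_right_cancel (key (Units.mk0 x hx) 1))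
  subst hψ
  exact hγ.eq hγ'

theorem psiEquiv_of_isLift {g : Aut (kumCover k)} {h : Aut (abCover k)} (e : IsLift g h) :
    psiEquiv k h = QuotientGroup.mk (deck (kumCover k) g) := by
  rw [← isLift_iff_restrictHom.1 e]
  exact psiHom_restrictHom g

theorem eq_psiEquiv (Ψ : Aut (abCover k) ≃* Pi1Ab k)
    (hΨ : ∀ (g : Aut (kumCover k)) (h : Aut (abCover k)), IsLift g h →
      Ψ h = QuotientGroup.mk (deck (kumCover k) g)) : Ψ = psiEquiv k := by
  refine MulEquiv.ext fun h => ?_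
  obtain ⟨g, hg⟩ := exists_isLift_of_aut_abCover h
  rw [hΨ g h hg, psiEquiv_of_isLift hg]

/-! ### The reciprocity homomorphism -/

variable (k) in
/-- The homomorphism from the logarithmic multiplicative group to `kˣ × Ẑ`. -/
noncomputable def toZhat : Gmlog (logPoint k) →* kˣ × Multiplicative Zhat :=
  ((MonoidHom.id kˣ).prodMap (AddMonoidHom.toMultiplicative intToZhat)).comp
    (thetaEquiv k).toMonoidHom

theorem toZhat_apply (z : Gmlog (logPoint k)) : toZhat k z = ((thetaEquiv k z).1,
    Multiplicative.ofAdd (intToZhat (thetaEquiv k z).2.toAdd)) := rfl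

theorem exists_completion_equiv_zhat [TopologicalSpace k] [DiscreteTopology k] :
    ∃ e : ProfiniteGrp.ProfiniteCompletion.completion (GrpCat.of (Gmlog (logPoint k))) ≃ₜ*
        kˣ × Multiplicative Zhat,
      ∀ z : Gmlog (logPoint k),
        e (ProfiniteGrp.ProfiniteCompletion.etaFn (GrpCat.of (Gmlog (logPoint k))) z) =
          toZhat k z := by
  refine exists_completion_equiv (toZhat k) ?_ fun N => ?_
  · have h : DenseRange (Prod.map id (AddMonoidHom.toMultiplicative intToZhat) :
        kˣ × Multiplicative ℤ → kˣ × Multiplicative Zhat) :=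
      denseRange_id.prodMap denseRange_intToZhat
    rw [DenseRange, ← (thetaEquiv k).surjective.range_comp] at h
    exact h
  · -- every `n`-th power lies in `N`, where `n` is the index of `N`
    have hn0 : N.toSubgroup.index ≠ 0 := Subgroup.FiniteIndex.index_ne_zero
    let n : ℕ+ := ⟨N.toSubgroup.index, Nat.pos_of_ne_zero hn0⟩
    let f : kˣ × Multiplicative Zhat → kˣ × ZMod n := fun z => (z.1, z.2.toAdd.1 n)
    have hf : Continuous f := continuous_fst.prodMk ((continuous_apply n).comp
      (continuous_subtype_val.comp (continuous_toAdd.comp continuous_snd)))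
    let p : kˣ × ZMod n → Gmlog (logPoint k) ⧸ N.toSubgroup := fun z =>
      QuotientGroup.mk ((thetaEquiv k).symm (z.1, Multiplicative.ofAdd (z.2.val : ℤ)))
    refine ⟨p ∘ f, fun U => (isOpen_discrete (p ⁻¹' U)).preimage hf, fun g => ?_⟩
    obtain ⟨⟨u, a⟩, rfl⟩ := (thetaEquiv k).symm.surjective g
    rw [toZhat_apply, MulEquiv.apply_symm_apply]
    refine QuotientGroup.eq.2 ?_
    obtain ⟨c, hc⟩ : ((n : ℕ) : ℤ) ∣ a.toAdd - ((a.toAdd : ZMod n).val : ℤ) := by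
      rw [← ZMod.intCast_zmod_eq_zero_iff_dvd, Int.cast_sub, Int.cast_natCast,
        ZMod.natCast_zmod_val, sub_self]
    change ((thetaEquiv k).symm (u, Multiplicative.ofAdd ((a.toAdd : ZMod n).val : ℤ)))⁻¹ *
      (thetaEquiv k).symm (u, a) ∈ N.toSubgroup
    have h1 : (u, Multiplicative.ofAdd ((a.toAdd : ZMod n).val : ℤ))⁻¹ * (u, a) =
        ((1 : kˣ), Multiplicative.ofAdd c) ^ (n : ℕ) := by
      refine Prod.ext ((inv_mul_cancel u).trans (one_pow _).symm) ?_
      refine Multiplicative.toAdd.injective ?_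
      change -((a.toAdd : ZMod n).val : ℤ) + a.toAdd = (n : ℕ) • c
      rw [nsmul_eq_mul, ← hc]
      ring
    rw [← map_inv, ← map_mul, h1, map_pow]
    exact Subgroup.pow_index_mem _ _

end

end LogCFT

open CategoryTheory LogCFT LogCFT.LogScheme in
theorem proposition6p3 (k : Type) [Field k] [Finite k] [TopologicalSpace k] [DiscreteTopology k] :
    ∃! Rec : Gmlog (logPoint k) →* Pi1Ab k,
      ∃ (θ : Gmlog (logPoint k) ≃* kˣ × Multiplicative ℤ)
        (γ : kˣ × Multiplicative Zhat ≃* Aut (abCover k))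
        (Ψ : Aut (abCover k) ≃* Pi1Ab k),
        (∀ (x : kˣ) (n : ℕ),
          θ (Algebra.GrothendieckGroup.of (hollowSec x (natElt n))) =
            (x, Multiplicative.ofAdd (n : ℤ))) ∧
        (∀ (u : kˣ) (t : Zhat) (n : ℕ+) (x : (AlgebraicClosure k)ˣ) (m : ℕ),
          x ^ (Nat.card k ^ (n : ℕ)) = x →
          globalFlat (γ (u, Multiplicative.ofAdd t)).inv.left (hollowSec x (abElt k m)) =
            hollowSec ((Units.map (algebraMap k (AlgebraicClosure k)).toMonoidHom u) ^ m *
              x ^ (Nat.card k ^ (t.1 n).val)) (abElt k m)) ∧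
        (∀ h : Aut (abCover k), ∃ g : Aut (kumCover k),
          g.hom ≫ coverProj k = coverProj k ≫ h.hom) ∧
        (∀ (g : Aut (kumCover k)) (h : Aut (abCover k)),
          g.hom ≫ coverProj k = coverProj k ≫ h.hom →
          Ψ h = QuotientGroup.mk (deck (kumCover k) g)) ∧
        IsHomeomorph (fun z : kˣ × Multiplicative Zhat => Ψ (γ z)) ∧
        (∀ z : Gmlog (logPoint k), Rec z =
          Ψ (γ ((θ z).1, Multiplicative.ofAdd (intToZhat (θ z).2.toAdd)))) ∧
        ∃ e : ProfiniteGrp.ProfiniteCompletion.completion (GrpCat.of (Gmlog (logPoint k))) ≃ₜ*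
            Pi1Ab k,
          ∀ z : Gmlog (logPoint k),
            e (ProfiniteGrp.ProfiniteCompletion.etaFn (GrpCat.of (Gmlog (logPoint k))) z) =
              Rec z := by
  refine ⟨((psiEquiv k).toMonoidHom.comp (gammaEquiv k).toMonoidHom).comp (toZhat k),
    ⟨thetaEquiv k, gammaEquiv k, psiEquiv k, thetaEquiv_of, globalFlat_gammaEquiv,
      exists_isLift_of_aut_abCover, fun _ _ => psiEquiv_of_isLift, isHomeomorph_psi_gamma,
      fun _ => rfl, ?_⟩, ?_⟩
  · obtain ⟨e, he⟩ := exists_completion_equiv_zhat (k := k)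
    let e' : kˣ × Multiplicative Zhat ≃ₜ* Pi1Ab k :=
      { (gammaEquiv k).trans (psiEquiv k) with
        continuous_toFun := isHomeomorph_psi_gamma.continuous
        continuous_invFun := ((gammaEquiv k).trans (psiEquiv k)).toEquiv.continuous_symm_iff.2
          isHomeomorph_psi_gamma.isOpenMap }
    exact ⟨e.trans e', fun z => congrArg e' (he z)⟩
  · rintro Rec ⟨θ, γ, Ψ, hθ, hγ, -, hΨ, -, hRec, -⟩
    obtain rfl := eq_thetaEquiv θ hθ
    obtain rfl := eq_gammaEquiv γ hγ
    obtain rfl := eq_psiEquiv Ψ hΨ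
    exact MonoidHom.ext hRec
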